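/- Let $k$ be a field and let $Q$ be a finite quiver without oriented cycles (for example a quiver of Euclidean type $\widetilde{\mathbb A}_m,\widetilde{\mathbb D}_m,\widetilde{\mathbb E}_6,\widetilde{\mathbb E}_7,\widetilde{\mathbb E}_8$). Modules are finite dimensional $k$-representations of $Q$, equivalently finite dimensional right $kQ$-modules; $uX$ denotes the direct sum of $u$ copies of $X$. A module is called *exceptional* if it is indecomposable and $\operatorname{Ext}^1(M,M)=0$. A pair $(Y,X)$ of exceptional modules is an *orthogonal exceptional pair* if $\operatorname{Hom}(X,Y)=\operatorname{Hom}(Y,X)=\operatorname{Ext}^1(X,Y)=0$. A *Schofield sequence* is a short exact sequence $0\to uX\xrightarrow{f} Z\xrightarrow{g} vY\to 0$ in which $(Y,X)$ is an orthogonal exceptional pair, $Z$ is exceptional and $u,v$ are positive integers. For a vertex $i$ let $S(i)$ be the simple module at $i$ and $\sigma_iQ$ the quiver obtained from $Q$ by reversing all arrows involving $i$. If $i$ is a sink, the reflection functor $S_i^+$ from representations of $Q$ to representations of $\sigma_iQ$ replaces $M_i$ by the kernel of the map $\bigoplus_{\alpha:a\to i}M_a\to M_i$; if $i$ is a source, the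 reflection functor $S_i^-$ replaces $M_i$ by the cokernel of the map $M_i\to\bigoplus_{\alpha:i\to b}M_b$. Let $D=\operatorname{Hom}_k(-,k)$, and let $\tau=D\operatorname{Ext}^1(-,kQ)$ and $\tau^{-1}=\operatorname{Ext}^1(D(kQ),-)$ be the Auslander–Reiten translations. Let $0\to uX\xrightarrow{f} Z\xrightarrow{g} vY\to 0$ be a Schofield sequence. 1. If $i$ is a sink and $X$ is not isomorphic to the simple projective module $S(i)$, then $0\to uS_i^+X\to S_i^+Z\to vS_i^+Y\to 0$, with the maps $S_i^+(f)$, $S_i^+(g)$, is a Schofield sequence over $\sigma_iQ$. 2. If $i$ is a source and $Y$ is not isomorphic to the simple injective module $S(i)$, then $0\to uS_i^-X\to S_i^-Z\to vS_i^-Y\to 0$, with the maps $S_i^-(f)$, $S_i^-(g)$, is a Schofield sequence over $\sigma_iQ$. 3. If $X$ is not projective, then $0\to u\tau X\to\tau Z\to v\tau Y\to 0$, with the maps $\tau(f)$, $\tau(g)$, is a Schofield sequence over $Q$. 4. If $Y$ is not injective, then $0\to u\tau^{-1}X\to\tau^{-1}Z\to v\tau^{-1}Y\to 0$, with the maps $\tau^{-1}(f)$,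 $\tau^{-1}(g)$, is a Schofield sequence over $Q$. (Here $F(uX)$ is identified with $uF(X)$ and $F(vY)$ with $vF(Y)$ in the canonical way for each of these additive functors $F$.) -/

import Mathlib

open CategoryTheory CategoryTheory.Limits CategoryTheory.Abelian

universe u

noncomputable section

namespace QuiverRep

/-! ### Quivers -/

section Quivers

variable (Q : Type u) [Quiver.{u} Q]

/-- There are no oriented cycles: every path from a vertex to itself is trivial. -/
def IsAcyclic : Prop :=
  ∀ (a : Q) (p : Quiver.Path a a), p.length = 0

variable {Q}

/-- A vertex at which no arrow starts. -/
def IsSink (i : Q) : Prop :=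
  ∀ b : Q, IsEmpty (i ⟶ b)

theorem IsSink.ne {i a : Q} (hi : IsSink i) (e : a ⟶ i) : a ≠ i := by
  rintro rfl
  exact (hi a).false e

/-- A vertex at which no arrow ends. -/
def IsSource (i : Q) : Prop :=
  ∀ a : Q, IsEmpty (a ⟶ i)

/-- The arrows of the quiver obtained by reversing all arrows which involve the vertex `i`. -/
inductive ReflArrow (i : Q) : Q → Q → Type u
  | keep {a b : Q} (ha : a ≠ i) (hb : b ≠ i) (e : a ⟶ b) : ReflArrow i a b
  | flipIn {a : Q} (e : a ⟶ i) : ReflArrow i i a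
  | flipOut {b : Q} (hb : b ≠ i) (e : i ⟶ b) : ReflArrow i b i

/-- The vertices of the reflected quiver `σ_i Q`; they are those of `Q`. -/
@[nolint unusedArguments]
def Reflected (_i : Q) : Type u := Q

/-- The reflected quiver `σ_i Q`. -/
instance (i : Q) : Quiver.{u} (Reflected i) where
  Hom a b := ReflArrow (Q := Q) i a b

end Quivers

end QuiverRep

/-- The category of all `k`-representations of the quiver `Q`, that is, of functors from the
category of paths of `Q` to `k`-vector spaces. Finite dimensionality is the predicate
`QuiverRep.IsFinDim`. -/
abbrev QuiverRep (k : Type u) [Field k] (Q : Type u) [Quiver.{u} Q] : Type (u + 1) :=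
  Paths Q ⥤ ModuleCat.{u} k

namespace QuiverRep

variable {k : Type u} [Field k] {Q : Type u} [Quiver.{u} Q]

/-- The vector space of a representation at a vertex. -/
def space (M : QuiverRep k Q) (j : Q) : ModuleCat.{u} k :=
  M.obj j

/-- The linear map of a representation at an arrow. -/
def arrowMap (M : QuiverRep k Q) {a b : Q} (e : a ⟶ b) : space M a ⟶ space M b :=
  M.map (X := a) (Y := b) e.toPath

/-- The component of a morphism of representations at a vertex. -/
def homAt {M N : QuiverRep k Q} (φ : M ⟶ N) (j : Q) : space M j ⟶ space N j :=
  φ.app j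

@[simp]
theorem homAt_id (M : QuiverRep k Q) (j : Q) : homAt (𝟙 M) j = 𝟙 (space M j) := rfl

@[simp]
theorem homAt_comp {M N L : QuiverRep k Q} (φ : M ⟶ N) (ψ : N ⟶ L) (j : Q) :
    homAt (φ ≫ ψ) j = homAt φ j ≫ homAt ψ j := rfl

theorem hom_ext {M N : QuiverRep k Q} {φ ψ : M ⟶ N} (h : ∀ j : Q, homAt φ j = homAt ψ j) :
    φ = ψ :=
  NatTrans.ext (funext h)

theorem arrowMap_homAt {M N : QuiverRep k Q} (φ : M ⟶ N) {a b : Q} (e : a ⟶ b) :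
    arrowMap M e ≫ homAt φ b = homAt φ a ≫ arrowMap N e :=
  φ.naturality _

theorem arrowMap_homAt_assoc {M N : QuiverRep k Q} (φ : M ⟶ N) {a b : Q} (e : a ⟶ b)
    {V : ModuleCat.{u} k} (t : space N b ⟶ V) :
    arrowMap M e ≫ homAt φ b ≫ t = homAt φ a ≫ arrowMap N e ≫ t := by
  rw [← Category.assoc, arrowMap_homAt, Category.assoc]

/-- A representation is finite dimensional if its space at every vertex is. -/
def IsFinDim (M : QuiverRep k Q) : Prop :=
  ∀ j : Q, Module.Finite k (space M j)

/-- The representation given by a family of vector spaces and of linear maps at the arrows. -/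
def mk (V : Q → ModuleCat.{u} k) (f : ∀ a b : Q, (a ⟶ b) → (V a ⟶ V b)) : QuiverRep k Q :=
  Paths.lift { obj := V, map := fun {a b} e => f a b e }

theorem space_mk (V : Q → ModuleCat.{u} k) (f : ∀ a b : Q, (a ⟶ b) → (V a ⟶ V b)) (j : Q) :
    space (mk V f) j = V j := rfl

theorem arrowMap_mk (V : Q → ModuleCat.{u} k) (f : ∀ a b : Q, (a ⟶ b) → (V a ⟶ V b))
    {a b : Q} (e : a ⟶ b) : arrowMap (mk V f) e = f a b e :=
  Paths.lift_toPath _ e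

/-- A morphism of representations is a family of linear maps compatible with the arrows. -/
def homMk {M N : QuiverRep k Q} (φ : ∀ j : Q, space M j ⟶ space N j)
    (h : ∀ (a b : Q) (e : a ⟶ b), arrowMap M e ≫ φ b = φ a ≫ arrowMap N e) : M ⟶ N where
  app j := φ j
  naturality {a b} p := by
    refine Paths.induction_fixed_source
      (P := fun {b} p => M.map p ≫ φ b = φ a ≫ N.map p) ?_ ?_ p
    · rw [M.map_id, N.map_id]
      exact (Category.id_comp _).trans (Category.comp_id _).symm
    · intro b c p e hp
      have hc := h b c e
      have h1 : M.map (p ≫ (Paths.of Q).map e) = M.map p ≫ arrowMap M e := M.map_comp _ _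
      have h2 : N.map (p ≫ (Paths.of Q).map e) = N.map p ≫ arrowMap N e := N.map_comp _ _
      rw [h1, h2]
      exact (Category.assoc _ _ _).trans ((congrArg (fun t => M.map p ≫ t) hc).trans
        ((Category.assoc _ _ _).symm.trans ((congrArg (fun t => t ≫ arrowMap N e) hp).trans
          (Category.assoc _ _ _))))

@[simp]
theorem homAt_homMk {M N : QuiverRep k Q} (φ : ∀ j : Q, space M j ⟶ space N j)
    (h : ∀ (a b : Q) (e : a ⟶ b), arrowMap M e ≫ φ b = φ a ≫ arrowMap N e) (j : Q) :
    homAt (homMk φ h) j = φ j := rfl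

/-! ### Indecomposable projectives, injectives and simples -/

variable (k Q)

/-- The representations `P(j) = k[paths starting at j]`, contravariantly functorial in `j`. Their
direct sum over `j` is the regular representation `kQ`. -/
def proj : (Paths Q)ᵒᵖ ⥤ QuiverRep k Q :=
  coyoneda ⋙ (Functor.whiskeringRight (Paths Q) (Type u) (ModuleCat.{u} k)).obj (ModuleCat.free k)

/-- The representations `I(j) = D k[paths ending at j]`, contravariantly functorial in `j`. Their
direct sum over `j` is the representation `D(kQ)`. -/
def inj : (Paths Q)ᵒᵖ ⥤ QuiverRep k Q where
  obj j :=
    { obj := fun l => ModuleCat.of k (Module.Dual k ((l ⟶ j.unop) →₀ k))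
      map := fun p => ModuleCat.ofHom (Finsupp.lmapDomain k k (fun q => p ≫ q)).dualMap
      map_id := fun l => by
        ext x
        simp
      map_comp := fun p q => by
        ext x
        simp }
  map r :=
    { app := fun l => ModuleCat.ofHom (Finsupp.lmapDomain k k (fun q => q ≫ r.unop)).dualMap
      naturality := fun l l' p => by
        ext x
        simp }
  map_id j := by
    ext l x
    simp
  map_comp r s := by
    ext l x
    simp

open scoped Classical in
variable {Q} in
/-- The simple representation `S(i)`: the field at `i`, zero at the other vertices, and all arrows
acting as zero. -/
def simpleRep (i : Q) : QuiverRep k Q :=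
  mk (fun j => if j = i then ModuleCat.of k k else ModuleCat.of k PUnit) (fun _ _ _ => 0)


/-! ### Ext groups -/

variable {k Q}

/-- The morphism from `P(j)` which sends the trivial path at `j` to a given element. -/
def projDesc (M : QuiverRep k Q) (j : Paths Q) (x : M.obj j) :
    (proj k Q).obj (Opposite.op j) ⟶ M where
  app l := ModuleCat.ofHom (Finsupp.linearCombination k
    (fun q : j ⟶ l => (M.map q).hom x))
  naturality l l' p := by
    apply ModuleCat.hom_ext
    apply Finsupp.lhom_ext'
    intro q
    apply LinearMap.ext_ring
    change Finsupp.linearCombination k _ (Finsupp.mapDomain (fun q => q ≫ p) (Finsupp.single q 1)) =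
      (M.map p).hom (Finsupp.linearCombination k _ (Finsupp.single q 1))
    rw [Finsupp.mapDomain_single, Finsupp.linearCombination_single,
      Finsupp.linearCombination_single, one_smul, one_smul, M.map_comp]
    rfl

theorem projDesc_apply (M : QuiverRep k Q) (j : Paths Q) (x : M.obj j) :
    ((projDesc M j x).app j).hom (Finsupp.single (𝟙 j) (1 : k)) = x := by
  change Finsupp.linearCombination k _ (Finsupp.single (𝟙 j) (1 : k)) = x
  rw [Finsupp.linearCombination_single, one_smul, M.map_id]
  rfl

theorem proj_hom_ext {M : QuiverRep k Q} {j : Paths Q}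
    {f g : (proj k Q).obj (Opposite.op j) ⟶ M}
    (h : (f.app j).hom (Finsupp.single (𝟙 j) (1 : k)) =
      (g.app j).hom (Finsupp.single (𝟙 j) (1 : k))) : f = g := by
  have key : ∀ (f : (proj k Q).obj (Opposite.op j) ⟶ M) (l : Paths Q) (q : j ⟶ l),
      (f.app l).hom (Finsupp.single q (1 : k)) =
        (M.map q).hom ((f.app j).hom (Finsupp.single (𝟙 j) (1 : k))) := by
    intro f l q
    have h1 := LinearMap.congr_fun (congrArg ModuleCat.Hom.hom (f.naturality q))
      (Finsupp.single (𝟙 j) (1 : k))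
    change (f.app l).hom (Finsupp.mapDomain (fun r => r ≫ q) (Finsupp.single (𝟙 j) (1 : k))) =
      (M.map q).hom ((f.app j).hom (Finsupp.single (𝟙 j) (1 : k))) at h1
    rw [Finsupp.mapDomain_single, Category.id_comp] at h1
    exact h1
  apply NatTrans.ext
  funext l
  apply ModuleCat.hom_ext
  apply Finsupp.lhom_ext'
  intro q
  apply LinearMap.ext_ring
  change (f.app l).hom (Finsupp.single q (1 : k)) = (g.app l).hom (Finsupp.single q (1 : k))
  rw [key f, key g, h]

instance (j : Paths Q) : Projective ((proj k Q).obj (Opposite.op j)) where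
  factors {E X} f e he := by
    have he' : Epi (e.app j) := inferInstance
    obtain ⟨y, hy⟩ := (ModuleCat.epi_iff_surjective (e.app j)).1 he'
      ((f.app j).hom (Finsupp.single (𝟙 j) (1 : k)))
    refine ⟨projDesc E j y, proj_hom_ext ?_⟩
    change (e.app j).hom (((projDesc E j y).app j).hom (Finsupp.single (𝟙 j) (1 : k))) = _
    rw [projDesc_apply]
    exact hy

instance : EnoughProjectives (QuiverRep k Q) where
  presentation M := ⟨{
    p := ∐ fun x : (Σ j : Paths Q, M.obj j) => (proj k Q).obj (Opposite.op x.1)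
    f := Sigma.desc fun x => projDesc M x.1 x.2
    epi := by
      refine NatTrans.epi_iff_epi_app _ |>.2 fun j => ?_
      refine (ModuleCat.epi_iff_surjective _).2 fun x => ?_
      have h := congrArg (fun t => NatTrans.app t j) (Sigma.ι_desc
        (fun x : (Σ j : Paths Q, M.obj j) => projDesc M x.1 x.2) ⟨j, x⟩)
      have h2 := LinearMap.congr_fun (congrArg ModuleCat.Hom.hom h)
        (Finsupp.single (𝟙 j) (1 : k))
      exact ⟨_, h2.trans (projDesc_apply M j x)⟩ }⟩

instance : HasFiniteBiproducts (QuiverRep k Q) :=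
  Abelian.hasFiniteBiproducts

/-- The groups `Ext` of representations live in the universe of the representations. -/
instance : HasExt.{u} (QuiverRep k Q) :=
  hasExt_of_enoughProjectives.{u} _

/-! ### Auslander-Reiten translations -/

/-- The representation `D Ext¹(M, kQ)`, with component `D Ext¹(M, P(j))` at the vertex `j`. -/
def tauObj (M : QuiverRep k Q) : QuiverRep k Q where
  obj j := ModuleCat.of k (Module.Dual k (Abelian.Ext M ((proj k Q).obj (Opposite.op j)) 1))
  map p := ModuleCat.ofHom (LinearMap.dualMap
    (Ext.postcompOfLinear (Ext.mk₀ ((proj k Q).map p.op)) k M (add_zero 1)))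
  map_id j := by
    ext x
    simp
  map_comp p q := by
    ext x
    simp

variable (k Q)

/-- The Auslander-Reiten translation `τ = D Ext¹(-, kQ)`. -/
def tau : QuiverRep k Q ⥤ QuiverRep k Q where
  obj := tauObj
  map {M N} f :=
    { app := fun j => ModuleCat.ofHom (LinearMap.dualMap
        (Ext.precompOfLinear (Ext.mk₀ f) k ((proj k Q).obj (Opposite.op j)) (zero_add 1)))
      naturality := fun j l p => by
        apply ModuleCat.hom_ext
        apply LinearMap.ext
        intro (x : Module.Dual k _)
        apply LinearMap.ext
        intro α
        exact congrArg x (Ext.comp_assoc (Ext.mk₀ f) α (Ext.mk₀ ((proj k Q).map p.op))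
          (zero_add 1) (add_zero 1) (a := 1) (by lia)) }
  map_id M := by
    apply NatTrans.ext
    funext j
    apply ModuleCat.hom_ext
    apply LinearMap.ext
    intro x
    apply LinearMap.ext
    intro α
    exact congrArg (DFunLike.coe (F := Module.Dual k _) x) (Ext.mk₀_id_comp α)
  map_comp f g := by
    apply NatTrans.ext
    funext j
    apply ModuleCat.hom_ext
    apply LinearMap.ext
    intro x
    apply LinearMap.ext
    intro α
    exact congrArg (DFunLike.coe (F := Module.Dual k _) x) (Ext.mk₀_comp_mk₀_assoc f g α).symm

/-- The inverse Auslander-Reiten translation `τ⁻¹ = Ext¹(D(kQ), -)`, with component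
`Ext¹(I(j), M)` at the vertex `j`. -/
def tauInv : QuiverRep k Q ⥤ QuiverRep k Q where
  obj M :=
    { obj := fun j => ModuleCat.of k (Abelian.Ext ((inj k Q).obj (Opposite.op j)) M 1)
      map := fun p => ModuleCat.ofHom
        (Ext.precompOfLinear (Ext.mk₀ ((inj k Q).map p.op)) k M (zero_add 1))
      map_id := fun j => by
        ext x
        simp
      map_comp := fun p q => by
        ext x
        simp }
  map {M N} f :=
    { app := fun j => ModuleCat.ofHom
        (Ext.postcompOfLinear (Ext.mk₀ f) k ((inj k Q).obj (Opposite.op j)) (add_zero 1))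
      naturality := fun j l p => by
        ext x
        simp }
  map_id M := by
    ext j x
    simp
  map_comp f g := by
    ext j x
    simp

/-! ### Reflection functors -/

variable {k Q}

open scoped Classical in
/-- The vector spaces of a representation `M`, with the one at the vertex `i` replaced by `V`. -/
def replaceObj (M : QuiverRep k Q) (i : Q) (V : ModuleCat.{u} k) (j : Q) : ModuleCat.{u} k :=
  if j = i then V else space M j

/-- The space at the vertex `i` is the new one. -/
def replaceSelf (M : QuiverRep k Q) (i : Q) (V : ModuleCat.{u} k) : replaceObj M i V i ≅ V :=
  eqToIso (if_pos rfl)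

/-- The space at any other vertex is the old one. -/
def replaceNe (M : QuiverRep k Q) {i : Q} (V : ModuleCat.{u} k) {j : Q} (h : j ≠ i) :
    replaceObj M i V j ≅ space M j :=
  eqToIso (if_neg h)

open scoped Classical in
/-- A morphism of representations, with the linear map at the vertex `i` replaced by `ψ`. -/
def replaceHom {M N : QuiverRep k Q} {i : Q} {V W : ModuleCat.{u} k} (φ : M ⟶ N) (ψ : V ⟶ W)
    (j : Q) : replaceObj M i V j ⟶ replaceObj N i W j :=
  if h : j = i then
    eqToHom (by rw [h]) ≫ (replaceSelf M i V).hom ≫ ψ ≫ (replaceSelf N i W).inv ≫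
      eqToHom (by rw [h])
  else (replaceNe M V h).hom ≫ homAt φ j ≫ (replaceNe N W h).inv

theorem replaceHom_self {M N : QuiverRep k Q} {i : Q} {V W : ModuleCat.{u} k} (φ : M ⟶ N)
    (ψ : V ⟶ W) : replaceHom (i := i) φ ψ i =
      (replaceSelf M i V).hom ≫ ψ ≫ (replaceSelf N i W).inv := by
  simp [replaceHom]

theorem replaceHom_ne {M N : QuiverRep k Q} {i : Q} {V W : ModuleCat.{u} k} (φ : M ⟶ N)
    (ψ : V ⟶ W) {j : Q} (h : j ≠ i) : replaceHom (i := i) φ ψ j =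
      (replaceNe M V h).hom ≫ homAt φ j ≫ (replaceNe N W h).inv := by
  simp [replaceHom, h]

theorem replaceHom_id (M : QuiverRep k Q) (i : Q) (V : ModuleCat.{u} k) (j : Q) :
    replaceHom (i := i) (𝟙 M) (𝟙 V) j = 𝟙 _ := by
  by_cases h : j = i
  · subst h
    rw [replaceHom_self]
    simp
  · rw [replaceHom_ne _ _ h]
    simp

theorem replaceHom_comp {M N L : QuiverRep k Q} {i : Q} {V W U : ModuleCat.{u} k}
    (φ : M ⟶ N) (φ' : N ⟶ L) (ψ : V ⟶ W) (ψ' : W ⟶ U) (j : Q) :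
    replaceHom (i := i) (φ ≫ φ') (ψ ≫ ψ') j = replaceHom φ ψ j ≫ replaceHom φ' ψ' j := by
  by_cases h : j = i
  · subst h
    simp only [replaceHom_self]
    simp
  · simp only [replaceHom_ne _ _ h]
    simp

variable [Finite Q] [∀ a b : Q, Finite (a ⟶ b)]

/-- The map from the direct sum of the spaces `M_a`, over the arrows `a ⟶ i`, to `M_i`. -/
def sinkMap (M : QuiverRep k Q) (i : Q) :
    (⨁ fun e : (Σ a : Q, (a ⟶ i)) => space M e.1) ⟶ space M i :=
  biproduct.desc fun e => arrowMap M e.2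

/-- The map from `M_i` to the direct sum of the spaces `M_b`, over the arrows `i ⟶ b`. -/
def sourceMap (M : QuiverRep k Q) (i : Q) :
    space M i ⟶ ⨁ fun e : (Σ b : Q, (i ⟶ b)) => space M e.1 :=
  biproduct.lift fun e => arrowMap M e.2

/-- The map induced on the kernels of `sinkMap`. -/
def sinkKernelMap {M N : QuiverRep k Q} (φ : M ⟶ N) (i : Q) :
    kernel (sinkMap M i) ⟶ kernel (sinkMap N i) :=
  kernel.map _ _ (biproduct.map fun e => homAt φ e.1) (homAt φ i) (by
    apply biproduct.hom_ext'
    intro e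
    simp [sinkMap, arrowMap_homAt])

/-- The map induced on the cokernels of `sourceMap`. -/
def sourceCokernelMap {M N : QuiverRep k Q} (φ : M ⟶ N) (i : Q) :
    cokernel (sourceMap M i) ⟶ cokernel (sourceMap N i) :=
  cokernel.map _ _ (homAt φ i) (biproduct.map fun e => homAt φ e.1) (by
    apply biproduct.hom_ext
    intro e
    simp [sourceMap, arrowMap_homAt])

theorem sinkKernelMap_id (M : QuiverRep k Q) (i : Q) : sinkKernelMap (𝟙 M) i = 𝟙 _ := by
  have h : (biproduct.map fun e : (Σ a : Q, (a ⟶ i)) => 𝟙 (space M e.1)) = 𝟙 _ := by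
    apply biproduct.hom_ext
    intro e
    simp
  rw [← cancel_mono (kernel.ι _)]
  simp [sinkKernelMap, h]

theorem sinkKernelMap_comp {M N L : QuiverRep k Q} (φ : M ⟶ N) (ψ : N ⟶ L) (i : Q) :
    sinkKernelMap (φ ≫ ψ) i = sinkKernelMap φ i ≫ sinkKernelMap ψ i := by
  have h : (biproduct.map fun e : (Σ a : Q, (a ⟶ i)) => homAt φ e.1 ≫ homAt ψ e.1) =
      (biproduct.map fun e : (Σ a : Q, (a ⟶ i)) => homAt φ e.1) ≫
        biproduct.map fun e : (Σ a : Q, (a ⟶ i)) => homAt ψ e.1 := by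
    apply biproduct.hom_ext
    intro e
    simp
  rw [← cancel_mono (kernel.ι _)]
  simp [sinkKernelMap, h]

theorem sourceCokernelMap_id (M : QuiverRep k Q) (i : Q) : sourceCokernelMap (𝟙 M) i = 𝟙 _ := by
  have h : (biproduct.map fun e : (Σ b : Q, (i ⟶ b)) => 𝟙 (space M e.1)) = 𝟙 _ := by
    apply biproduct.hom_ext
    intro e
    simp
  rw [← cancel_epi (cokernel.π _)]
  simp [sourceCokernelMap, h]

theorem sourceCokernelMap_comp {M N L : QuiverRep k Q} (φ : M ⟶ N) (ψ : N ⟶ L) (i : Q) :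
    sourceCokernelMap (φ ≫ ψ) i = sourceCokernelMap φ i ≫ sourceCokernelMap ψ i := by
  have h : (biproduct.map fun e : (Σ b : Q, (i ⟶ b)) => homAt φ e.1 ≫ homAt ψ e.1) =
      (biproduct.map fun e : (Σ b : Q, (i ⟶ b)) => homAt φ e.1) ≫
        biproduct.map fun e : (Σ b : Q, (i ⟶ b)) => homAt ψ e.1 := by
    apply biproduct.hom_ext
    intro e
    simp
  rw [← cancel_epi (cokernel.π _)]
  simp [sourceCokernelMap, h]

/-- The arrows of the reflection of `M` at a sink `i`: an arrow not involving `i` acts as in `M`, and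
the reverse of an arrow `a ⟶ i` acts as the component `ker (⨁ M_a ⟶ M_i) ⟶ M_a`. -/
def reflectSinkMap {i : Q} (hi : IsSink i) (M : QuiverRep k Q) : ∀ {a b : Q}, ReflArrow i a b →
    (replaceObj M i (kernel (sinkMap M i)) a ⟶ replaceObj M i (kernel (sinkMap M i)) b)
  | _, _, .keep ha hb e => (replaceNe M _ ha).hom ≫ arrowMap M e ≫ (replaceNe M _ hb).inv
  | _, _, .flipIn (a := a) e =>
      (replaceSelf M i _).hom ≫ kernel.ι (sinkMap M i) ≫
        biproduct.π (fun e : (Σ a : Q, (a ⟶ i)) => space M e.1) ⟨a, e⟩ ≫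
        (replaceNe M _ (hi.ne e)).inv
  | _, _, .flipOut _ e => ((hi _).false e).elim

/-- The arrows of the reflection of `M` at a source `i`: an arrow not involving `i` acts as in `M`,
and the reverse of an arrow `i ⟶ b` acts as the component `M_b ⟶ coker (M_i ⟶ ⨁ M_b)`. -/
def reflectSourceMap {i : Q} (hi : IsSource i) (M : QuiverRep k Q) : ∀ {a b : Q}, ReflArrow i a b →
    (replaceObj M i (cokernel (sourceMap M i)) a ⟶ replaceObj M i (cokernel (sourceMap M i)) b)
  | _, _, .keep ha hb e => (replaceNe M _ ha).hom ≫ arrowMap M e ≫ (replaceNe M _ hb).inv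
  | _, _, .flipIn e => ((hi _).false e).elim
  | _, _, .flipOut (b := b) hb e =>
      (replaceNe M _ hb).hom ≫
        biproduct.ι (fun e : (Σ b : Q, (i ⟶ b)) => space M e.1) ⟨b, e⟩ ≫
        cokernel.π (sourceMap M i) ≫ (replaceSelf M i _).inv

theorem reflectSinkMap_naturality {i : Q} (hi : IsSink i) {M N : QuiverRep k Q} (φ : M ⟶ N)
    {a b : Q} (r : ReflArrow i a b) :
    reflectSinkMap hi M r ≫ replaceHom φ (sinkKernelMap φ i) b =
      replaceHom φ (sinkKernelMap φ i) a ≫ reflectSinkMap hi N r := by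
  cases r with
  | keep ha hb e =>
    rw [replaceHom_ne _ _ ha, replaceHom_ne _ _ hb]
    simp [reflectSinkMap, arrowMap_homAt_assoc]
  | flipIn e =>
    rw [replaceHom_self, replaceHom_ne _ _ (hi.ne e)]
    simp [reflectSinkMap, sinkKernelMap]
  | flipOut hb e => exact ((hi _).false e).elim

theorem reflectSourceMap_naturality {i : Q} (hi : IsSource i) {M N : QuiverRep k Q} (φ : M ⟶ N)
    {a b : Q} (r : ReflArrow i a b) :
    reflectSourceMap hi M r ≫ replaceHom φ (sourceCokernelMap φ i) b =
      replaceHom φ (sourceCokernelMap φ i) a ≫ reflectSourceMap hi N r := by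
  cases r with
  | keep ha hb e =>
    rw [replaceHom_ne _ _ ha, replaceHom_ne _ _ hb]
    simp [reflectSourceMap, arrowMap_homAt_assoc]
  | flipIn e => exact ((hi _).false e).elim
  | flipOut hb e =>
    rw [replaceHom_self, replaceHom_ne _ _ hb]
    simp [reflectSourceMap, sourceCokernelMap]

/-- The reflection of a representation at a sink. -/
def reflectSinkObj {i : Q} (hi : IsSink i) (M : QuiverRep k Q) : QuiverRep k (Reflected i) :=
  mk (Q := Reflected i) (fun j => replaceObj (Q := Q) M i (kernel (sinkMap M i)) j)
    fun _ _ r => reflectSinkMap hi M r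

/-- The reflection of a representation at a source. -/
def reflectSourceObj {i : Q} (hi : IsSource i) (M : QuiverRep k Q) : QuiverRep k (Reflected i) :=
  mk (Q := Reflected i) (fun j => replaceObj (Q := Q) M i (cokernel (sourceMap M i)) j) fun _ _ r =>
    reflectSourceMap hi M r

variable (k)

/-- The Bernstein-Gelfand-Ponomarev reflection functor `S⁺_i` at a sink `i`. It replaces the space
`M_i` by the kernel of the map `⨁ M_a ⟶ M_i`, the sum being over all arrows `a ⟶ i`. -/
def reflectSink {i : Q} (hi : IsSink i) : QuiverRep k Q ⥤ QuiverRep k (Reflected i) where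
  obj M := reflectSinkObj hi M
  map {M N} φ := homMk (Q := Reflected i) (M := reflectSinkObj hi M) (N := reflectSinkObj hi N)
    (fun j => replaceHom (Q := Q) (i := i) φ (sinkKernelMap φ i) j) (by
      intro a b r
      refine Eq.trans ?_ ((reflectSinkMap_naturality hi φ r).trans ?_)
      · exact congrArg (fun t => t ≫ _) (arrowMap_mk _ _ r)
      · exact congrArg (fun t => _ ≫ t) (arrowMap_mk _ _ r).symm)
  map_id M := by
    apply hom_ext
    intro j
    exact (congrArg (fun t => replaceHom (Q := Q) (i := i) (𝟙 M) t j) (sinkKernelMap_id M i)).trans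
      (replaceHom_id M i (kernel (sinkMap M i)) j)
  map_comp {M N L} φ ψ := by
    apply hom_ext
    intro j
    exact (congrArg (fun t => replaceHom (Q := Q) (i := i) (φ ≫ ψ) t j)
      (sinkKernelMap_comp φ ψ i)).trans
        (replaceHom_comp φ ψ (sinkKernelMap φ i) (sinkKernelMap ψ i) j)

/-- The Bernstein-Gelfand-Ponomarev reflection functor `S⁻_i` at a source `i`. It replaces the space
`M_i` by the cokernel of the map `M_i ⟶ ⨁ M_b`, the sum being over all arrows `i ⟶ b`. -/
def reflectSource {i : Q} (hi : IsSource i) : QuiverRep k Q ⥤ QuiverRep k (Reflected i) where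
  obj M := reflectSourceObj hi M
  map {M N} φ := homMk (Q := Reflected i) (M := reflectSourceObj hi M)
    (N := reflectSourceObj hi N)
    (fun j => replaceHom (Q := Q) (i := i) φ (sourceCokernelMap φ i) j) (by
      intro a b r
      refine Eq.trans ?_ ((reflectSourceMap_naturality hi φ r).trans ?_)
      · exact congrArg (fun t => t ≫ _) (arrowMap_mk _ _ r)
      · exact congrArg (fun t => _ ≫ t) (arrowMap_mk _ _ r).symm)
  map_id M := by
    apply hom_ext
    intro j
    exact (congrArg (fun t => replaceHom (Q := Q) (i := i) (𝟙 M) t j)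
      (sourceCokernelMap_id M i)).trans
      (replaceHom_id M i (cokernel (sourceMap M i)) j)
  map_comp {M N L} φ ψ := by
    apply hom_ext
    intro j
    exact (congrArg (fun t => replaceHom (Q := Q) (i := i) (φ ≫ ψ) t j)
      (sourceCokernelMap_comp φ ψ i)).trans
        (replaceHom_comp φ ψ (sourceCokernelMap φ i) (sourceCokernelMap ψ i) j)

/-! ### Schofield sequences -/

section Schofield

variable {k Q : Type u} [Field k] [Quiver.{u} Q]

/-- A finite dimensional indecomposable representation without self-extensions. -/
structure IsExceptional (M : QuiverRep k Q) : Prop where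
  finDim : IsFinDim M
  indecomposable : Indecomposable M
  ext_self : Subsingleton (Abelian.Ext M M 1)

/-- The pair `(Y, X)` is an orthogonal exceptional pair. -/
structure IsOrthogonalExceptionalPair (Y X : QuiverRep k Q) : Prop where
  exceptional_left : IsExceptional Y
  exceptional_right : IsExceptional X
  hom_right_left : Subsingleton (X ⟶ Y)
  hom_left_right : Subsingleton (Y ⟶ X)
  ext_right_left : Subsingleton (Abelian.Ext X Y 1)

/-- The sequence `0 ⟶ uX ⟶ Z ⟶ vY ⟶ 0` with maps `f` and `g` is a Schofield sequence. -/
structure IsSchofieldSequence (u v : ℕ) (X Z Y : QuiverRep k Q)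
    (f : (⨁ fun _ : Fin u => X) ⟶ Z) (g : Z ⟶ ⨁ fun _ : Fin v => Y) : Prop where
  pair : IsOrthogonalExceptionalPair Y X
  exceptional : IsExceptional Z
  pos_left : 0 < u
  pos_right : 0 < v
  exact : ∃ w : f ≫ g = 0, (ShortComplex.mk f g w).ShortExact

variable {Q' : Type u} [Quiver.{u} Q']

/-- The map `u F(X) ⟶ F(Z)` which is `F(f)` on every summand. For an additive functor `F` this is
the map `F(f)`, read through the canonical isomorphism of `F(uX)` with `u F(X)`. -/
def mapFrom (F : QuiverRep k Q ⥤ QuiverRep k Q') {u : ℕ} {X Z : QuiverRep k Q}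
    (f : (⨁ fun _ : Fin u => X) ⟶ Z) : (⨁ fun _ : Fin u => F.obj X) ⟶ F.obj Z :=
  biproduct.desc fun t => F.map (biproduct.ι (fun _ : Fin u => X) t ≫ f)

/-- The map `F(Z) ⟶ v F(Y)` which is `F(g)` into every summand. For an additive functor `F` this is
the map `F(g)`, read through the canonical isomorphism of `F(vY)` with `v F(Y)`. -/
def mapTo (F : QuiverRep k Q ⥤ QuiverRep k Q') {v : ℕ} {Z Y : QuiverRep k Q}
    (g : Z ⟶ ⨁ fun _ : Fin v => Y) : F.obj Z ⟶ ⨁ fun _ : Fin v => F.obj Y :=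
  biproduct.lift fun t => F.map (g ≫ biproduct.π (fun _ : Fin v => Y) t)

end Schofield

end QuiverRep

end

/-! All four functors are handled by one transfer principle, `IsSchofieldSequence.map`. Let F be
additive, let it preserve finite dimensionality and the vanishing of Ext¹, and let it be fully
faithful on a class W containing X, Z and Y. If F keeps the given sequence exact, then it carries
the Schofield sequence to a Schofield sequence. Indecomposability passes along because it says that
0 and 1 are the only idempotent endomorphisms of a nonzero object.

The classes are as follows. At a sink i, W asks that the arrows into i jointly map onto M_i. At a
source, W asks that the arrows out of i are jointly injective on M_i. For τ, W asks that M has no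
nonzero map to any P(j); for τ⁻¹, that it receives none from any I(j). An indecomposable outside W
is S(i), projective or injective respectively. The hypothesis puts one end of the sequence in W. The
other end is in W because Ext¹(Y, X) ≠ 0: otherwise the sequence would split although Z is
indecomposable. Z is in W because X embeds in Z and Z maps onto Y.

Everything about Ext¹ rests on `subsingleton_ext_iff`, which expresses its vanishing through
families of linear maps at the arrows. Such families extend along monomorphisms and lift along
epimorphisms, so the category is hereditary and Ext² = 0. For reflections, a family on σ_iQ is
converted into one on Q, solved there, and the solution is carried back. Exactness is the snake
lemma for the maps between M_i and the product of its neighbours.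

For the translations, the tool is the Auslander-Reiten formula Hom(N, τM) ≅ D Ext¹(M, N), encoded by
the relation `IsTauPair`, together with its dual for τ⁻¹. It holds for N = P(j) by the definition of
τ and extends to finite dimensional N because Ext¹(M, -) is right exact. It gives Ext¹(M, N) = 0 ⇒
Hom(N, τM) = 0 ⇒ Ext¹(τM, τN) = 0. Fullness of τ is obtained by following the extension class of a
projective presentation through the formula. -/

noncomputable section

namespace QuiverRep

/-! ### Extensions in abelian categories -/

section AbelianCategories

universe w v t

variable {C : Type t} [Category.{v} C] [Abelian C]

theorem exists_lift_of_subsingleton_ext [HasExt.{w} C] {S : ShortComplex C} (hS : S.ShortExact)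
    {L : C} (h : Subsingleton (Ext L S.X₁ 1)) (φ : L ⟶ S.X₃) : ∃ ψ : L ⟶ S.X₂, ψ ≫ S.g = φ := by
  obtain ⟨x, hx⟩ := Ext.covariant_sequence_exact₃ L hS (Ext.mk₀ φ) (zero_add 1)
    (Subsingleton.elim _ _)
  obtain ⟨ψ, rfl⟩ := (Ext.mk₀_bijective L S.X₂).2 x
  exact ⟨ψ, (Ext.mk₀_bijective L S.X₃).1 (by rw [← hx, Ext.mk₀_comp_mk₀])⟩

theorem exists_extension_of_subsingleton_ext [HasExt.{w} C] {S : ShortComplex C}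
    (hS : S.ShortExact) {L : C} (h : Subsingleton (Ext S.X₃ L 1)) (φ : S.X₁ ⟶ L) :
    ∃ ψ : S.X₂ ⟶ L, S.f ≫ ψ = φ := by
  obtain ⟨x, hx⟩ := Ext.contravariant_sequence_exact₁ hS L (Ext.mk₀ φ) (add_zero 1)
    (Subsingleton.elim _ _)
  obtain ⟨ψ, rfl⟩ := (Ext.mk₀_bijective S.X₂ L).2 x
  exact ⟨ψ, (Ext.mk₀_bijective S.X₁ L).1 (by rw [← hx, Ext.mk₀_comp_mk₀])⟩

/-- Since the middle term is projective, every class is the pushout of the extension class along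
some φ : X₁ ⟶ L, and such a pushout splits as soon as φ extends to X₂. -/
theorem subsingleton_ext_of_extension [HasExt.{w} C] {S : ShortComplex C} (hS : S.ShortExact)
    [Projective S.X₂] {L : C} (h : ∀ φ : S.X₁ ⟶ L, ∃ ψ : S.X₂ ⟶ L, S.f ≫ ψ = φ) :
    Subsingleton (Ext S.X₃ L 1) := by
  refine subsingleton_of_forall_eq 0 fun x => ?_
  obtain ⟨y, rfl⟩ := Ext.contravariant_sequence_exact₃ hS L x (Ext.eq_zero_of_projective _)
    (add_zero 1)
  obtain ⟨φ, rfl⟩ := (Ext.mk₀_bijective S.X₁ L).2 y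
  obtain ⟨ψ, rfl⟩ := h φ
  rw [← Ext.mk₀_comp_mk₀, ShortComplex.ShortExact.extClass_comp_assoc]

theorem subsingleton_ext_of_lift [HasExt.{w} C] {S : ShortComplex C} (hS : S.ShortExact)
    [Injective S.X₂] {L : C} (h : ∀ φ : L ⟶ S.X₃, ∃ ψ : L ⟶ S.X₂, ψ ≫ S.g = φ) :
    Subsingleton (Ext L S.X₁ 1) := by
  refine subsingleton_of_forall_eq 0 fun x => ?_
  obtain ⟨y, rfl⟩ := Ext.covariant_sequence_exact₁ L hS x (Ext.eq_zero_of_injective _)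
    (zero_add 1)
  obtain ⟨φ, rfl⟩ := (Ext.mk₀_bijective L S.X₃).2 y
  obtain ⟨ψ, rfl⟩ := h φ
  rw [← Ext.mk₀_comp_mk₀, Ext.comp_assoc_of_second_deg_zero, hS.comp_extClass, Ext.comp_zero]

theorem shortExact_kernel {P M : C} (p : P ⟶ M) [Epi p] :
    (ShortComplex.mk (kernel.ι p) p (kernel.condition p)).ShortExact where
  exact := ShortComplex.exact_of_f_is_kernel _ (kernelIsKernel p)

theorem shortExact_cokernel {M I : C} (i : M ⟶ I) [Mono i] :
    (ShortComplex.mk i (cokernel.π i) (cokernel.condition i)).ShortExact where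
  exact := ShortComplex.exact_of_g_is_cokernel _ (cokernelIsCokernel i)

theorem projective_of_subsingleton_ext [HasExt.{w} C] {M : C}
    (h : ∀ N : C, Subsingleton (Ext M N 1)) : Projective M where
  factors φ e _ := exists_lift_of_subsingleton_ext (shortExact_kernel e) (h _) φ

theorem injective_of_subsingleton_ext [HasExt.{w} C] {M : C}
    (h : ∀ N : C, Subsingleton (Ext N M 1)) : Injective M where
  factors φ e _ := exists_extension_of_subsingleton_ext (shortExact_cokernel e) (h _) φ

/-- The cokernel of s is a complement of A in M, so one of the two vanishes; if it is the
complement, then s is epi as well as mono. -/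
theorem isZero_or_isIso_of_retract {M A : C} (hM : Indecomposable M) (s : A ⟶ M) (p : M ⟶ A)
    (h : s ≫ p = 𝟙 A) : IsZero A ∨ IsIso s := by
  have : IsSplitMono s := ⟨⟨p, h⟩⟩
  let S := ShortComplex.mk s (cokernel.π s) (cokernel.condition s)
  have hS : S.ShortExact := shortExact_cokernel s
  have sp : S.Splitting := ShortComplex.Splitting.ofExactOfRetraction S hS.exact p h hS.epi_g
  refine (hM.2 _ _ sp.isoBinaryBiproduct).imp id fun hz => ?_
  have : Epi s := by
    rw [← S.exact_iff_epi (hz.eq_of_tgt _ _)]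
    exact hS.exact
  exact isIso_of_mono_of_epi s

theorem eq_zero_or_id_of_idempotent {M : C} (hM : Indecomposable M) (e : M ⟶ M) (he : e ≫ e = e) :
    e = 0 ∨ e = 𝟙 M := by
  obtain ⟨A, i, p, hip, hpi⟩ := IsIdempotentComplete.idempotents_split M e he
  rcases isZero_or_isIso_of_retract hM i p hip with hA | hi
  · left
    rw [← hpi, hA.eq_of_src i 0, comp_zero]
  · right
    rw [← hpi, ← cancel_epi i, ← Category.assoc, hip, Category.id_comp, Category.comp_id]

/-- For M ≅ A ⊞ B the idempotent to test is the projection to A: it is 0 only if A = 0 and 1 only if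
B = 0. With `eq_zero_or_id_of_idempotent` this reads indecomposability off the endomorphisms, so a
fully faithful functor preserves it. -/
theorem indecomposable_of_idempotent {M : C} (h0 : ¬ IsZero M)
    (h : ∀ e : M ⟶ M, e ≫ e = e → e = 0 ∨ e = 𝟙 M) : Indecomposable M := by
  refine ⟨h0, fun A B φ => ?_⟩
  rcases h (φ.hom ≫ biprod.fst ≫ biprod.inl ≫ φ.inv) (by simp) with h | h
  · left
    rw [IsZero.iff_id_eq_zero]
    have h' := congrArg (fun t => biprod.inl ≫ φ.inv ≫ t ≫ φ.hom ≫ biprod.fst) h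
    simpa using h'
  · right
    rw [IsZero.iff_id_eq_zero]
    have h' := congrArg (fun t => biprod.inr ≫ φ.inv ≫ t ≫ φ.hom ≫ biprod.snd) h
    simpa using h'.symm

end AbelianCategories

/-! ### Vertexwise linear algebra -/

section Vertexwise

variable {k : Type u} [Field k] {Q : Type u} [Quiver.{u} Q]

/-- The linear map of a morphism of representations at a vertex. -/
def linAt {M N : QuiverRep k Q} (φ : M ⟶ N) (j : Q) : space M j →ₗ[k] space N j :=
  (homAt φ j).hom

/-- The linear map by which an arrow acts on a representation. -/
def actAt (M : QuiverRep k Q) {a b : Q} (e : a ⟶ b) : space M a →ₗ[k] space M b :=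
  (arrowMap M e).hom

@[simp]
theorem linAt_id (M : QuiverRep k Q) (j : Q) : linAt (𝟙 M) j = LinearMap.id := rfl

@[simp]
theorem linAt_comp {M N L : QuiverRep k Q} (φ : M ⟶ N) (ψ : N ⟶ L) (j : Q) :
    linAt (φ ≫ ψ) j = linAt ψ j ∘ₗ linAt φ j := rfl

@[simp]
theorem linAt_zero (M N : QuiverRep k Q) (j : Q) : linAt (0 : M ⟶ N) j = 0 := rfl

theorem linAt_ext {M N : QuiverRep k Q} {φ ψ : M ⟶ N} (h : ∀ j, linAt φ j = linAt ψ j) : φ = ψ :=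
  hom_ext fun j => ModuleCat.hom_ext (h j)

theorem linAt_act {M N : QuiverRep k Q} (φ : M ⟶ N) {a b : Q} (e : a ⟶ b) (x : space M a) :
    linAt φ b (actAt M e x) = actAt N e (linAt φ a x) :=
  LinearMap.congr_fun (congrArg ModuleCat.Hom.hom (arrowMap_homAt φ e)) x

/-- A morphism of representations from a compatible family of linear maps. -/
def homOfLin {M N : QuiverRep k Q} (φ : ∀ j, space M j →ₗ[k] space N j)
    (h : ∀ {a b : Q} (e : a ⟶ b) (x : space M a), φ b (actAt M e x) = actAt N e (φ a x)) : M ⟶ N :=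
  homMk (fun j => ModuleCat.ofHom (φ j)) fun _ _ e => ModuleCat.hom_ext (LinearMap.ext (h e))

@[simp]
theorem linAt_homOfLin {M N : QuiverRep k Q} (φ : ∀ j, space M j →ₗ[k] space N j)
    (h : ∀ {a b : Q} (e : a ⟶ b) (x : space M a), φ b (actAt M e x) = actAt N e (φ a x)) (j : Q) :
    linAt (homOfLin φ h) j = φ j := rfl

/-- This is what allows exactness and vanishing to be tested one vertex at a time. -/
theorem evaluation_jointlyReflectIsomorphisms : JointlyReflectIsomorphisms
    (fun j : Paths Q => (evaluation (Paths Q) (ModuleCat.{u} k)).obj j) where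
  isIso φ h := (NatTrans.isIso_iff_isIso_app φ).2 fun j => h j

theorem mono_iff_injective {M N : QuiverRep k Q} (φ : M ⟶ N) :
    Mono φ ↔ ∀ j, Function.Injective (linAt φ j) := by
  rw [NatTrans.mono_iff_mono_app]
  exact forall_congr' fun j => ModuleCat.mono_iff_injective _

theorem epi_iff_surjective {M N : QuiverRep k Q} (φ : M ⟶ N) :
    Epi φ ↔ ∀ j, Function.Surjective (linAt φ j) := by
  rw [NatTrans.epi_iff_epi_app]
  exact forall_congr' fun j => ModuleCat.epi_iff_surjective _

theorem exact_iff_linAt (S : ShortComplex (QuiverRep k Q)) :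
    S.Exact ↔ ∀ j, Function.Exact (linAt S.f j) (linAt S.g j) := by
  rw [evaluation_jointlyReflectIsomorphisms.exact_iff]
  exact forall_congr' fun j => ShortComplex.ShortExact.moduleCat_exact_iff_function_exact _

theorem shortExact_iff_linAt (S : ShortComplex (QuiverRep k Q)) :
    S.ShortExact ↔ ∀ j, Function.Injective (linAt S.f j) ∧
      Function.Exact (linAt S.f j) (linAt S.g j) ∧ Function.Surjective (linAt S.g j) := by
  refine ⟨fun h j => ⟨(mono_iff_injective _).1 h.mono_f j, (exact_iff_linAt S).1 h.exact j,
    (epi_iff_surjective _).1 h.epi_g j⟩, fun h => ?_⟩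
  have := (mono_iff_injective S.f).2 fun j => (h j).1
  have := (epi_iff_surjective S.g).2 fun j => (h j).2.2
  exact ⟨(exact_iff_linAt S).2 fun j => (h j).2.1⟩

theorem isZero_iff_subsingleton (M : QuiverRep k Q) :
    IsZero M ↔ ∀ j, Subsingleton (space M j) := by
  rw [evaluation_jointlyReflectIsomorphisms.isZero_iff]
  exact forall_congr' fun j => ModuleCat.isZero_iff_subsingleton

theorem IsFinDim.of_mono {M N : QuiverRep k Q} (hN : IsFinDim N) (φ : M ⟶ N) [Mono φ] :
    IsFinDim M := fun j =>
  have := hN j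
  Module.Finite.of_injective (linAt φ j) ((mono_iff_injective φ).1 inferInstance j)

theorem IsFinDim.of_epi {M N : QuiverRep k Q} (hM : IsFinDim M) (φ : M ⟶ N) [Epi φ] :
    IsFinDim N := fun j =>
  have := hM j
  Module.Finite.of_surjective (linAt φ j) ((epi_iff_surjective φ).1 inferInstance j)

/-! ### The first extension group in terms of arrows -/

/-- The extension of `M` by `N` given by a family of linear maps at the arrows. -/
def extRep (M N : QuiverRep k Q) (h : ∀ a b : Q, (a ⟶ b) → (space M a →ₗ[k] space N b)) :
    QuiverRep k Q :=
  mk (fun j => ModuleCat.of k (space N j × space M j)) fun a b e => ModuleCat.ofHom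
    (((actAt N e).coprod (h a b e)).prod (actAt M e ∘ₗ LinearMap.snd k _ _))

/-- The space at a vertex of a representation given by vector spaces and linear maps. -/
def mkEquiv (V : Q → ModuleCat.{u} k) (f : ∀ a b : Q, (a ⟶ b) → (V a ⟶ V b)) (j : Q) :
    V j ≃ₗ[k] space (mk V f) j :=
  LinearEquiv.refl k (V j)

theorem actAt_mkEquiv (V : Q → ModuleCat.{u} k) (f : ∀ a b : Q, (a ⟶ b) → (V a ⟶ V b))
    {a b : Q} (e : a ⟶ b) (x : V a) :
    actAt (mk V f) e (mkEquiv V f a x) = mkEquiv V f b ((f a b e).hom x) :=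
  LinearMap.congr_fun (congrArg ModuleCat.Hom.hom (arrowMap_mk V f e)) x

/-- The space at a vertex of an extension of representations. -/
def extRepEquiv (M N : QuiverRep k Q) (h : ∀ a b : Q, (a ⟶ b) → (space M a →ₗ[k] space N b))
    (j : Q) : (space N j × space M j) ≃ₗ[k] space (extRep M N h) j :=
  mkEquiv (fun j => ModuleCat.of k (space N j × space M j)) _ j

theorem actAt_extRepEquiv (M N : QuiverRep k Q)
    (h : ∀ a b : Q, (a ⟶ b) → (space M a →ₗ[k] space N b)) {a b : Q} (e : a ⟶ b)
    (x : space N a × space M a) : actAt (extRep M N h) e (extRepEquiv M N h a x) =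
      extRepEquiv M N h b (actAt N e x.1 + h a b e x.2, actAt M e x.2) :=
  actAt_mkEquiv (fun j => ModuleCat.of k (space N j × space M j)) _ e x

/-- There are no extensions of `M` by `N` if and only if every family of linear maps `M_a ⟶ N_b`
at the arrows is the defect of naturality of a family of linear maps at the vertices. -/
theorem subsingleton_ext_iff (M N : QuiverRep k Q) : Subsingleton (Ext M N 1) ↔
    ∀ h : ∀ a b : Q, (a ⟶ b) → (space M a →ₗ[k] space N b),
      ∃ φ : ∀ j, space M j →ₗ[k] space N j, ∀ (a b : Q) (e : a ⟶ b) (x : space M a),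
        φ b (actAt M e x) - actAt N e (φ a x) = h a b e x := by
  constructor
  · intro hMN h
    let ε := extRepEquiv M N h
    let i : N ⟶ extRep M N h := homOfLin
      (fun j => (ε j).toLinearMap ∘ₗ LinearMap.inl k (space N j) (space M j)) fun {a b} e x => by
        simp [ε, actAt_extRepEquiv]
    let p : extRep M N h ⟶ M := homOfLin
      (fun j => LinearMap.snd k (space N j) (space M j) ∘ₗ (ε j).symm.toLinearMap)
      fun {a b} e x => by
        obtain ⟨y, rfl⟩ := (ε a).surjective x
        simp [ε, actAt_extRepEquiv]
    have hi : ∀ j x, linAt i j x = ε j (x, 0) := fun _ _ => rfl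
    have hp : ∀ j x, linAt p j (ε j x) = x.2 := fun _ _ => rfl
    have w : i ≫ p = 0 := linAt_ext fun j => by
      ext x
      simp [hi, hp]
    have hS : (ShortComplex.mk i p w).ShortExact := by
      rw [shortExact_iff_linAt]
      refine fun j => ⟨(ε j).injective.comp LinearMap.inl_injective, fun x => ?_,
        LinearMap.snd_surjective.comp (ε j).symm.surjective⟩
      obtain ⟨y, rfl⟩ := (ε j).surjective x
      simp [hi, hp, Prod.ext_iff, eq_comm]
    -- A section of the extension twisted by `h` has the form x ↦ (φ x, x); its compatibility with
    -- the arrows is the required identity for φ.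
    obtain ⟨s, hs⟩ := exists_lift_of_subsingleton_ext hS hMN (𝟙 M)
    refine ⟨fun j => LinearMap.fst k (space N j) (space M j) ∘ₗ (ε j).symm.toLinearMap ∘ₗ linAt s j,
      fun a b e x => ?_⟩
    have h2 : ((ε a).symm (linAt s a x)).2 = x :=
      LinearMap.congr_fun (congrArg (fun t => linAt t a) hs) x
    have h1 := linAt_act s e x
    rw [← (ε a).apply_symm_apply (linAt s a x), actAt_extRepEquiv, h2] at h1
    simp [h1, ε]
  · intro H
    let p := Projective.π M
    have hS := shortExact_kernel p
    refine subsingleton_ext_of_extension hS fun φ => ?_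
    have hS' := (shortExact_iff_linAt _).1 hS
    have hinj : ∀ j, Function.Injective (linAt (kernel.ι p) j) := fun j => (hS' j).1
    have hex : ∀ j, Function.Exact (linAt (kernel.ι p) j) (linAt p j) := fun j => (hS' j).2.1
    have hsurj : ∀ j, Function.Surjective (linAt p j) := fun j => (hS' j).2.2
    choose r hr using fun j => LinearMap.exists_leftInverse_of_injective _
      (LinearMap.ker_eq_bot.2 (hinj j))
    choose s hs using fun j => LinearMap.exists_rightInverse_of_surjective _
      (LinearMap.range_eq_top.2 (hsurj j))
    have hr' : ∀ j x, r j (linAt (kernel.ι p) j x) = x := fun j x => LinearMap.congr_fun (hr j) x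
    have hs' : ∀ j x, linAt p j (s j x) = x := fun j x => LinearMap.congr_fun (hs j) x
    -- The linear extension φ ∘ r of φ need not commute with the arrows. Its defect D vanishes on
    -- the kernel of p, so it descends to M, and a solution ψ there supplies the correction ψ ∘ p.
    let D : ∀ a b : Q, (a ⟶ b) → (space (Projective.over M) a →ₗ[k] space N b) := fun a b e =>
      actAt N e ∘ₗ linAt φ a ∘ₗ r a - linAt φ b ∘ₗ r b ∘ₗ actAt (Projective.over M) e
    have hD : ∀ a b (e : a ⟶ b) x, D a b e (s a (linAt p a x)) = D a b e x := by
      intro a b e x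
      rw [← sub_eq_zero, ← map_sub]
      obtain ⟨y, hy⟩ := (hex a (s a (linAt p a x) - x)).1 (by rw [map_sub, hs', sub_self])
      rw [← hy]
      simp [D, ← linAt_act, hr']
    obtain ⟨ψ, hψ⟩ := H fun a b e => D a b e ∘ₗ s a
    refine ⟨homOfLin (fun j => linAt φ j ∘ₗ r j + ψ j ∘ₗ linAt p j) fun {a b} e x => ?_,
      linAt_ext fun j => ?_⟩
    · have h1 := hψ a b e (linAt p a x)
      rw [LinearMap.comp_apply, hD] at h1
      simp only [D, LinearMap.sub_apply, LinearMap.comp_apply] at h1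
      simp only [LinearMap.add_apply, LinearMap.comp_apply, linAt_act p, map_add]
      rw [sub_eq_iff_eq_add] at h1
      rw [h1]
      abel
    · ext x
      have h0 : linAt p j (linAt (kernel.ι p) j x) = 0 := (hex j).apply_apply_eq_zero x
      change linAt φ j (r j (linAt (kernel.ι p) j x)) + ψ j (linAt p j (linAt (kernel.ι p) j x)) = _
      rw [hr', h0, map_zero, add_zero]

/-- Families of linear maps at the arrows satisfy no compatibility condition, so they extend from K
to M along linear retractions; a solution on M then restricts to K. This is the hereditary property
of quiver representations. -/
theorem subsingleton_ext_of_mono {K M N : QuiverRep k Q} (f : K ⟶ M) [Mono f]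
    (h : Subsingleton (Ext M N 1)) : Subsingleton (Ext K N 1) := by
  rw [subsingleton_ext_iff] at h ⊢
  intro c
  choose r hr using fun j => LinearMap.exists_leftInverse_of_injective _
    (LinearMap.ker_eq_bot.2 ((mono_iff_injective f).1 inferInstance j))
  obtain ⟨φ, hφ⟩ := h fun a b e => c a b e ∘ₗ r a
  refine ⟨fun j => φ j ∘ₗ linAt f j, fun a b e x => ?_⟩
  have h1 := hφ a b e (linAt f a x)
  rw [LinearMap.comp_apply, show r a (linAt f a x) = x from LinearMap.congr_fun (hr a) x] at h1
  rw [LinearMap.comp_apply, linAt_act, LinearMap.comp_apply, h1]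

theorem subsingleton_ext_of_epi {M N L : QuiverRep k Q} (g : N ⟶ L) [Epi g]
    (h : Subsingleton (Ext M N 1)) : Subsingleton (Ext M L 1) := by
  rw [subsingleton_ext_iff] at h ⊢
  intro c
  choose s hs using fun j => LinearMap.exists_rightInverse_of_surjective _
    (LinearMap.range_eq_top.2 ((epi_iff_surjective g).1 inferInstance j))
  obtain ⟨φ, hφ⟩ := h fun a b e => s b ∘ₗ c a b e
  refine ⟨fun j => linAt g j ∘ₗ φ j, fun a b e x => ?_⟩
  have h1 := congrArg (linAt g b) (hφ a b e x)
  rw [LinearMap.comp_apply, map_sub, linAt_act,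
    show linAt g b (s b (c a b e x)) = c a b e x from LinearMap.congr_fun (hs b) _] at h1
  exact h1

theorem projective_of_mono {K P : QuiverRep k Q} [Projective P] (f : K ⟶ P) [Mono f] :
    Projective K :=
  projective_of_subsingleton_ext fun _ => subsingleton_ext_of_mono f
    (Ext.subsingleton_of_projective _ _ 0)

theorem injective_of_epi {I K : QuiverRep k Q} [Injective I] (f : I ⟶ K) [Epi f] :
    Injective K :=
  injective_of_subsingleton_ext fun _ => subsingleton_ext_of_epi f
    (Ext.subsingleton_of_injective _ _ 0)

/-- Dimension shift: the kernel of a projective presentation is a subobject of a projective, hence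
projective. -/
theorem subsingleton_ext_two (M N : QuiverRep k Q) : Subsingleton (Ext M N 2) := by
  refine subsingleton_of_forall_eq 0 fun x => ?_
  have hS := shortExact_kernel (Projective.π M)
  obtain ⟨y, rfl⟩ := Ext.contravariant_sequence_exact₃ hS N x (Ext.eq_zero_of_projective _)
    (show 1 + 1 = 2 from rfl)
  have : Projective (kernel (Projective.π M)) := projective_of_mono (kernel.ι _)
  rw [Ext.eq_zero_of_projective (P := kernel (Projective.π M)) y, Ext.comp_zero]

/-- The obstruction lies in Ext²(M, ker g) = 0. This right exactness is what extends the
Auslander-Reiten formula from the P(j) to their quotients. -/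
theorem exists_ext_lift_of_epi (M : QuiverRep k Q) {N L : QuiverRep k Q} (g : N ⟶ L) [Epi g]
    (x : Ext M L 1) : ∃ y : Ext M N 1, y.comp (Ext.mk₀ g) (add_zero 1) = x :=
  have := subsingleton_ext_two M (kernel g)
  Ext.covariant_sequence_exact₃ M (shortExact_kernel g) x (show 1 + 1 = 2 from rfl)
    (Subsingleton.elim _ _)

theorem exists_ext_extension_of_mono {K M : QuiverRep k Q} (N : QuiverRep k Q) (f : K ⟶ M) [Mono f]
    (x : Ext K N 1) : ∃ y : Ext M N 1, (Ext.mk₀ f).comp y (zero_add 1) = x :=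
  have := subsingleton_ext_two (cokernel f) N
  Ext.contravariant_sequence_exact₁ (shortExact_cokernel f) N x (show 1 + 1 = 2 from rfl)
    (Subsingleton.elim _ _)

end Vertexwise

/-! ### Transfer of Schofield sequences along additive functors -/

section Transfer

variable {k : Type u} [Field k] {Q : Type u} [Quiver.{u} Q] {Q' : Type u} [Quiver.{u} Q']

/-- An additive functor commutes with finite biproducts, and through these isomorphisms the two
sequences agree. -/
theorem shortExact_mapFrom_mapTo (F : QuiverRep k Q ⥤ QuiverRep k Q') [F.Additive] {u v : ℕ}
    {X Z Y : QuiverRep k Q} (f : (⨁ fun _ : Fin u => X) ⟶ Z) (g : Z ⟶ ⨁ fun _ : Fin v => Y)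
    (w : F.map f ≫ F.map g = 0) (h : (ShortComplex.mk (F.map f) (F.map g) w).ShortExact) :
    ∃ w : mapFrom F f ≫ mapTo F g = 0, (ShortComplex.mk (mapFrom F f) (mapTo F g) w).ShortExact := by
  have hf : F.map f = (F.mapBiproduct fun _ : Fin u => X).hom ≫ mapFrom F f := by
    rw [mapFrom, biproduct.mapBiproduct_hom_desc]
    congr 1
    apply biproduct.hom_ext'
    simp
  have hg : F.map g = mapTo F g ≫ (F.mapBiproduct fun _ : Fin v => Y).inv := by
    rw [Iso.eq_comp_inv]
    apply biproduct.hom_ext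
    intro t
    rw [mapTo, biproduct.lift_π, Category.assoc, Functor.mapBiproduct_hom, biproduct.lift_π, F.map_comp]
  have w' : mapFrom F f ≫ mapTo F g = 0 := by
    rw [hf, hg, Category.assoc, ← Category.assoc (mapFrom F f)] at w
    exact zero_of_epi_comp _ (zero_of_comp_mono _ (by rwa [Category.assoc]))
  exact ⟨w', ShortComplex.shortExact_of_iso (ShortComplex.isoMk
    (S₁ := ShortComplex.mk (F.map f) (F.map g) w) (S₂ := ShortComplex.mk _ _ w')
    (F.mapBiproduct _) (Iso.refl _) (F.mapBiproduct _) (by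
      exact hf.symm.trans (Category.comp_id _).symm) (by
      change 𝟙 _ ≫ mapTo F g = F.map g ≫ (F.mapBiproduct fun _ : Fin v => Y).hom
      rw [hg, Category.assoc, Iso.inv_hom_id, Category.comp_id, Category.id_comp])) h⟩

theorem isZero_of_isZero_biproduct {n : ℕ} (hn : 0 < n) {X : QuiverRep k Q}
    (h : IsZero (⨁ fun _ : Fin n => X)) : IsZero X := by
  rw [IsZero.iff_id_eq_zero, ← biproduct.ι_π_self (fun _ : Fin n => X) ⟨0, hn⟩,
    h.eq_of_tgt (biproduct.ι (fun _ : Fin n => X) ⟨0, hn⟩) 0, zero_comp]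

theorem subsingleton_ext_biproduct {m n : ℕ} {X Y : QuiverRep k Q}
    (h : Subsingleton (Ext Y X 1)) :
    Subsingleton (Ext (⨁ fun _ : Fin n => Y) (⨁ fun _ : Fin m => X) 1) := by
  have h1 : Subsingleton (Ext Y (⨁ fun _ : Fin m => X) 1) :=
    (Ext.addEquivBiproduct Y (biproduct.isBilimit fun _ : Fin m => X) 1).toEquiv.subsingleton
  exact (Ext.biproductAddEquiv (biproduct.isBilimit fun _ : Fin n => Y) _ 1).toEquiv.subsingleton

variable {m n : ℕ} {X Z Y : QuiverRep k Q} {f : (⨁ fun _ : Fin m => X) ⟶ Z}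
  {g : Z ⟶ ⨁ fun _ : Fin n => Y}

/-- Otherwise g has a section s, and indecomposability of Z makes either vY zero or s invertible. In
the second case g is mono, so the monomorphism f is zero and uX = 0. This excludes a projective Y
and an injective X. -/
theorem IsSchofieldSequence.not_subsingleton_ext (h : IsSchofieldSequence m n X Z Y f g) :
    ¬ Subsingleton (Ext Y X 1) := by
  intro hYX
  obtain ⟨w, hS⟩ := h.exact
  obtain ⟨s, hs⟩ := exists_lift_of_subsingleton_ext hS (subsingleton_ext_biproduct hYX) (𝟙 _)
  rcases isZero_or_isIso_of_retract h.exceptional.indecomposable s g hs with hz | hi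
  · exact h.pair.exceptional_left.indecomposable.1 (isZero_of_isZero_biproduct h.pos_right hz)
  · have hg : g = inv s := by
      rw [← cancel_epi s, hs, IsIso.hom_inv_id]
    have : Mono g := hg ▸ inferInstance
    have hf : f = 0 := zero_of_comp_mono g w
    have : Mono f := hS.mono_f
    refine h.pair.exceptional_right.indecomposable.1 (isZero_of_isZero_biproduct h.pos_left ?_)
    rw [IsZero.iff_id_eq_zero, ← cancel_mono f, hf, comp_zero, comp_zero]

theorem IsExceptional.map (F : QuiverRep k Q ⥤ QuiverRep k Q') [F.Additive] {M : QuiverRep k Q}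
    (hM : IsExceptional M) (hfin : IsFinDim (F.obj M))
    (hbij : Function.Bijective (F.map : (M ⟶ M) → (F.obj M ⟶ F.obj M)))
    (hext : Subsingleton (Ext (F.obj M) (F.obj M) 1)) : IsExceptional (F.obj M) where
  finDim := hfin
  indecomposable := by
    refine indecomposable_of_idempotent (fun h0 => hM.indecomposable.1 ?_) fun e he => ?_
    · rw [IsZero.iff_id_eq_zero] at h0 ⊢
      exact hbij.1 (by rw [F.map_id, F.map_zero, h0])
    · obtain ⟨e, rfl⟩ := hbij.2 e
      rcases eq_zero_or_id_of_idempotent hM.indecomposable e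
        (hbij.1 (by rw [F.map_comp, he])) with rfl | rfl
      · exact Or.inl (F.map_zero _ _)
      · exact Or.inr (F.map_id M)
  ext_self := hext

/-- Only full faithfulness is restricted to W, since a reflection functor kills the simple at its
vertex and τ kills projectives. Vanishing of Ext¹ is preserved by the four functors on all finite
dimensional representations. -/
theorem IsSchofieldSequence.map (h : IsSchofieldSequence m n X Z Y f g)
    (F : QuiverRep k Q ⥤ QuiverRep k Q') [F.Additive] (W : QuiverRep k Q → Prop)
    (hX : W X) (hZ : W Z) (hY : W Y) (hfin : ∀ M, IsFinDim M → IsFinDim (F.obj M))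
    (hbij : ∀ M N, W M → W N → IsFinDim M → IsFinDim N →
      Function.Bijective (F.map : (M ⟶ N) → (F.obj M ⟶ F.obj N)))
    (hext : ∀ M N, IsFinDim M → IsFinDim N → Subsingleton (Ext M N 1) →
      Subsingleton (Ext (F.obj M) (F.obj N) 1))
    (hexact : ∃ w, (ShortComplex.mk (F.map f) (F.map g) w).ShortExact) :
    IsSchofieldSequence m n (F.obj X) (F.obj Z) (F.obj Y) (mapFrom F f) (mapTo F g) := by
  have hexc : ∀ M, W M → IsExceptional M → IsExceptional (F.obj M) := fun M hW hM =>
    hM.map F (hfin M hM.finDim) (hbij M M hW hW hM.finDim hM.finDim)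
      (hext M M hM.finDim hM.finDim hM.ext_self)
  have hXf := h.pair.exceptional_right.finDim
  have hYf := h.pair.exceptional_left.finDim
  have := h.pair.hom_right_left
  have := h.pair.hom_left_right
  obtain ⟨w, hS⟩ := hexact
  exact
    { pair :=
        { exceptional_left := hexc Y hY h.pair.exceptional_left
          exceptional_right := hexc X hX h.pair.exceptional_right
          hom_right_left := (hbij X Y hX hY hXf hYf).2.subsingleton
          hom_left_right := (hbij Y X hY hX hYf hXf).2.subsingleton
          ext_right_left := hext X Y hXf hYf h.pair.ext_right_left }
      exceptional := hexc Z hZ h.exceptional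
      pos_left := h.pos_left
      pos_right := h.pos_right
      exact := shortExact_mapFrom_mapTo F f g w hS }

end Transfer

/-! ### Linear algebra and simple representations -/

section LinearAlgebra

variable {k : Type*} [Field k] {V₁ V₂ V₃ V : Type*} [AddCommGroup V₁] [AddCommGroup V₂]
  [AddCommGroup V₃] [AddCommGroup V] [Module k V₁] [Module k V₂] [Module k V₃] [Module k V]

theorem exists_linearMap_lift {f : V₁ →ₗ[k] V₂} {g : V₂ →ₗ[k] V₃} (hf : Function.Injective f)
    (h : Function.Exact f g) (L : V →ₗ[k] V₂) (hL : ∀ x, g (L x) = 0) :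
    ∃ ψ : V →ₗ[k] V₁, ∀ x, f (ψ x) = L x := by
  obtain ⟨r, hr⟩ := LinearMap.exists_leftInverse_of_injective f (LinearMap.ker_eq_bot.2 hf)
  refine ⟨r ∘ₗ L, fun x => ?_⟩
  obtain ⟨y, hy⟩ := (h (L x)).1 (hL x)
  rw [LinearMap.comp_apply, ← hy, show r (f y) = y from LinearMap.congr_fun hr y]

theorem exists_linearMap_desc {f : V₁ →ₗ[k] V₂} {g : V₂ →ₗ[k] V₃} (hg : Function.Surjective g)
    (h : Function.Exact f g) (L : V₂ →ₗ[k] V) (hL : ∀ x, L (f x) = 0) :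
    ∃ ψ : V₃ →ₗ[k] V, ∀ x, ψ (g x) = L x := by
  obtain ⟨s, hs⟩ := LinearMap.exists_rightInverse_of_surjective g (LinearMap.range_eq_top.2 hg)
  refine ⟨L ∘ₗ s, fun x => ?_⟩
  obtain ⟨y, hy⟩ := (h (s (g x) - x)).1 (by
    rw [map_sub, show g (s (g x)) = g x from LinearMap.congr_fun hs (g x), sub_self])
  rw [LinearMap.comp_apply, ← sub_eq_zero, ← map_sub, ← hy, hL]

end LinearAlgebra

/-- Reflected representations have one description at i and another elsewhere; this lemma keeps the
casts of the dependent `if` out of the constructions of maps between them. -/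
theorem exists_family {ι : Type*} {T : ι → Sort*} (i : ι) (x : T i) (y : ∀ j, j ≠ i → T j) :
    ∃ z : ∀ j, T j, z i = x ∧ ∀ j (hj : j ≠ i), z j = y j hj := by
  classical
  refine ⟨fun j => if h : j = i then h ▸ x else y j h, by simp, fun j hj => by simp [hj]⟩

/-! ### Maps to and from the simple representation at a vertex -/

section Simple

variable {k : Type u} [Field k] {Q : Type u} [Quiver.{u} Q]

/-- The space of the simple representation `S(i)` at the vertex `i`. -/
def simpleEquiv (i : Q) : space (simpleRep k i) i ≃ₗ[k] k :=
  (mkEquiv _ _ i).symm ≪≫ₗ (eqToIso (if_pos rfl)).toLinearEquiv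

theorem subsingleton_space_simpleRep {i j : Q} (h : j ≠ i) :
    Subsingleton (space (simpleRep k i) j) := by
  refine ((mkEquiv _ _ j).symm ≪≫ₗ (eqToIso (if_neg h) :
    _ ≅ ModuleCat.of k PUnit).toLinearEquiv).toEquiv.subsingleton

theorem actAt_simpleRep (i : Q) {a b : Q} (e : a ⟶ b) (x : space (simpleRep k i) a) :
    actAt (simpleRep k i) e x = 0 := by
  classical
  let V : Q → ModuleCat.{u} k := fun j => if j = i then ModuleCat.of k k else ModuleCat.of k PUnit
  obtain ⟨y, rfl⟩ := (mkEquiv V (fun _ _ _ => 0) a).surjective x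
  exact (actAt_mkEquiv V (fun _ _ _ => 0) e y).trans (map_zero (mkEquiv V (fun _ _ _ => 0) b))

theorem exists_hom_to_simpleRep {M : QuiverRep k Q} {i : Q} (l : space M i →ₗ[k] k)
    (hl : ∀ (a : Q) (e : a ⟶ i) (x : space M a), l (actAt M e x) = 0) :
    ∃ p : M ⟶ simpleRep k i, ∀ x, simpleEquiv i (linAt p i x) = l x := by
  obtain ⟨z, hz, hz'⟩ := exists_family (T := fun j => space M j →ₗ[k] space (simpleRep k i) j) i
    ((simpleEquiv i).symm.toLinearMap ∘ₗ l) fun _ _ => 0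
  refine ⟨homOfLin z fun {a b} e x => ?_, fun x => ?_⟩
  · rw [actAt_simpleRep]
    by_cases hb : b = i
    · subst hb
      rw [hz, LinearMap.comp_apply, hl, map_zero]
    · rw [hz' b hb, LinearMap.zero_apply]
  · rw [linAt_homOfLin, hz]
    simp

theorem exists_hom_from_simpleRep {M : QuiverRep k Q} {i : Q} (v : space M i)
    (hv : ∀ (b : Q) (e : i ⟶ b), actAt M e v = 0) :
    ∃ s : simpleRep k i ⟶ M, ∀ x, linAt s i x = simpleEquiv i x • v := by
  obtain ⟨z, hz, hz'⟩ := exists_family (T := fun j => space (simpleRep k i) j →ₗ[k] space M j) i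
    (LinearMap.toSpanSingleton k _ v ∘ₗ (simpleEquiv i).toLinearMap) fun _ _ => 0
  refine ⟨homOfLin z fun {a b} e x => ?_, fun x => ?_⟩
  · rw [actAt_simpleRep, map_zero]
    by_cases ha : a = i
    · subst ha
      rw [hz]
      simp [hv]
    · rw [hz' a ha, LinearMap.zero_apply, map_zero]
  · rw [linAt_homOfLin, hz]
    simp

/-- An indecomposable representation with a vector at `i` which is killed by all arrows and is not
in the image of the arrows, as detected by a functional, is the simple representation at `i`. -/
theorem nonempty_iso_simpleRep {M : QuiverRep k Q} (hM : Indecomposable M) {i : Q} (v : space M i)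
    (hv : ∀ (b : Q) (e : i ⟶ b), actAt M e v = 0) (l : space M i →ₗ[k] k)
    (hl : ∀ (a : Q) (e : a ⟶ i) (x : space M a), l (actAt M e x) = 0) (h : l v ≠ 0) :
    Nonempty (M ≅ simpleRep k i) := by
  obtain ⟨s, hs⟩ := exists_hom_from_simpleRep v hv
  -- The scalar (l v)⁻¹ normalises the composite S(i) ⟶ M ⟶ S(i) to the identity.
  obtain ⟨p, hp⟩ := exists_hom_to_simpleRep ((l v)⁻¹ • l) fun a e x => by
    rw [LinearMap.smul_apply, hl, smul_zero]
  have hsp : s ≫ p = 𝟙 _ := linAt_ext fun j => by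
    ext x
    by_cases hj : j = i
    · subst hj
      apply (simpleEquiv j).injective
      rw [linAt_comp, LinearMap.comp_apply, hp, hs]
      simp [h]
    · exact (subsingleton_space_simpleRep hj).elim _ _
  rcases isZero_or_isIso_of_retract hM s p hsp with h0 | hi
  · have h1 := (isZero_iff_subsingleton _).1 h0 i
    exact absurd (congrArg (simpleEquiv i) (h1.elim ((simpleEquiv i).symm (1 : k)) 0)) (by simp)
  · exact ⟨(asIso s).symm⟩

end Simple

/-! ### Elements of finite biproducts of vector spaces -/

section Biproducts

variable {k : Type u} [Field k]

theorem biproduct_eq_sum {ι : Type*} [Fintype ι] (V : ι → ModuleCat.{u} k)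
    (x : (⨁ V : ModuleCat.{u} k)) :
    x = ∑ e, (biproduct.ι V e).hom ((biproduct.π V e).hom x) := by
  have h1 : ∑ e, biproduct.π V e ≫ biproduct.ι V e = 𝟙 (⨁ V) :=
    IsBilimit.total (biproduct.isBilimit V)
  have h2 := congrArg (fun t : (⨁ V) ⟶ (⨁ V) => t.hom x) h1
  simpa [ModuleCat.hom_sum] using h2.symm

theorem biproduct_ext_apply {ι : Type*} [Finite ι] (V : ι → ModuleCat.{u} k)
    {x y : (⨁ V : ModuleCat.{u} k)}
    (h : ∀ e, (biproduct.π V e).hom x = (biproduct.π V e).hom y) : x = y := by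
  let := Fintype.ofFinite ι
  rw [biproduct_eq_sum V x, biproduct_eq_sum V y]
  simp only [h]

theorem exists_biproduct_apply {ι : Type*} [Finite ι] (V : ι → ModuleCat.{u} k) (x : ∀ e, V e) :
    ∃ y : (⨁ V : ModuleCat.{u} k), ∀ e, (biproduct.π V e).hom y = x e := by
  classical
  let := Fintype.ofFinite ι
  refine ⟨∑ e, (biproduct.ι V e).hom (x e), fun e => ?_⟩
  rw [map_sum, Finset.sum_eq_single e]
  · exact congrArg (fun t => ModuleCat.Hom.hom t (x e)) (biproduct.ι_π_self V e)
  · intro b _ hb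
    exact congrArg (fun t => ModuleCat.Hom.hom t (x b)) (biproduct.ι_π_ne V hb)
  · exact fun h => absurd (Finset.mem_univ e) h

end Biproducts

/-! ### Reflection at a sink -/

section Sink

variable {k : Type u} [Field k] {Q : Type u} [Quiver.{u} Q] [Finite Q]
  [∀ a b : Q, Finite (a ⟶ b)]

/-- The linear map from the product of the spaces `M_a`, over the arrows `a ⟶ i`, to `M_i`. -/
def sinkSum (M : QuiverRep k Q) (i : Q) :
    (∀ e : (Σ a : Q, (a ⟶ i)), space M e.1) →ₗ[k] space M i :=
  letI := Fintype.ofFinite (Σ a : Q, (a ⟶ i))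
  ∑ e, actAt M e.2 ∘ₗ LinearMap.proj e

open scoped Classical in
theorem sinkSum_single (M : QuiverRep k Q) (i : Q) (e : Σ a : Q, (a ⟶ i)) (x : space M e.1) :
    sinkSum M i (Pi.single e x) = actAt M e.2 x := by
  let := Fintype.ofFinite (Σ a : Q, (a ⟶ i))
  simp only [sinkSum, LinearMap.sum_apply, LinearMap.comp_apply, LinearMap.proj_apply]
  rw [Finset.sum_eq_single e (fun b _ hb => by rw [Pi.single_eq_of_ne hb, map_zero])
    (fun h => absurd (Finset.mem_univ e) h), Pi.single_eq_same]

theorem linAt_sinkSum {M N : QuiverRep k Q} (φ : M ⟶ N) (i : Q)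
    (x : ∀ e : (Σ a : Q, (a ⟶ i)), space M e.1) :
    linAt φ i (sinkSum M i x) = sinkSum N i fun e => linAt φ e.1 (x e) := by
  let := Fintype.ofFinite (Σ a : Q, (a ⟶ i))
  simp [sinkSum, linAt_act]

theorem sinkMap_apply (M : QuiverRep k Q) (i : Q)
    (x : (⨁ fun e : (Σ a : Q, (a ⟶ i)) => space M e.1 : ModuleCat.{u} k)) :
    (sinkMap M i).hom x = sinkSum M i fun e =>
      (biproduct.π (fun e : (Σ a : Q, (a ⟶ i)) => space M e.1) e).hom x := by
  let := Fintype.ofFinite (Σ a : Q, (a ⟶ i))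
  rw [biproduct_eq_sum _ x, map_sum]
  simp only [sinkSum, LinearMap.sum_apply, LinearMap.comp_apply, LinearMap.proj_apply]
  refine Finset.sum_congr rfl fun e _ => ?_
  rw [← biproduct_eq_sum _ x]
  have h : biproduct.ι (fun e : (Σ a : Q, (a ⟶ i)) => space M e.1) e ≫ sinkMap M i =
      arrowMap M e.2 := biproduct.ι_desc _ e
  exact congrArg (fun t => ModuleCat.Hom.hom t
    ((biproduct.π (fun e : (Σ a : Q, (a ⟶ i)) => space M e.1) e).hom x)) h

variable {i : Q} (hi : IsSink i) (M : QuiverRep k Q)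

/-- The space of the reflection of `M` at a vertex other than the reflected one. -/
def sinkEquiv {j : Q} (h : j ≠ i) :
    space (Q := Reflected i) ((reflectSink k hi).obj M) j ≃ₗ[k] space M j :=
  (replaceNe M (kernel (sinkMap M i)) h).toLinearEquiv

/-- The embedding of the new space of the reflection of `M` at a sink. -/
def sinkIncl : space (Q := Reflected i) ((reflectSink k hi).obj M) i →ₗ[k]
    ∀ e : (Σ a : Q, (a ⟶ i)), space M e.1 :=
  LinearMap.pi fun e => ((replaceSelf M i _).hom ≫ kernel.ι (sinkMap M i) ≫
    biproduct.π (fun e : (Σ a : Q, (a ⟶ i)) => space M e.1) e).hom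

theorem sinkIncl_apply (x : space (Q := Reflected i) ((reflectSink k hi).obj M) i)
    (e : Σ a : Q, (a ⟶ i)) : sinkIncl hi M x e =
      (biproduct.π (fun e : (Σ a : Q, (a ⟶ i)) => space M e.1) e).hom
        ((kernel.ι (sinkMap M i)).hom ((replaceSelf M i _).toLinearEquiv x)) := rfl

theorem sinkIncl_injective : Function.Injective (sinkIncl hi M) := by
  intro x y h
  apply (replaceSelf M i (kernel (sinkMap M i))).toLinearEquiv.injective
  apply (ModuleCat.mono_iff_injective (kernel.ι (sinkMap M i))).1 inferInstance
  exact biproduct_ext_apply _ fun e => congrFun h e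

/-- Together with `sinkIncl_injective`, this presents the new space as a kernel inside an ordinary
product, free of biproducts and casts. -/
theorem sinkIncl_exact : Function.Exact (sinkIncl hi M) (sinkSum M i) := by
  have hS := (ShortComplex.ShortExact.moduleCat_exact_iff_function_exact _).1
    (ShortComplex.exact_of_f_is_kernel (ShortComplex.mk (kernel.ι (sinkMap M i)) (sinkMap M i)
      (kernel.condition _)) (kernelIsKernel (sinkMap M i)))
  intro x
  constructor
  · intro hx
    obtain ⟨y, hy⟩ := exists_biproduct_apply (fun e : (Σ a : Q, (a ⟶ i)) => space M e.1) x
    obtain ⟨z, hz⟩ := (hS y).1 (by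
      refine (sinkMap_apply M i y).trans ?_
      simp only [hy, hx])
    obtain ⟨t, rfl⟩ := (replaceSelf M i (kernel (sinkMap M i))).toLinearEquiv.surjective z
    refine ⟨t, funext fun e => (hy e).symm ▸ ?_⟩
    exact congrArg (biproduct.π (fun e : (Σ a : Q, (a ⟶ i)) => space M e.1) e).hom hz
  · rintro ⟨t, rfl⟩
    exact (sinkMap_apply M i _).symm.trans (hS.apply_apply_eq_zero _)

theorem actAt_reflectSink {a b : Q} (r : ReflArrow i a b)
    (x : space (Q := Reflected i) ((reflectSink k hi).obj M) a) :
    actAt (Q := Reflected i) (a := a) (b := b) ((reflectSink k hi).obj M) r x =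
      (reflectSinkMap hi M r).hom x :=
  LinearMap.congr_fun (congrArg ModuleCat.Hom.hom (arrowMap_mk (Q := Reflected i)
    (fun j => replaceObj (Q := Q) M i (kernel (sinkMap M i)) j)
    (fun _ _ r => reflectSinkMap hi M r) (a := a) (b := b) r)) x

theorem sinkEquiv_act_keep {a b : Q} (ha : a ≠ i) (hb : b ≠ i) (e : a ⟶ b)
    (x : space (Q := Reflected i) ((reflectSink k hi).obj M) a) :
    sinkEquiv hi M hb (actAt (Q := Reflected i) (a := a) (b := b) ((reflectSink k hi).obj M)
      (ReflArrow.keep ha hb e) x) = actAt M e (sinkEquiv hi M ha x) := by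
  rw [actAt_reflectSink]
  exact (replaceNe M (kernel (sinkMap M i)) hb).toLinearEquiv.apply_symm_apply _

theorem sinkEquiv_act_flip {a : Q} (e : a ⟶ i)
    (x : space (Q := Reflected i) ((reflectSink k hi).obj M) i) :
    sinkEquiv hi M (hi.ne e) (actAt (Q := Reflected i) (a := i) (b := a) ((reflectSink k hi).obj M)
      (ReflArrow.flipIn e) x) = sinkIncl hi M x ⟨a, e⟩ := by
  rw [actAt_reflectSink]
  exact (replaceNe M (kernel (sinkMap M i)) (hi.ne e)).toLinearEquiv.apply_symm_apply _

variable {M} {N : QuiverRep k Q}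

theorem sinkEquiv_linAt (φ : M ⟶ N) {j : Q} (h : j ≠ i)
    (x : space (Q := Reflected i) ((reflectSink k hi).obj M) j) :
    sinkEquiv hi N h (linAt (Q := Reflected i) ((reflectSink k hi).map φ) j x) =
      linAt φ j (sinkEquiv hi M h x) := by
  have h1 : linAt (Q := Reflected i) ((reflectSink k hi).map φ) j x =
    (replaceHom (Q := Q) (i := i) φ (sinkKernelMap φ i) j).hom x := rfl
  rw [h1, replaceHom_ne _ _ h]
  exact (replaceNe N (kernel (sinkMap N i)) h).toLinearEquiv.apply_symm_apply _

theorem sinkIncl_linAt (φ : M ⟶ N)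
    (x : space (Q := Reflected i) ((reflectSink k hi).obj M) i) (e : Σ a : Q, (a ⟶ i)) :
    sinkIncl hi N (linAt (Q := Reflected i) ((reflectSink k hi).map φ) i x) e =
      linAt φ e.1 (sinkIncl hi M x e) := by
  have h1 : linAt (Q := Reflected i) ((reflectSink k hi).map φ) i x =
    (replaceHom (Q := Q) (i := i) φ (sinkKernelMap φ i) i).hom x := rfl
  rw [sinkIncl_apply, sinkIncl_apply, h1, replaceHom_self]
  have h2 : (replaceSelf M i _).hom ≫ sinkKernelMap φ i ≫ kernel.ι (sinkMap N i) ≫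
      biproduct.π (fun e : (Σ a : Q, (a ⟶ i)) => space N e.1) e =
      (replaceSelf M i _).hom ≫ kernel.ι (sinkMap M i) ≫
      biproduct.π (fun e : (Σ a : Q, (a ⟶ i)) => space M e.1) e ≫ homAt φ e.1 := by
    simp [sinkKernelMap]
  have h3 := congrArg (fun t => ModuleCat.Hom.hom t x) h2
  refine Eq.trans ?_ h3
  exact congrArg (fun t => (biproduct.π (fun e : (Σ a : Q, (a ⟶ i)) => space N e.1) e).hom
    ((kernel.ι (sinkMap N i)).hom t))
    ((replaceSelf N i (kernel (sinkMap N i))).toLinearEquiv.apply_symm_apply _)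

end Sink

/-! ### Full faithfulness, Ext¹ and exactness for reflection at a sink -/

section SinkFunctor

variable {k : Type u} [Field k] {Q : Type u} [Quiver.{u} Q] [Finite Q]
  [∀ a b : Q, Finite (a ⟶ b)] {i : Q} (hi : IsSink i)

theorem reflectSink_hom_ext {L : QuiverRep k (Reflected i)} {N : QuiverRep k Q}
    {α β : L ⟶ (reflectSink k hi).obj N}
    (h₁ : ∀ (j : Q) (h : j ≠ i) (x : space (Q := Reflected i) L j),
      sinkEquiv hi N h (linAt (Q := Reflected i) α j x) =
        sinkEquiv hi N h (linAt (Q := Reflected i) β j x))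
    (h₂ : ∀ (x : space (Q := Reflected i) L i) (e : Σ a : Q, (a ⟶ i)),
      sinkIncl hi N (linAt (Q := Reflected i) α i x) e =
        sinkIncl hi N (linAt (Q := Reflected i) β i x) e) : α = β := by
  refine linAt_ext (Q := Reflected i) fun (j : Q) => LinearMap.ext fun x => ?_
  by_cases hj : j = i
  · subst hj
    exact sinkIncl_injective hi N (funext (h₂ x))
  · exact (sinkEquiv hi N hj).injective (h₁ j hj x)

instance : (reflectSink k hi).Additive where
  map_add {M N φ ψ} := by
    refine reflectSink_hom_ext hi (fun j h x => ?_) fun x e => ?_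
    · exact (sinkEquiv_linAt hi _ h x).trans ((congrArg₂ (· + ·) (sinkEquiv_linAt hi φ h x)
        (sinkEquiv_linAt hi ψ h x)).symm.trans (map_add (sinkEquiv hi N h) _ _).symm)
    · exact (sinkIncl_linAt hi _ x e).trans ((congrArg₂ (· + ·) (sinkIncl_linAt hi φ x e)
        (sinkIncl_linAt hi ψ x e)).symm.trans
          (congrFun (map_add (sinkIncl hi N) _ _).symm e))

theorem IsFinDim.reflectSink {M : QuiverRep k Q} (hM : IsFinDim M) :
    IsFinDim ((reflectSink k hi).obj M) := fun (j : Q) => by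
  have := hM
  by_cases hj : j = i
  · subst hj
    have : ∀ j : Q, Module.Finite k (space M j) := hM
    exact Module.Finite.of_injective (sinkIncl hi M) (sinkIncl_injective hi M)
  · have := hM j
    exact Module.Finite.equiv (sinkEquiv hi M hj).symm

/-- Since M_i is the quotient of the product of the M_a by the new space of the reflection, a
morphism out of M is determined away from i. A morphism of reflections yields maps away from i that
respect these kernels, so they descend to M_i. -/
theorem reflectSink_map_bijective {M N : QuiverRep k Q}
    (hM : Function.Surjective (sinkSum M i)) :
    Function.Bijective ((reflectSink k hi).map :
      (M ⟶ N) → ((reflectSink k hi).obj M ⟶ (reflectSink k hi).obj N)) := by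
  classical
  constructor
  · intro φ φ' h
    have hne : ∀ j, j ≠ i → ∀ x, linAt φ j x = linAt φ' j x := fun j hj x => by
      obtain ⟨y, rfl⟩ := (sinkEquiv hi M hj).surjective x
      rw [← sinkEquiv_linAt, ← sinkEquiv_linAt, h]
    refine linAt_ext fun j => LinearMap.ext fun x => ?_
    by_cases hj : j = i
    · subst hj
      obtain ⟨y, rfl⟩ := hM x
      rw [linAt_sinkSum, linAt_sinkSum]
      exact congrArg _ (funext fun e => hne _ (hi.ne e.2) _)
    · exact hne j hj x
  · intro ψ
    let c : ∀ j : Q, j ≠ i → (space M j →ₗ[k] space N j) := fun j hj =>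
      (sinkEquiv hi N hj).toLinearMap ∘ₗ linAt (Q := Reflected i) ψ j ∘ₗ
        (sinkEquiv hi M hj).symm.toLinearMap
    have hc : ∀ (j : Q) (hj : j ≠ i) x, c j hj (sinkEquiv hi M hj x) =
        sinkEquiv hi N hj (linAt (Q := Reflected i) ψ j x) := fun j hj x => by simp [c]
    have hflip : ∀ x (e : Σ a : Q, (a ⟶ i)), c e.1 (hi.ne e.2) (sinkIncl hi M x e) =
        sinkIncl hi N (linAt (Q := Reflected i) ψ i x) e := by
      rintro x ⟨a, e⟩
      rw [← sinkEquiv_act_flip, ← sinkEquiv_act_flip, hc]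
      exact congrArg _ (linAt_act (Q := Reflected i) ψ (a := i) (b := a) (ReflArrow.flipIn e) x)
    -- By `hflip` the maps c act on the kernel of `sinkSum M i` as ψ does at i, so they carry it
    -- into the kernel of `sinkSum N i`; hence d is well defined.
    obtain ⟨d, hd⟩ := exists_linearMap_desc hM (sinkIncl_exact hi M)
      (sinkSum N i ∘ₗ LinearMap.pi fun e => c e.1 (hi.ne e.2) ∘ₗ LinearMap.proj e) fun x => by
        rw [← (sinkIncl_exact hi N).apply_apply_eq_zero (linAt (Q := Reflected i) ψ i x)]
        exact congrArg _ (funext fun e => hflip x e)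
    obtain ⟨z, hz, hz'⟩ := exists_family (T := fun j => space M j →ₗ[k] space N j) i d c
    refine ⟨homOfLin z fun {a b} e x => ?_, ?_⟩
    · by_cases hb : b = i
      · subst hb
        have h1 := hd (Pi.single (⟨a, e⟩ : Σ a : Q, (a ⟶ b)) x)
        rw [sinkSum_single] at h1
        rw [hz, h1, hz' a (hi.ne e), LinearMap.comp_apply, ← sinkSum_single N b ⟨a, e⟩]
        refine congrArg _ (funext fun e' => ?_)
        exact Pi.apply_single (fun e : (Σ a : Q, (a ⟶ b)) => c e.1 (hi.ne e.2))
          (fun e => map_zero _) ⟨a, e⟩ x e'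
      · have ha : a ≠ i := by
          rintro rfl
          exact (hi b).false e
        obtain ⟨y, rfl⟩ := (sinkEquiv hi M ha).surjective x
        rw [hz' a ha, hz' b hb, ← sinkEquiv_act_keep hi M ha hb, hc, hc, ← sinkEquiv_act_keep]
        exact congrArg _ (linAt_act (Q := Reflected i) ψ (a := a) (b := b) _ y)
    · refine reflectSink_hom_ext hi (fun j h x => ?_) fun x e => ?_
      · rw [sinkEquiv_linAt, linAt_homOfLin, hz' j h, hc]
      · rw [sinkIncl_linAt, linAt_homOfLin, hz' e.1 (hi.ne e.2), hflip]

/-- A family c on σ_iQ becomes a family on Q: it is kept at the arrows away from i, and its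
components at the flipped arrows, assembled into t, are summed into N_i. A solution φ for Q,
corrected by t on the new space, solves c. -/
theorem subsingleton_ext_reflectSink {M N : QuiverRep k Q} (h : Subsingleton (Ext M N 1)) :
    Subsingleton (Ext ((reflectSink k hi).obj M) ((reflectSink k hi).obj N) 1) := by
  classical
  rw [subsingleton_ext_iff] at h
  refine (subsingleton_ext_iff (Q := Reflected i) _ _).2 fun c => ?_
  let cf : ∀ a (e : a ⟶ i), _ := fun a e => c i a (ReflArrow.flipIn e)
  let ck : ∀ {a b : Q} (ha : a ≠ i) (hb : b ≠ i) (e : a ⟶ b), _ := fun {a b} ha hb e =>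
    c a b (ReflArrow.keep ha hb e)
  obtain ⟨r, hr⟩ := LinearMap.exists_leftInverse_of_injective (sinkIncl hi M)
    (LinearMap.ker_eq_bot.2 (sinkIncl_injective hi M))
  -- At flipped arrows c is defined only on the kernel of `sinkSum M i`; the retraction r extends it
  -- to the whole product.
  let t : (∀ e : (Σ a : Q, (a ⟶ i)), space M e.1) →ₗ[k] ∀ e : (Σ a : Q, (a ⟶ i)), space N e.1 :=
    LinearMap.pi fun e => (sinkEquiv hi N (hi.ne e.2)).toLinearMap ∘ₗ cf e.1 e.2 ∘ₗ r
  have ht : ∀ x e, t (sinkIncl hi M x) e = sinkEquiv hi N (hi.ne e.2) (cf e.1 e.2 x) :=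
    fun x e => by
      have : r (sinkIncl hi M x) = x := LinearMap.congr_fun hr x
      simp [t, this]
  obtain ⟨d, hd, hd'⟩ := exists_family
    (T := fun b => ∀ a, (a ⟶ b) → (space M a →ₗ[k] space N b)) i
    (fun a e => - (sinkSum N i ∘ₗ t ∘ₗ LinearMap.single k _ (⟨a, e⟩ : Σ a : Q, (a ⟶ i))))
    (fun b hb a e =>
      have ha : a ≠ i := by
        rintro rfl
        exact (hi b).false e
      (sinkEquiv hi N hb).toLinearMap ∘ₗ ck ha hb e ∘ₗ (sinkEquiv hi M ha).symm.toLinearMap)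
  obtain ⟨φ, hφ⟩ := h fun a b e => d b a e
  have hsum : ∀ x, φ i (sinkSum M i x) - sinkSum N i (fun e => φ e.1 (x e)) =
      - sinkSum N i (t x) := by
    intro x
    let A : (∀ e : (Σ a : Q, (a ⟶ i)), space M e.1) →ₗ[k] space N i :=
      φ i ∘ₗ sinkSum M i - sinkSum N i ∘ₗ LinearMap.pi fun e => φ e.1 ∘ₗ LinearMap.proj e
    have hA : A = - (sinkSum N i ∘ₗ t) := by
      refine LinearMap.pi_ext fun e y => ?_
      have h1 := hφ e.1 i e.2 y
      rw [hd, ← sinkSum_single M i e, ← sinkSum_single N i e] at h1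
      refine Eq.trans ?_ h1
      refine congrArg (fun t => φ i (sinkSum M i (Pi.single e y)) - sinkSum N i t)
        (funext fun e' => ?_)
      exact Pi.apply_single (fun e : (Σ a : Q, (a ⟶ i)) => φ e.1) (fun e => map_zero _) e y e'
    exact LinearMap.congr_fun hA x
  -- On the kernel of `sinkSum M i` the identity `hsum` says that φ and t have the same sum in N_i,
  -- so φ - t lands in the new space of N. Subtracting this p from φ leaves exactly t, that is, c at
  -- the flipped arrows.
  obtain ⟨p, hp⟩ := exists_linearMap_lift (sinkIncl_injective hi N) (sinkIncl_exact hi N)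
    ((LinearMap.pi fun e => φ e.1 ∘ₗ LinearMap.proj e) ∘ₗ sinkIncl hi M - t ∘ₗ sinkIncl hi M)
    fun x => by
      have h1 := hsum (sinkIncl hi M x)
      rw [(sinkIncl_exact hi M).apply_apply_eq_zero, map_zero, zero_sub, neg_inj] at h1
      rw [LinearMap.sub_apply, map_sub, sub_eq_zero]
      exact h1
  obtain ⟨z, hz, hz'⟩ := exists_family (T := fun j : Q =>
      space (Q := Reflected i) ((reflectSink k hi).obj M) j →ₗ[k]
        space (Q := Reflected i) ((reflectSink k hi).obj N) j) i p
    fun j hj => (sinkEquiv hi N hj).symm.toLinearMap ∘ₗ φ j ∘ₗ (sinkEquiv hi M hj).toLinearMap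
  have hzne : ∀ (j : Q) (hj : j ≠ i) x, sinkEquiv hi N hj (z j x) = φ j (sinkEquiv hi M hj x) :=
    fun j hj x => by
      rw [hz' j hj]
      simp
  refine ⟨z, fun (a b : Q) (e : ReflArrow i a b) x => ?_⟩
  cases e with
  | keep ha hb e =>
    apply (sinkEquiv hi N hb).injective
    rw [map_sub]
    refine (congrArg₂ (· - ·) ((hzne b hb _).trans (congrArg (φ b)
      (sinkEquiv_act_keep hi M ha hb e x))) ((sinkEquiv_act_keep hi N ha hb e _).trans
        (congrArg (actAt N e) (hzne a ha x)))).trans ?_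
    have h1 := hφ a b e (sinkEquiv hi M ha x)
    rw [hd' b hb] at h1
    simpa [ck] using h1
  | flipIn e =>
    apply (sinkEquiv hi N (hi.ne e)).injective
    rw [map_sub]
    refine (congrArg₂ (· - ·) ((hzne b (hi.ne e) _).trans (congrArg (φ b)
      (sinkEquiv_act_flip hi M e x))) (sinkEquiv_act_flip hi N e _)).trans ?_
    rw [hz, hp]
    simp [ht, cf]
  | flipOut hb e => exact ((hi _).false e).elim

/-- Snake lemma for the maps `sinkSum`: taking kernels is left exact, and surjectivity for A removes
the only obstruction on the right. -/
theorem shortExact_reflectSink {A B C : QuiverRep k Q} {f : A ⟶ B} {g : B ⟶ C} (w : f ≫ g = 0)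
    (hS : (ShortComplex.mk f g w).ShortExact) (hA : Function.Surjective (sinkSum A i)) :
    ∃ w, (ShortComplex.mk ((reflectSink k hi).map f) ((reflectSink k hi).map g) w).ShortExact := by
  have w' : (reflectSink k hi).map f ≫ (reflectSink k hi).map g = 0 := by
    rw [← Functor.map_comp, w, Functor.map_zero]
  refine ⟨w', (shortExact_iff_linAt (Q := Reflected i) _).2 fun (j : Q) => ?_⟩
  rw [shortExact_iff_linAt] at hS
  have hinj := fun j => (hS j).1
  have hex : ∀ j, Function.Exact (linAt f j) (linAt g j) := fun j => (hS j).2.1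
  have hsurj := fun j => (hS j).2.2
  have hw : ∀ x, linAt (Q := Reflected i) ((reflectSink k hi).map g) j
      (linAt (Q := Reflected i) ((reflectSink k hi).map f) j x) = 0 := fun x =>
    LinearMap.congr_fun (congrArg (fun t => linAt (Q := Reflected i) t j) w') x
  by_cases hj : j = i
  · subst hj
    refine ⟨fun x y hxy => ?_, fun y => ⟨fun hy => ?_, ?_⟩, fun z => ?_⟩
    · refine sinkIncl_injective hi A (funext fun e => hinj e.1 ?_)
      rw [← sinkIncl_linAt, ← sinkIncl_linAt]
      exact congrArg (fun t => sinkIncl hi B t e) hxy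
    · have h1 : ∀ e : (Σ a : Q, (a ⟶ j)), ∃ x, linAt f e.1 x = sinkIncl hi B y e := fun e => by
        refine (hex e.1 _).1 ?_
        rw [← sinkIncl_linAt]
        exact (congrArg (fun t => sinkIncl hi C t e) hy).trans (by rw [map_zero]; rfl)
      choose x hx using h1
      obtain ⟨t, ht⟩ := (sinkIncl_exact hi A x).1 (hinj j (by
        rw [linAt_sinkSum, map_zero, ← (sinkIncl_exact hi B).apply_apply_eq_zero y]
        exact congrArg _ (funext hx)))
      refine ⟨t, sinkIncl_injective hi B (funext fun e => ?_)⟩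
      rw [← hx, ← ht]
      exact sinkIncl_linAt hi f t e
    · rintro ⟨x, rfl⟩
      exact hw x
    · choose y hy using fun e : (Σ a : Q, (a ⟶ j)) => hsurj e.1 (sinkIncl hi C z e)
      -- The lift y of z need not lie in the kernel. Its sum comes from A, where it is the sum of
      -- some family; subtracting that family corrects y without changing its image in C.
      obtain ⟨a, ha⟩ := (hex j (sinkSum B j y)).1 (by
        rw [linAt_sinkSum, ← (sinkIncl_exact hi C).apply_apply_eq_zero z]
        exact congrArg _ (funext hy))
      obtain ⟨a, rfl⟩ := hA a
      rw [linAt_sinkSum] at ha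
      obtain ⟨t, ht⟩ := (sinkIncl_exact hi B (y - fun e => linAt f e.1 (a e))).1 (by
        rw [map_sub, ha, sub_self])
      refine ⟨t, sinkIncl_injective hi C (funext fun e => ?_)⟩
      refine (sinkIncl_linAt hi g t e).trans ?_
      rw [ht, Pi.sub_apply, map_sub, (hex e.1).apply_apply_eq_zero, sub_zero]
      exact hy e
  · refine ⟨fun x y hxy => ?_, fun y => ⟨fun hy => ?_, ?_⟩, fun z => ?_⟩
    · apply (sinkEquiv hi A hj).injective
      apply hinj j
      rw [← sinkEquiv_linAt, ← sinkEquiv_linAt]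
      exact congrArg _ hxy
    · obtain ⟨x, hx⟩ := (hex j (sinkEquiv hi B hj y)).1 (by
        rw [← sinkEquiv_linAt]
        exact (congrArg _ hy).trans (map_zero _))
      obtain ⟨t, rfl⟩ := (sinkEquiv hi A hj).surjective x
      refine ⟨t, (sinkEquiv hi B hj).injective ?_⟩
      exact (sinkEquiv_linAt hi f hj t).trans hx
    · rintro ⟨x, rfl⟩
      exact hw x
    · obtain ⟨y, hy⟩ := hsurj j (sinkEquiv hi C hj z)
      obtain ⟨t, rfl⟩ := (sinkEquiv hi B hj).surjective y
      refine ⟨t, (sinkEquiv hi C hj).injective ?_⟩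
      exact (sinkEquiv_linAt hi g hj t).trans hy

end SinkFunctor

/-! ### Multiples of a representation, and the maps X ⟶ Z ⟶ Y of a Schofield sequence -/

section Supported

variable {k : Type u} [Field k] {Q : Type u} [Quiver.{u} Q]

theorem linAt_biproduct_sum {n : ℕ} (X : QuiverRep k Q) (j : Q)
    (x : space (⨁ fun _ : Fin n => X) j) :
    x = ∑ t, linAt (biproduct.ι (fun _ : Fin n => X) t) j
      (linAt (biproduct.π (fun _ : Fin n => X) t) j x) := by
  let L : ((⨁ fun _ : Fin n => X) ⟶ (⨁ fun _ : Fin n => X)) →+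
    (space (⨁ fun _ : Fin n => X) j →ₗ[k] space (⨁ fun _ : Fin n => X) j) :=
    { toFun := fun φ => linAt φ j
      map_zero' := rfl
      map_add' := fun _ _ => rfl }
  have h := congrArg L (biproduct.total (f := fun _ : Fin n => X))
  rw [map_sum] at h
  have h1 := LinearMap.congr_fun h x
  rw [LinearMap.sum_apply] at h1
  exact h1.symm

theorem subsingleton_space_of_iso_simpleRep {M : QuiverRep k Q} {i : Q}
    (h : Nonempty (M ≅ simpleRep k i)) {j : Q} (hj : j ≠ i) : Subsingleton (space M j) :=
  have := subsingleton_space_simpleRep (k := k) hj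
  ((mono_iff_injective h.some.hom).1 inferInstance j).subsingleton

variable {m n : ℕ} {X Z Y : QuiverRep k Q} {f : (⨁ fun _ : Fin m => X) ⟶ Z}
  {g : Z ⟶ ⨁ fun _ : Fin n => Y}

theorem IsSchofieldSequence.exists_mono (h : IsSchofieldSequence m n X Z Y f g) :
    ∃ s : X ⟶ Z, Mono s := by
  obtain ⟨w, hS⟩ := h.exact
  have : Mono f := hS.mono_f
  exact ⟨biproduct.ι (fun _ : Fin m => X) ⟨0, h.pos_left⟩ ≫ f, inferInstance⟩

theorem IsSchofieldSequence.exists_epi (h : IsSchofieldSequence m n X Z Y f g) :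
    ∃ p : Z ⟶ Y, Epi p := by
  obtain ⟨w, hS⟩ := h.exact
  have : Epi g := hS.epi_g
  exact ⟨g ≫ biproduct.π (fun _ : Fin n => Y) ⟨0, h.pos_right⟩, inferInstance⟩

end Supported

/-! ### Schofield sequences under reflection at a sink -/

section SinkSchofield

variable {k : Type u} [Field k] {Q : Type u} [Quiver.{u} Q] [Finite Q]
  [∀ a b : Q, Finite (a ⟶ b)] {i : Q}

/-- A nonzero functional vanishing on the image of the arrows detects a vector at the sink that
spans a direct summand S(i). -/
theorem surjective_sinkSum_or_iso_simpleRep (hi : IsSink i) {M : QuiverRep k Q}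
    (hM : Indecomposable M) :
    Function.Surjective (sinkSum M i) ∨ Nonempty (M ≅ simpleRep k i) := by
  classical
  refine or_iff_not_imp_left.2 fun h => ?_
  have hlt : LinearMap.range (sinkSum M i) < ⊤ :=
    lt_top_iff_ne_top.2 fun h' => h (LinearMap.range_eq_top.1 h')
  obtain ⟨l, hl0, hl⟩ := Submodule.exists_le_ker_of_lt_top _ hlt
  obtain ⟨v, hv⟩ : ∃ v, l v ≠ 0 := by
    by_contra! h'
    exact hl0 (LinearMap.ext h')
  refine nonempty_iso_simpleRep hM v (fun b e => ((hi b).false e).elim) l (fun a e x => ?_) hv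
  exact hl ⟨Pi.single (⟨a, e⟩ : Σ a : Q, (a ⟶ i)) x, sinkSum_single M i ⟨a, e⟩ x⟩

theorem surjective_sinkSum_biproduct {X : QuiverRep k Q} (n : ℕ)
    (h : Function.Surjective (sinkSum X i)) :
    Function.Surjective (sinkSum (⨁ fun _ : Fin n => X) i) := by
  intro x
  choose y hy using fun t => h (linAt (biproduct.π (fun _ : Fin n => X) t) i x)
  refine ⟨∑ t, fun e => linAt (biproduct.ι (fun _ : Fin n => X) t) e.1 (y t e), ?_⟩
  rw [map_sum, linAt_biproduct_sum X i x]
  refine Finset.sum_congr rfl fun t _ => ?_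
  rw [← linAt_sinkSum, hy]

theorem IsSchofieldSequence.reflectSink (hi : IsSink i) {X Z Y : QuiverRep k Q} {m n : ℕ}
    {f : (⨁ fun _ : Fin m => X) ⟶ Z} {g : Z ⟶ ⨁ fun _ : Fin n => Y}
    (h : IsSchofieldSequence m n X Z Y f g) (hX : ¬ Nonempty (X ≅ simpleRep k i)) :
    IsSchofieldSequence m n ((reflectSink k hi).obj X) ((reflectSink k hi).obj Z)
      ((reflectSink k hi).obj Y) (mapFrom (reflectSink k hi) f) (mapTo (reflectSink k hi) g) := by
  have hXs : Function.Surjective (sinkSum X i) := (surjective_sinkSum_or_iso_simpleRep hi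
    h.pair.exceptional_right.indecomposable).resolve_right hX
  obtain ⟨w, hS⟩ := h.exact
  refine h.map (QuiverRep.reflectSink k hi) (fun M => Function.Surjective (sinkSum M i)) hXs ?_ ?_
    (fun M hM => hM.reflectSink hi) (fun M N hM _ _ _ => reflectSink_map_bijective hi hM)
    (fun M N _ _ hMN => subsingleton_ext_reflectSink hi hMN)
    (shortExact_reflectSink hi w hS (surjective_sinkSum_biproduct m hXs))
  -- If Z were S(i), its subobject X would vanish away from i; surjectivity of `sinkSum X i` would
  -- then give X_i = 0 as well.
  · refine (surjective_sinkSum_or_iso_simpleRep hi h.exceptional.indecomposable).resolve_right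
      fun hZ => h.pair.exceptional_right.indecomposable.1 ?_
    obtain ⟨s, hs⟩ := h.exists_mono
    have hne : ∀ j, j ≠ i → Subsingleton (space X j) := fun j hj =>
      have := subsingleton_space_of_iso_simpleRep hZ hj
      ((mono_iff_injective s).1 hs j).subsingleton
    refine (isZero_iff_subsingleton X).2 fun j => ?_
    by_cases hj : j = i
    · subst hj
      have := fun e : (Σ a : Q, (a ⟶ j)) => hne e.1 (hi.ne e.2)
      exact hXs.subsingleton
    · exact hne j hj
  -- If Y were S(i), no arrow would start in its support, so the criterion for Ext¹(Y, X) = 0 would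
  -- hold trivially.
  · refine (surjective_sinkSum_or_iso_simpleRep hi
      h.pair.exceptional_left.indecomposable).resolve_right fun hY => h.not_subsingleton_ext ?_
    rw [subsingleton_ext_iff]
    refine fun c => ⟨fun _ => 0, fun a b e x => ?_⟩
    have ha : a ≠ i := by
      rintro rfl
      exact (hi b).false e
    have := subsingleton_space_of_iso_simpleRep hY ha
    simp [Subsingleton.elim x 0]

end SinkSchofield

/-! ### Reflection at a source -/

section Source

variable {k : Type u} [Field k] {Q : Type u} [Quiver.{u} Q]

theorem IsSource.ne {i b : Q} (hi : IsSource i) (e : i ⟶ b) : b ≠ i := by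
  rintro rfl
  exact (hi b).false e

/-- The linear map from `M_i` to the product of the spaces `M_b`, over the arrows `i ⟶ b`. -/
def sourceDiag (M : QuiverRep k Q) (i : Q) :
    space M i →ₗ[k] ∀ e : (Σ b : Q, (i ⟶ b)), space M e.1 :=
  LinearMap.pi fun e => actAt M e.2

theorem sourceDiag_linAt {M N : QuiverRep k Q} (φ : M ⟶ N) (i : Q) (x : space M i) :
    sourceDiag N i (linAt φ i x) = fun e => linAt φ e.1 (sourceDiag M i x e) :=
  funext fun e => (linAt_act φ e.2 x).symm

variable [Finite Q] [∀ a b : Q, Finite (a ⟶ b)]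

theorem biproduct_π_sourceMap (M : QuiverRep k Q) (i : Q) (x : space M i)
    (e : Σ b : Q, (i ⟶ b)) :
    (biproduct.π (fun e : (Σ b : Q, (i ⟶ b)) => space M e.1) e).hom ((sourceMap M i).hom x) =
      sourceDiag M i x e := by
  have h : sourceMap M i ≫ biproduct.π (fun e : (Σ b : Q, (i ⟶ b)) => space M e.1) e =
      arrowMap M e.2 := biproduct.lift_π _ e
  exact congrArg (fun t => ModuleCat.Hom.hom t x) h

variable {i : Q} (hi : IsSource i) (M : QuiverRep k Q)

/-- The space of the reflection of `M` at a vertex other than the reflected one. -/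
def sourceEquiv {j : Q} (h : j ≠ i) :
    space (Q := Reflected i) ((reflectSource k hi).obj M) j ≃ₗ[k] space M j :=
  (replaceNe M (cokernel (sourceMap M i)) h).toLinearEquiv

/-- The isomorphism of the new space of the reflection of `M` at a source with a cokernel. -/
def sourceSelf : space (Q := Reflected i) ((reflectSource k hi).obj M) i ≃ₗ[k]
    (cokernel (sourceMap M i) : ModuleCat.{u} k) :=
  (replaceSelf M i (cokernel (sourceMap M i))).toLinearEquiv

/-- The projection onto the new space of the reflection of `M` at a source. -/
def sourceProj : (∀ e : (Σ b : Q, (i ⟶ b)), space M e.1) →ₗ[k]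
    space (Q := Reflected i) ((reflectSource k hi).obj M) i :=
  letI := Fintype.ofFinite (Σ b : Q, (i ⟶ b))
  (sourceSelf hi M).symm.toLinearMap ∘ₗ (cokernel.π (sourceMap M i)).hom ∘ₗ
    ∑ e, (biproduct.ι (fun e : (Σ b : Q, (i ⟶ b)) => space M e.1) e).hom ∘ₗ LinearMap.proj e

theorem sourceSelf_sourceProj (y : (⨁ fun e : (Σ b : Q, (i ⟶ b)) => space M e.1 : ModuleCat.{u} k))
    (x : ∀ e : (Σ b : Q, (i ⟶ b)), space M e.1)
    (h : ∀ e, (biproduct.π (fun e : (Σ b : Q, (i ⟶ b)) => space M e.1) e).hom y = x e) :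
    sourceSelf hi M (sourceProj hi M x) = (cokernel.π (sourceMap M i)).hom y := by
  let := Fintype.ofFinite (Σ b : Q, (i ⟶ b))
  obtain rfl : _ = x := funext h
  refine ((sourceSelf hi M).apply_symm_apply _).trans
    (congrArg (cokernel.π (sourceMap M i)).hom ?_)
  rw [LinearMap.sum_apply]
  exact (biproduct_eq_sum _ y).symm

theorem sourceProj_surjective : Function.Surjective (sourceProj hi M) := by
  intro z
  obtain ⟨y, hy⟩ := (ModuleCat.epi_iff_surjective (cokernel.π (sourceMap M i))).1 inferInstance
    (sourceSelf hi M z)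
  exact ⟨_, (sourceSelf hi M).injective
    ((sourceSelf_sourceProj hi M y _ fun _ => rfl).trans hy)⟩

/-- With `sourceProj_surjective`, this presents the new space as the cokernel of `sourceDiag M i` on
an ordinary product. -/
theorem sourceProj_exact : Function.Exact (sourceDiag M i) (sourceProj hi M) := by
  have hS := (ShortComplex.ShortExact.moduleCat_exact_iff_function_exact _).1
    (ShortComplex.exact_of_g_is_cokernel (ShortComplex.mk (sourceMap M i)
      (cokernel.π (sourceMap M i)) (cokernel.condition _)) (cokernelIsCokernel (sourceMap M i)))
  intro x
  obtain ⟨y, hy⟩ := exists_biproduct_apply (fun e : (Σ b : Q, (i ⟶ b)) => space M e.1) x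
  rw [← (sourceSelf hi M).map_eq_zero_iff, sourceSelf_sourceProj hi M y x hy]
  refine (hS y).trans ⟨?_, ?_⟩
  · rintro ⟨m, hm⟩
    refine ⟨m, funext fun e => ?_⟩
    rw [← hy, ← biproduct_π_sourceMap]
    exact congrArg _ hm
  · rintro ⟨m, hm⟩
    refine ⟨m, biproduct_ext_apply _ fun e => ?_⟩
    rw [hy, ← hm]
    exact biproduct_π_sourceMap M i m e

theorem actAt_reflectSource {a b : Q} (r : ReflArrow i a b)
    (x : space (Q := Reflected i) ((reflectSource k hi).obj M) a) :
    actAt (Q := Reflected i) (a := a) (b := b) ((reflectSource k hi).obj M) r x =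
      (reflectSourceMap hi M r).hom x :=
  LinearMap.congr_fun (congrArg ModuleCat.Hom.hom (arrowMap_mk (Q := Reflected i)
    (fun j => replaceObj (Q := Q) M i (cokernel (sourceMap M i)) j)
    (fun _ _ r => reflectSourceMap hi M r) (a := a) (b := b) r)) x

theorem sourceEquiv_act_keep {a b : Q} (ha : a ≠ i) (hb : b ≠ i) (e : a ⟶ b)
    (x : space (Q := Reflected i) ((reflectSource k hi).obj M) a) :
    sourceEquiv hi M hb (actAt (Q := Reflected i) (a := a) (b := b) ((reflectSource k hi).obj M)
      (ReflArrow.keep ha hb e) x) = actAt M e (sourceEquiv hi M ha x) := by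
  rw [actAt_reflectSource]
  exact (replaceNe M (cokernel (sourceMap M i)) hb).toLinearEquiv.apply_symm_apply _

open scoped Classical in
theorem act_flip_eq_sourceProj {b : Q} (hb : b ≠ i) (e : i ⟶ b)
    (x : space (Q := Reflected i) ((reflectSource k hi).obj M) b) :
    actAt (Q := Reflected i) (a := b) (b := i) ((reflectSource k hi).obj M)
      (ReflArrow.flipOut hb e) x =
        sourceProj hi M (Pi.single (⟨b, e⟩ : Σ b : Q, (i ⟶ b)) (sourceEquiv hi M hb x)) := by
  apply (sourceSelf hi M).injective
  rw [actAt_reflectSource, sourceSelf_sourceProj hi M ((biproduct.ι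
    (fun e : (Σ b : Q, (i ⟶ b)) => space M e.1) ⟨b, e⟩).hom (sourceEquiv hi M hb x))]
  · exact (replaceSelf M i (cokernel (sourceMap M i))).toLinearEquiv.apply_symm_apply _
  · intro e'
    by_cases he : e' = ⟨b, e⟩
    · subst he
      rw [Pi.single_eq_same]
      exact congrArg (fun t => ModuleCat.Hom.hom t (sourceEquiv hi M hb x))
        (biproduct.ι_π_self (fun e : (Σ b : Q, (i ⟶ b)) => space M e.1) ⟨b, e⟩)
    · rw [Pi.single_eq_of_ne he]
      exact congrArg (fun t => ModuleCat.Hom.hom t (sourceEquiv hi M hb x))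
        (biproduct.ι_π_ne (fun e : (Σ b : Q, (i ⟶ b)) => space M e.1) (Ne.symm he))

variable {M} {N : QuiverRep k Q}

theorem sourceEquiv_linAt (φ : M ⟶ N) {j : Q} (h : j ≠ i)
    (x : space (Q := Reflected i) ((reflectSource k hi).obj M) j) :
    sourceEquiv hi N h (linAt (Q := Reflected i) ((reflectSource k hi).map φ) j x) =
      linAt φ j (sourceEquiv hi M h x) := by
  have h1 : linAt (Q := Reflected i) ((reflectSource k hi).map φ) j x =
    (replaceHom (Q := Q) (i := i) φ (sourceCokernelMap φ i) j).hom x := rfl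
  rw [h1, replaceHom_ne _ _ h]
  exact (replaceNe N (cokernel (sourceMap N i)) h).toLinearEquiv.apply_symm_apply _

theorem linAt_sourceProj (φ : M ⟶ N) (x : ∀ e : (Σ b : Q, (i ⟶ b)), space M e.1) :
    linAt (Q := Reflected i) ((reflectSource k hi).map φ) i (sourceProj hi M x) =
      sourceProj hi N fun e => linAt φ e.1 (x e) := by
  obtain ⟨y, hy⟩ := exists_biproduct_apply (fun e : (Σ b : Q, (i ⟶ b)) => space M e.1) x
  have h1 : linAt (Q := Reflected i) ((reflectSource k hi).map φ) i (sourceProj hi M x) =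
    (replaceHom (Q := Q) (i := i) φ (sourceCokernelMap φ i) i).hom (sourceProj hi M x) := rfl
  apply (sourceSelf hi N).injective
  rw [h1, replaceHom_self, sourceSelf_sourceProj hi N ((biproduct.map fun e :
    (Σ b : Q, (i ⟶ b)) => homAt φ e.1).hom y)]
  · have h2 : cokernel.π (sourceMap M i) ≫ sourceCokernelMap φ i =
      (biproduct.map fun e : (Σ b : Q, (i ⟶ b)) => homAt φ e.1) ≫ cokernel.π (sourceMap N i) := by
      simp [sourceCokernelMap]
    refine Eq.trans ((sourceSelf hi N).apply_symm_apply _)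
      (Eq.trans ?_ (congrArg (fun t => ModuleCat.Hom.hom t y) h2))
    exact congrArg (sourceCokernelMap φ i).hom (sourceSelf_sourceProj hi M y x hy)
  · intro e
    rw [← hy]
    exact congrArg (fun t => ModuleCat.Hom.hom t y)
      (biproduct.map_π (fun e : (Σ b : Q, (i ⟶ b)) => homAt φ e.1) e)

end Source

/-! ### Reflection at a source: full faithfulness, Ext¹, exactness and Schofield sequences -/

section SourceFunctor

variable {k : Type u} [Field k] {Q : Type u} [Quiver.{u} Q]

/-- A nonzero vector at a source killed by all arrows spans a direct summand S(i), any functional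
not vanishing on it giving the projection. -/
theorem injective_sourceDiag_or_iso_simpleRep {M : QuiverRep k Q} (hM : Indecomposable M)
    {i : Q} (hi : IsSource i) :
    Function.Injective (sourceDiag M i) ∨ Nonempty (M ≅ simpleRep k i) := by
  refine or_iff_not_imp_left.2 fun h => ?_
  rw [injective_iff_map_eq_zero] at h
  push Not at h
  obtain ⟨v, hv, hv0⟩ := h
  obtain ⟨l, hl⟩ : ∃ l : Module.Dual k (space M i), l v ≠ 0 := by
    by_contra! h'
    exact hv0 ((Module.forall_dual_apply_eq_zero_iff k v).1 h')
  exact nonempty_iso_simpleRep hM v (fun b e => congrFun hv ⟨b, e⟩) l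
    (fun a e => ((hi a).false e).elim) hl

theorem injective_sourceDiag_biproduct {X : QuiverRep k Q} {i : Q} (n : ℕ)
    (h : Function.Injective (sourceDiag X i)) :
    Function.Injective (sourceDiag (⨁ fun _ : Fin n => X) i) := by
  rw [injective_iff_map_eq_zero]
  intro x hx
  rw [linAt_biproduct_sum X i x]
  refine Finset.sum_eq_zero fun t _ => ?_
  rw [show linAt (biproduct.π (fun _ : Fin n => X) t) i x = 0 from h (by
    rw [sourceDiag_linAt, hx, map_zero]
    exact funext fun e => map_zero _), map_zero]

variable [Finite Q]
  [∀ a b : Q, Finite (a ⟶ b)] {i : Q} (hi : IsSource i)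

theorem reflectSource_hom_ext {L : QuiverRep k (Reflected i)} {M : QuiverRep k Q}
    {α β : (reflectSource k hi).obj M ⟶ L}
    (h₁ : ∀ (j : Q) (_ : j ≠ i) (x : space (Q := Reflected i) ((reflectSource k hi).obj M) j),
      linAt (Q := Reflected i) α j x = linAt (Q := Reflected i) β j x)
    (h₂ : ∀ x : (∀ e : (Σ b : Q, (i ⟶ b)), space M e.1),
      linAt (Q := Reflected i) α i (sourceProj hi M x) =
        linAt (Q := Reflected i) β i (sourceProj hi M x)) : α = β := by
  refine linAt_ext (Q := Reflected i) fun (j : Q) => LinearMap.ext fun x => ?_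
  by_cases hj : j = i
  · subst hj
    obtain ⟨y, rfl⟩ := sourceProj_surjective hi M x
    exact h₂ y
  · exact h₁ j hj x

instance : (reflectSource k hi).Additive where
  map_add {M N φ ψ} := by
    refine reflectSource_hom_ext hi (fun j h x => (sourceEquiv hi N h).injective ?_) fun x => ?_
    · exact (sourceEquiv_linAt hi _ h x).trans ((congrArg₂ (· + ·) (sourceEquiv_linAt hi φ h x)
        (sourceEquiv_linAt hi ψ h x)).symm.trans (map_add (sourceEquiv hi N h) _ _).symm)
    · exact (linAt_sourceProj hi _ x).trans ((map_add (sourceProj hi N) _ _).trans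
        (congrArg₂ (· + ·) (linAt_sourceProj hi φ x) (linAt_sourceProj hi ψ x)).symm)

theorem IsFinDim.reflectSource {M : QuiverRep k Q} (hM : IsFinDim M) :
    IsFinDim ((reflectSource k hi).obj M) := fun (j : Q) => by
  by_cases hj : j = i
  · subst hj
    have : ∀ j : Q, Module.Finite k (space M j) := hM
    exact Module.Finite.of_surjective (sourceProj hi M) (sourceProj_surjective hi M)
  · have := hM j
    exact Module.Finite.equiv (sourceEquiv hi M hj).symm

/-- Since N_i embeds in the product of the N_b as the kernel of the projection to the new space, a
morphism into N is determined away from i, and a morphism of reflections restricts to a map M_i ⟶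
N_i. -/
theorem reflectSource_map_bijective {M N : QuiverRep k Q}
    (hN : Function.Injective (sourceDiag N i)) :
    Function.Bijective ((reflectSource k hi).map :
      (M ⟶ N) → ((reflectSource k hi).obj M ⟶ (reflectSource k hi).obj N)) := by
  classical
  constructor
  · intro φ φ' h
    have hne : ∀ j, j ≠ i → ∀ x, linAt φ j x = linAt φ' j x := fun j hj x => by
      obtain ⟨y, rfl⟩ := (sourceEquiv hi M hj).surjective x
      rw [← sourceEquiv_linAt, ← sourceEquiv_linAt, h]
    refine linAt_ext fun j => LinearMap.ext fun x => ?_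
    by_cases hj : j = i
    · subst hj
      apply hN
      rw [sourceDiag_linAt, sourceDiag_linAt]
      exact funext fun e => hne _ (hi.ne e.2) _
    · exact hne j hj x
  · intro ψ
    let c : ∀ j : Q, j ≠ i → (space M j →ₗ[k] space N j) := fun j hj =>
      (sourceEquiv hi N hj).toLinearMap ∘ₗ linAt (Q := Reflected i) ψ j ∘ₗ
        (sourceEquiv hi M hj).symm.toLinearMap
    have hc : ∀ (j : Q) (hj : j ≠ i) x, c j hj (sourceEquiv hi M hj x) =
        sourceEquiv hi N hj (linAt (Q := Reflected i) ψ j x) := fun j hj x => by simp [c]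
    let C : (∀ e : (Σ b : Q, (i ⟶ b)), space M e.1) →ₗ[k] ∀ e : (Σ b : Q, (i ⟶ b)), space N e.1 :=
      LinearMap.pi fun e => c e.1 (hi.ne e.2) ∘ₗ LinearMap.proj e
    have hflip : ∀ x, sourceProj hi N (C x) =
        linAt (Q := Reflected i) ψ i (sourceProj hi M x) := by
      intro x
      refine LinearMap.congr_fun (f := sourceProj hi N ∘ₗ C)
        (g := linAt (Q := Reflected i) ψ i ∘ₗ sourceProj hi M) (LinearMap.pi_ext ?_) x
      rintro ⟨b, e⟩ y
      obtain ⟨y, rfl⟩ := (sourceEquiv hi M (hi.ne e)).surjective y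
      have h1 := linAt_act (Q := Reflected i) ψ (a := b) (b := i) (ReflArrow.flipOut (hi.ne e) e) y
      rw [act_flip_eq_sourceProj] at h1
      refine Eq.trans (congrArg (sourceProj hi N) ?_)
        ((act_flip_eq_sourceProj hi N (hi.ne e) e _).symm.trans h1.symm)
      rw [← hc]
      exact funext fun e' => Pi.apply_single (fun e : (Σ b : Q, (i ⟶ b)) => c e.1 (hi.ne e.2))
          (fun e => map_zero _) ⟨b, e⟩ _ e'
    -- By `hflip` the map C sends the image of M_i to vectors that die in the new space of N, that
    -- is, into the image of N_i.
    obtain ⟨d, hd⟩ := exists_linearMap_lift hN (sourceProj_exact hi N) (C ∘ₗ sourceDiag M i)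
      fun x => by
        rw [LinearMap.comp_apply, hflip, (sourceProj_exact hi M).apply_apply_eq_zero, map_zero]
    obtain ⟨z, hz, hz'⟩ := exists_family (T := fun j => space M j →ₗ[k] space N j) i d c
    refine ⟨homOfLin z fun {a b} e x => ?_, ?_⟩
    · by_cases ha : a = i
      · subst ha
        rw [hz, hz' b (hi.ne e)]
        exact (congrFun (hd x) ⟨b, e⟩).symm
      · have hb : b ≠ i := by
          rintro rfl
          exact (hi a).false e
        obtain ⟨y, rfl⟩ := (sourceEquiv hi M ha).surjective x
        rw [hz' a ha, hz' b hb, ← sourceEquiv_act_keep hi M ha hb, hc, hc, ← sourceEquiv_act_keep]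
        exact congrArg _ (linAt_act (Q := Reflected i) ψ (a := a) (b := b) _ y)
    · refine reflectSource_hom_ext hi (fun j h x => (sourceEquiv hi N h).injective ?_) fun x => ?_
      · refine (sourceEquiv_linAt hi _ h x).trans ?_
        rw [linAt_homOfLin, hz' j h]
        exact hc j h x
      · rw [linAt_sourceProj, ← hflip]
        refine congrArg (sourceProj hi N) (funext fun e => ?_)
        rw [linAt_homOfLin, hz' e.1 (hi.ne e.2)]
        rfl

theorem subsingleton_ext_reflectSource {M N : QuiverRep k Q} (h : Subsingleton (Ext M N 1)) :
    Subsingleton (Ext ((reflectSource k hi).obj M) ((reflectSource k hi).obj N) 1) := by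
  classical
  rw [subsingleton_ext_iff] at h
  refine (subsingleton_ext_iff (Q := Reflected i) _ _).2 fun c => ?_
  let cf : ∀ {b : Q} (hb : b ≠ i) (e : i ⟶ b), _ := fun {b} hb e => c b i (ReflArrow.flipOut hb e)
  let ck : ∀ {a b : Q} (ha : a ≠ i) (hb : b ≠ i) (e : a ⟶ b), _ := fun {a b} ha hb e =>
    c a b (ReflArrow.keep ha hb e)
  obtain ⟨s, hs⟩ := LinearMap.exists_rightInverse_of_surjective (sourceProj hi N)
    (LinearMap.range_eq_top.2 (sourceProj_surjective hi N))
  let := Fintype.ofFinite (Σ b : Q, (i ⟶ b))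
  -- At flipped arrows c takes values in the cokernel; the section s lifts them to the product of
  -- the N_b.
  let t : (∀ e : (Σ b : Q, (i ⟶ b)), space M e.1) →ₗ[k] ∀ e : (Σ b : Q, (i ⟶ b)), space N e.1 :=
    s ∘ₗ ∑ e : (Σ b : Q, (i ⟶ b)),
      cf (hi.ne e.2) e.2 ∘ₗ (sourceEquiv hi M (hi.ne e.2)).symm.toLinearMap ∘ₗ LinearMap.proj e
  have ht : ∀ (b : Q) (e : i ⟶ b) x, sourceProj hi N (t (Pi.single (⟨b, e⟩ : Σ b : Q, (i ⟶ b))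
      (sourceEquiv hi M (hi.ne e) x))) = cf (hi.ne e) e x := by
    intro b e x
    refine (LinearMap.congr_fun hs _).trans ?_
    rw [LinearMap.id_apply, LinearMap.sum_apply,
      Finset.sum_eq_single (⟨b, e⟩ : Σ b : Q, (i ⟶ b))]
    · simp only [LinearMap.comp_apply, LinearMap.proj_apply, Pi.single_eq_same]
      exact congrArg _ ((sourceEquiv hi M (hi.ne e)).symm_apply_apply x)
    · intro e' _ he
      simp only [LinearMap.comp_apply, LinearMap.proj_apply, Pi.single_eq_of_ne he]
      exact (congrArg _ (map_zero _)).trans (map_zero _)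
    · exact fun h => absurd (Finset.mem_univ _) h
  have hne : ∀ {a b : Q}, (a ⟶ b) → b ≠ i := by
    rintro a _ e rfl
    exact (hi a).false e
  -- The solution on σ_iQ will be -φ away from i and t - C at i, hence the minus sign at the kept
  -- arrows and none at the arrows out of i.
  obtain ⟨d, hd, hd'⟩ := exists_family
    (T := fun a => ∀ b, (a ⟶ b) → (space M a →ₗ[k] space N b)) i
    (fun b e => LinearMap.proj (⟨b, e⟩ : Σ b : Q, (i ⟶ b)) ∘ₗ t ∘ₗ sourceDiag M i)
    (fun a ha b e =>
      -((sourceEquiv hi N (hne e)).toLinearMap ∘ₗ ck ha (hne e) e ∘ₗ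
        (sourceEquiv hi M ha).symm.toLinearMap))
  obtain ⟨φ, hφ⟩ := h fun a b e => d a b e
  let C : (∀ e : (Σ b : Q, (i ⟶ b)), space M e.1) →ₗ[k] ∀ e : (Σ b : Q, (i ⟶ b)), space N e.1 :=
      LinearMap.pi fun e => φ e.1 ∘ₗ LinearMap.proj e
  have hdiag : ∀ x, C (sourceDiag M i x) - t (sourceDiag M i x) = sourceDiag N i (φ i x) := by
    intro x
    refine funext fun e => ?_
    have h1 := hφ i e.1 e.2 x
    rw [hd, sub_eq_iff_eq_add', ← sub_eq_iff_eq_add] at h1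
    exact h1
  obtain ⟨p, hp⟩ := exists_linearMap_desc (sourceProj_surjective hi M) (sourceProj_exact hi M)
    (sourceProj hi N ∘ₗ (t - C)) fun x => by
      rw [LinearMap.comp_apply, LinearMap.sub_apply, ← neg_sub, hdiag, map_neg,
        (sourceProj_exact hi N).apply_apply_eq_zero, neg_zero]
  obtain ⟨z, hz, hz'⟩ := exists_family (T := fun j : Q =>
      space (Q := Reflected i) ((reflectSource k hi).obj M) j →ₗ[k]
        space (Q := Reflected i) ((reflectSource k hi).obj N) j) i p
    fun j hj => - ((sourceEquiv hi N hj).symm.toLinearMap ∘ₗ φ j ∘ₗ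
      (sourceEquiv hi M hj).toLinearMap)
  have hzne : ∀ (j : Q) (hj : j ≠ i) x,
      sourceEquiv hi N hj (z j x) = - φ j (sourceEquiv hi M hj x) := fun j hj x => by
    rw [hz' j hj]
    simp
  refine ⟨z, fun (a b : Q) (e : ReflArrow i a b) x => ?_⟩
  cases e with
  | keep ha hb e =>
    apply (sourceEquiv hi N hb).injective
    rw [map_sub]
    refine (congrArg₂ (· - ·) ((hzne b hb _).trans (congrArg (fun t => - φ b t)
      (sourceEquiv_act_keep hi M ha hb e x))) ((sourceEquiv_act_keep hi N ha hb e _).trans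
        (congrArg (actAt N e) (hzne a ha x)))).trans ?_
    have h1 := hφ a b e (sourceEquiv hi M ha x)
    rw [hd' a ha] at h1
    rw [map_neg, ← neg_sub', h1]
    simp [ck]
  | flipIn e => exact ((hi _).false e).elim
  | flipOut hb e =>
    refine (congrArg₂ (· - ·) (congrArg (z i) (act_flip_eq_sourceProj hi M hb e x))
      ((act_flip_eq_sourceProj hi N hb e _).trans
        (congrArg (fun t => sourceProj hi N (Pi.single (⟨a, e⟩ : Σ b : Q, (i ⟶ b)) t))
          (hzne a hb x)))).trans ?_
    rw [hz, hp]
    have h1 : C (Pi.single (⟨a, e⟩ : Σ b : Q, (i ⟶ b)) (sourceEquiv hi M hb x)) =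
        Pi.single (⟨a, e⟩ : Σ b : Q, (i ⟶ b)) (φ a (sourceEquiv hi M hb x)) :=
      funext fun e' => Pi.apply_single (fun e : (Σ b : Q, (i ⟶ b)) => φ e.1)
        (fun e => map_zero _) ⟨a, e⟩ _ e'
    rw [LinearMap.comp_apply, LinearMap.sub_apply, map_sub, h1, Pi.single_neg, map_neg, sub_neg_eq_add,
      sub_add_cancel]
    exact ht a e x

/-- Snake lemma for the maps `sourceDiag`: cokernels are right exact, and injectivity for C gives
exactness on the left. -/
theorem shortExact_reflectSource {A B C : QuiverRep k Q} {f : A ⟶ B} {g : B ⟶ C} (w : f ≫ g = 0)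
    (hS : (ShortComplex.mk f g w).ShortExact) (hC : Function.Injective (sourceDiag C i)) :
    ∃ w, (ShortComplex.mk ((reflectSource k hi).map f)
      ((reflectSource k hi).map g) w).ShortExact := by
  have w' : (reflectSource k hi).map f ≫ (reflectSource k hi).map g = 0 := by
    rw [← Functor.map_comp, w, Functor.map_zero]
  refine ⟨w', (shortExact_iff_linAt (Q := Reflected i) _).2 fun (j : Q) => ?_⟩
  rw [shortExact_iff_linAt] at hS
  have hinj : ∀ j, Function.Injective (linAt f j) := fun j => (hS j).1
  have hex : ∀ j, Function.Exact (linAt f j) (linAt g j) := fun j => (hS j).2.1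
  have hsurj : ∀ j, Function.Surjective (linAt g j) := fun j => (hS j).2.2
  have hw : ∀ x, linAt (Q := Reflected i) ((reflectSource k hi).map g) j
      (linAt (Q := Reflected i) ((reflectSource k hi).map f) j x) = 0 := fun x =>
    LinearMap.congr_fun (congrArg (fun t => linAt (Q := Reflected i) t j) w') x
  by_cases hj : j = i
  · subst hj
    refine ⟨(injective_iff_map_eq_zero _).2 fun x hx => ?_, fun y => ⟨fun hy => ?_, ?_⟩,
      fun z => ?_⟩
    · obtain ⟨a, rfl⟩ := sourceProj_surjective hi A x
      obtain ⟨b, hb⟩ := (sourceProj_exact hi B _).1 ((linAt_sourceProj hi f a).symm.trans hx)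
      -- The image of b in C is killed by `sourceDiag C j`, so it is zero and b comes from A.
      obtain ⟨a', rfl⟩ := (hex j b).1 (hC (by
        rw [sourceDiag_linAt, hb, map_zero]
        exact funext fun e => (hex e.1).apply_apply_eq_zero _))
      rw [sourceDiag_linAt] at hb
      exact (sourceProj_exact hi A a).2 ⟨a', funext fun e => hinj e.1 (congrFun hb e)⟩
    · obtain ⟨y, rfl⟩ := sourceProj_surjective hi B y
      obtain ⟨c, hc⟩ := (sourceProj_exact hi C _).1 ((linAt_sourceProj hi g y).symm.trans hy)
      obtain ⟨b, rfl⟩ := hsurj j c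
      rw [sourceDiag_linAt] at hc
      choose a ha using fun e : (Σ b : Q, (j ⟶ b)) => (hex e.1 (y e - sourceDiag B j b e)).1 (by
        rw [map_sub, sub_eq_zero]
        exact (congrFun hc e).symm)
      refine ⟨sourceProj hi A a, (linAt_sourceProj hi f a).trans ?_⟩
      have h1 : (fun e => linAt f e.1 (a e)) = y - sourceDiag B j b := funext ha
      rw [h1, map_sub, (sourceProj_exact hi B).apply_apply_eq_zero, sub_zero]
    · rintro ⟨x, rfl⟩
      exact hw x
    · obtain ⟨c, rfl⟩ := sourceProj_surjective hi C z
      choose b hb using fun e : (Σ b : Q, (j ⟶ b)) => hsurj e.1 (c e)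
      refine ⟨sourceProj hi B b, (linAt_sourceProj hi g b).trans ?_⟩
      exact congrArg _ (funext hb)
  · refine ⟨fun x y hxy => ?_, fun y => ⟨fun hy => ?_, ?_⟩, fun z => ?_⟩
    · apply (sourceEquiv hi A hj).injective
      apply hinj j
      rw [← sourceEquiv_linAt, ← sourceEquiv_linAt]
      exact congrArg _ hxy
    · obtain ⟨x, hx⟩ := (hex j (sourceEquiv hi B hj y)).1 (by
        rw [← sourceEquiv_linAt]
        exact (congrArg _ hy).trans (map_zero _))
      obtain ⟨t, rfl⟩ := (sourceEquiv hi A hj).surjective x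
      refine ⟨t, (sourceEquiv hi B hj).injective ?_⟩
      exact (sourceEquiv_linAt hi f hj t).trans hx
    · rintro ⟨x, rfl⟩
      exact hw x
    · obtain ⟨y, hy⟩ := hsurj j (sourceEquiv hi C hj z)
      obtain ⟨t, rfl⟩ := (sourceEquiv hi B hj).surjective y
      refine ⟨t, (sourceEquiv hi C hj).injective ?_⟩
      exact (sourceEquiv_linAt hi g hj t).trans hy

theorem IsSchofieldSequence.reflectSource (hi : IsSource i) {X Z Y : QuiverRep k Q} {m n : ℕ}
    {f : (⨁ fun _ : Fin m => X) ⟶ Z} {g : Z ⟶ ⨁ fun _ : Fin n => Y}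
    (h : IsSchofieldSequence m n X Z Y f g) (hY : ¬ Nonempty (Y ≅ simpleRep k i)) :
    IsSchofieldSequence m n ((reflectSource k hi).obj X) ((reflectSource k hi).obj Z)
      ((reflectSource k hi).obj Y) (mapFrom (reflectSource k hi) f)
      (mapTo (reflectSource k hi) g) := by
  have hYs : Function.Injective (sourceDiag Y i) := (injective_sourceDiag_or_iso_simpleRep
    h.pair.exceptional_left.indecomposable hi).resolve_right hY
  obtain ⟨w, hS⟩ := h.exact
  refine h.map (QuiverRep.reflectSource k hi) (fun M => Function.Injective (sourceDiag M i))
    ?_ ?_ hYs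
    (fun M hM => hM.reflectSource hi) (fun M N _ hN _ _ => reflectSource_map_bijective hi hN)
    (fun M N _ _ hMN => subsingleton_ext_reflectSource hi hMN)
    (shortExact_reflectSource hi w hS (injective_sourceDiag_biproduct n hYs))
  -- If X were S(i), no arrow would end in its support, so Ext¹(Y, X) would vanish.
  · refine (injective_sourceDiag_or_iso_simpleRep
      h.pair.exceptional_right.indecomposable hi).resolve_right fun hX => h.not_subsingleton_ext ?_
    rw [subsingleton_ext_iff]
    refine fun c => ⟨fun _ => 0, fun a b e x => ?_⟩
    have hb : b ≠ i := by
      rintro rfl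
      exact (hi a).false e
    have := subsingleton_space_of_iso_simpleRep hX hb
    exact Subsingleton.elim _ _
  -- If Z were S(i), its quotient Y would live at i only, and `sourceDiag Y i` would embed Y_i into
  -- zero.
  · refine (injective_sourceDiag_or_iso_simpleRep h.exceptional.indecomposable hi).resolve_right
      fun hZ => h.pair.exceptional_left.indecomposable.1 ?_
    obtain ⟨p, hp⟩ := h.exists_epi
    have hne : ∀ j, j ≠ i → Subsingleton (space Y j) := fun j hj =>
      have := subsingleton_space_of_iso_simpleRep hZ hj
      ((epi_iff_surjective p).1 hp j).subsingleton
    refine (isZero_iff_subsingleton Y).2 fun j => ?_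
    by_cases hj : j = i
    · subst hj
      have := fun e : (Σ b : Q, (j ⟶ b)) => hne e.1 (hi.ne e.2)
      exact hYs.subsingleton
    · exact hne j hj

end SourceFunctor

/-! ### Finite dimensional projective covers and injective hulls -/

section FinDim

variable {k : Type u} [Field k] {Q : Type u} [Quiver.{u} Q]

/-- Acyclicity makes reachability by a nontrivial path a well-founded order on the finite vertex
set. A nontrivial path is a last arrow after a path to a smaller vertex. -/
theorem finite_path [Finite Q] [∀ a b : Q, Finite (a ⟶ b)] (hQ : IsAcyclic Q) (a b : Q) :
    Finite (Quiver.Path a b) := by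
  let r : Q → Q → Prop := fun a b => ∃ p : Quiver.Path a b, 0 < p.length
  have : IsTrans Q r := ⟨fun a b c ⟨p, hp⟩ ⟨q, hq⟩ => ⟨p.comp q, by
    rw [Quiver.Path.length_comp]
    lia⟩⟩
  have : Std.Irrefl r := ⟨fun a ⟨p, hp⟩ => hp.ne' (hQ a p)⟩
  have wf : WellFounded r := Finite.wellFounded_of_trans_of_irrefl r
  induction b using wf.induction with
  | _ b ih =>
    have : ∀ x : (Σ c : Q, (c ⟶ b)), Finite (Quiver.Path a x.1) := fun x =>
      ih x.1 ⟨x.2.toPath, by simp [Quiver.Hom.toPath]⟩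
    let F : Quiver.Path a b → Option (Σ x : (Σ c : Q, (c ⟶ b)), Quiver.Path a x.1) := fun p =>
      match p with
      | .nil => none
      | .cons p e => some ⟨⟨_, e⟩, p⟩
    refine Finite.of_injective F fun p q h => ?_
    cases p with
    | nil =>
      cases q with
      | nil => rfl
      | cons q e => simp [F] at h
    | cons p e =>
      cases q with
      | nil => simp [F] at h
      | cons q e' =>
        simp only [F, Option.some.injEq, Sigma.mk.injEq] at h
        obtain ⟨h1, h2⟩ := h
        obtain ⟨rfl, h1⟩ := h1
        cases h1
        cases h2
        rfl

theorem isFinDim_proj [Finite Q] [∀ a b : Q, Finite (a ⟶ b)] (hQ : IsAcyclic Q) (j : Paths Q) :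
    IsFinDim ((proj k Q).obj (Opposite.op j)) := fun l => by
  let l' : Paths Q := l
  have : Finite (j ⟶ l') := finite_path hQ j l
  change Module.Finite k ((j ⟶ l') →₀ k)
  infer_instance

theorem isFinDim_inj [Finite Q] [∀ a b : Q, Finite (a ⟶ b)] (hQ : IsAcyclic Q) (j : Paths Q) :
    IsFinDim ((inj k Q).obj (Opposite.op j)) := fun l => by
  let l' : Paths Q := l
  have : Finite (l' ⟶ j) := finite_path hQ l j
  change Module.Finite k (Module.Dual k ((l' ⟶ j) →₀ k))
  infer_instance

theorem linAt_sum {M N : QuiverRep k Q} {ι : Type*} (s : Finset ι) (φ : ι → (M ⟶ N)) (j : Q) :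
    linAt (∑ t ∈ s, φ t) j = ∑ t ∈ s, linAt (φ t) j :=
  map_sum ({ toFun := fun φ => linAt φ j, map_zero' := rfl, map_add' := fun _ _ => rfl } :
    (M ⟶ N) →+ (space M j →ₗ[k] space N j)) _ _

theorem isFinDim_biproduct {ι : Type*} [Finite ι] (V : ι → QuiverRep k Q)
    (hV : ∀ t, IsFinDim (V t)) : IsFinDim (⨁ V) := fun j => by
  let := Fintype.ofFinite ι
  have := fun t => hV t j
  refine Module.Finite.of_injective
    (LinearMap.pi fun t => linAt (biproduct.π V t) j : _ →ₗ[k] ∀ t, space (V t) j)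
    ((injective_iff_map_eq_zero _).2 fun x hx => ?_)
  have h1 : ∑ t, biproduct.π V t ≫ biproduct.ι V t = 𝟙 (⨁ V) :=
    IsBilimit.total (biproduct.isBilimit V)
  have h2 := LinearMap.congr_fun (congrArg (fun φ => linAt φ j) h1) x
  rw [linAt_sum, LinearMap.sum_apply] at h2
  refine h2.symm.trans (Finset.sum_eq_zero fun t _ => ?_)
  rw [linAt_comp, LinearMap.comp_apply, show linAt (biproduct.π V t) j x = 0 from congrFun hx t,
    map_zero]

theorem finite_hom [Finite Q] {M N : QuiverRep k Q} (hM : IsFinDim M) (hN : IsFinDim N) :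
    Module.Finite k (M ⟶ N) := by
  have : ∀ j : Q, Module.Finite k (space M j) := hM
  have : ∀ j : Q, Module.Finite k (space N j) := hN
  refine Module.Finite.of_injective ({
    toFun := fun φ j => linAt φ j
    map_add' := fun _ _ => rfl
    map_smul' := fun _ _ => rfl } : (M ⟶ N) →ₗ[k] ∀ j : Q, space M j →ₗ[k] space N j) ?_
  exact fun φ ψ h => linAt_ext fun j => congrFun h j

/-- A finite dimensional representation is a quotient of a finite sum of the `P(j)`. -/
theorem exists_proj_cover [Finite Q] {M : QuiverRep k Q} (hM : IsFinDim M) :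
    ∃ (ι : Type u) (_ : Fintype ι) (j : ι → Paths Q)
      (p : (⨁ fun t => (proj k Q).obj (Opposite.op (j t))) ⟶ M), Epi p := by
  have : ∀ j : Q, Module.Finite k (space M j) := hM
  let ι := Σ j : Q, Fin (Module.finrank k (space M j))
  let V : ι → QuiverRep k Q := fun t => (proj k Q).obj (Opposite.op (t.1 : Paths Q))
  let p : ⨁ V ⟶ M := biproduct.desc fun t =>
    projDesc M (t.1 : Paths Q) (Module.finBasis k (space M t.1) t.2)
  refine ⟨ι, Fintype.ofFinite ι, fun t => t.1, p, (epi_iff_surjective p).2 fun j => ?_⟩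
  rw [← LinearMap.range_eq_top, ← top_le_iff, ← (Module.finBasis k (space M j)).span_eq,
    Submodule.span_le]
  rintro _ ⟨t, rfl⟩
  let j' : Paths Q := j
  refine ⟨linAt (biproduct.ι V ⟨j, t⟩) j (Finsupp.single (𝟙 j') (1 : k)), ?_⟩
  have h : biproduct.ι V ⟨j, t⟩ ≫ p = projDesc M (j : Paths Q) (Module.finBasis k (space M j) t) :=
    biproduct.ι_desc _ _
  exact (LinearMap.congr_fun (congrArg (fun φ => linAt φ j) h) _).trans (projDesc_apply M j _)

theorem finite_ext [Finite Q] [∀ a b : Q, Finite (a ⟶ b)] (hQ : IsAcyclic Q) {M N : QuiverRep k Q}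
    (hM : IsFinDim M) (hN : IsFinDim N) : Module.Finite k (Ext M N 1) := by
  obtain ⟨ι, _, j, p, hp⟩ := exists_proj_cover hM
  have hS := shortExact_kernel p
  have := finite_hom ((isFinDim_biproduct _ fun t => isFinDim_proj hQ (j t)).of_mono (kernel.ι p))
    hN
  refine Module.Finite.of_surjective ((Ext.precompOfLinear hS.extClass k N (add_zero 1)) ∘ₗ
    (Ext.linearEquiv₀ (R := k)).symm.toLinearMap : (kernel p ⟶ N) →ₗ[k] Ext M N 1) fun x => ?_
  obtain ⟨y, rfl⟩ := Ext.contravariant_sequence_exact₃ hS N x (Ext.eq_zero_of_projective _)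
    (add_zero 1)
  obtain ⟨y, rfl⟩ := (Ext.mk₀_bijective _ _).2 y
  exact ⟨y, rfl⟩

/-- The functional of a morphism to `I(j)`. -/
def injFun {M : QuiverRep k Q} {j : Paths Q} (φ : M ⟶ (inj k Q).obj (Opposite.op j)) :
    Module.Dual k (M.obj j) :=
  LinearMap.applyₗ (Finsupp.single (𝟙 j) (1 : k)) ∘ₗ
    (show M.obj j →ₗ[k] Module.Dual k ((j ⟶ j) →₀ k) from (φ.app j).hom)

/-- Naturality along q moves the value at q to the value at the trivial path; so a morphism to I(j)
amounts to a functional on M_j. -/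
theorem app_inj_apply {M : QuiverRep k Q} {j : Paths Q}
    (φ : M ⟶ (inj k Q).obj (Opposite.op j)) {l : Paths Q} (q : l ⟶ j) (x : M.obj l) :
    (show Module.Dual k ((l ⟶ j) →₀ k) from (φ.app l).hom x) (Finsupp.single q 1) =
      injFun φ ((M.map q).hom x) := by
  have h := LinearMap.congr_fun (congrArg ModuleCat.Hom.hom (φ.naturality q)) x
  have h2 := LinearMap.congr_fun (f := (show Module.Dual k ((j ⟶ j) →₀ k) from
    (φ.app j).hom ((M.map q).hom x))) h (Finsupp.single (𝟙 j) (1 : k))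
  refine Eq.trans ?_ h2.symm
  change _ = (show Module.Dual k ((l ⟶ j) →₀ k) from (φ.app l).hom x)
    (Finsupp.mapDomain (fun r => q ≫ r) (Finsupp.single (𝟙 j) 1))
  rw [Finsupp.mapDomain_single, Category.comp_id]

theorem inj_hom_ext {M : QuiverRep k Q} {j : Paths Q}
    {φ ψ : M ⟶ (inj k Q).obj (Opposite.op j)} (h : injFun φ = injFun ψ) : φ = ψ := by
  apply NatTrans.ext
  funext l
  apply ModuleCat.hom_ext
  apply LinearMap.ext
  intro x
  refine Finsupp.lhom_ext' fun q => LinearMap.ext_ring ?_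
  exact (app_inj_apply φ q x).trans ((LinearMap.congr_fun h _).trans (app_inj_apply ψ q x).symm)

/-- The morphism to `I(j)` with a given functional. -/
def injLift (M : QuiverRep k Q) (j : Paths Q) (m : Module.Dual k (M.obj j)) :
    M ⟶ (inj k Q).obj (Opposite.op j) where
  app l := ModuleCat.ofHom ((Finsupp.llift k k k (l ⟶ j)).toLinearMap ∘ₗ
    LinearMap.pi fun q => m ∘ₗ (M.map q).hom)
  naturality l l' p := by
    apply ModuleCat.hom_ext
    apply LinearMap.ext
    intro x
    refine Finsupp.lhom_ext' fun q => LinearMap.ext_ring ?_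
    change Finsupp.llift k k k (l' ⟶ j) (fun q => m ((M.map q).hom ((M.map p).hom x)))
      (Finsupp.single q 1) = Finsupp.llift k k k (l ⟶ j) (fun q => m ((M.map q).hom x))
        (Finsupp.mapDomain (fun q => p ≫ q) (Finsupp.single q 1))
    rw [Finsupp.mapDomain_single]
    simp

theorem injFun_injLift (M : QuiverRep k Q) (j : Paths Q) (m : Module.Dual k (M.obj j)) :
    injFun (injLift M j m) = m := by
  ext x
  change Finsupp.llift k k k (j ⟶ j) (fun q => m ((M.map q).hom x)) (Finsupp.single (𝟙 j) 1) = m x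
  simp

/-- Morphisms to I(j) are functionals on the space at j, and functionals extend along injective
linear maps. -/
instance (j : Paths Q) : Injective ((inj k Q).obj (Opposite.op j)) where
  factors {A B} φ i hi := by
    obtain ⟨r, hr⟩ := LinearMap.exists_leftInverse_of_injective (linAt i j)
      (LinearMap.ker_eq_bot.2 ((mono_iff_injective i).1 hi j))
    refine ⟨injLift B j (injFun φ ∘ₗ r), inj_hom_ext ?_⟩
    have h : injFun (i ≫ injLift B j (injFun φ ∘ₗ r)) =
        injFun (injLift B j (injFun φ ∘ₗ r)) ∘ₗ linAt i j := rfl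
    rw [h, injFun_injLift]
    exact LinearMap.ext fun x => congrArg (injFun φ) (LinearMap.congr_fun hr x)

/-- A finite dimensional representation embeds into a finite sum of the `I(j)`. -/
theorem exists_inj_hull [Finite Q] {M : QuiverRep k Q} (hM : IsFinDim M) :
    ∃ (ι : Type u) (_ : Fintype ι) (j : ι → Paths Q)
      (s : M ⟶ ⨁ fun t => (inj k Q).obj (Opposite.op (j t))), Mono s := by
  have : ∀ j : Q, Module.Finite k (space M j) := hM
  let ι := Σ j : Q, Fin (Module.finrank k (space M j))
  let V : ι → QuiverRep k Q := fun t => (inj k Q).obj (Opposite.op (t.1 : Paths Q))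
  let s : M ⟶ ⨁ V := biproduct.lift fun t =>
    injLift M (t.1 : Paths Q) ((Module.finBasis k (space M t.1)).coord t.2)
  refine ⟨ι, Fintype.ofFinite ι, fun t => t.1, s, (mono_iff_injective s).2 fun j =>
    (injective_iff_map_eq_zero _).2 fun x hx => ?_⟩
  refine (Module.finBasis k (space M j)).forall_coord_eq_zero_iff.1 fun t => ?_
  have h : s ≫ biproduct.π V ⟨j, t⟩ =
      injLift M (j : Paths Q) ((Module.finBasis k (space M j)).coord t) := biproduct.lift_π _ _
  have h1 := LinearMap.congr_fun (injFun_injLift M (j : Paths Q)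
    ((Module.finBasis k (space M j)).coord t)) x
  rw [← h] at h1
  refine h1.symm.trans ?_
  have h2 : injFun (s ≫ biproduct.π V ⟨j, t⟩) x =
    injFun (biproduct.π V ⟨j, t⟩) (linAt s j x) := rfl
  rw [h2, hx]
  exact map_zero (injFun (biproduct.π V ⟨j, t⟩))

end FinDim

/-! ### The Auslander-Reiten formula for `τ` -/

section Tau

variable {k : Type u} [Field k] {Q : Type u} [Quiver.{u} Q]

theorem projDesc_add (M : QuiverRep k Q) (j : Paths Q) (x y : M.obj j) :
    projDesc M j (x + y) = projDesc M j x + projDesc M j y :=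
  proj_hom_ext (by
    rw [projDesc_apply]
    exact (congrArg₂ (· + ·) (projDesc_apply M j x) (projDesc_apply M j y)).symm)

theorem projDesc_smul (M : QuiverRep k Q) (j : Paths Q) (c : k) (x : M.obj j) :
    projDesc M j (c • x) = c • projDesc M j x :=
  proj_hom_ext (by
    rw [projDesc_apply]
    exact (congrArg (c • ·) (projDesc_apply M j x)).symm)

theorem projDesc_single {j l : Paths Q} (q : j ⟶ l) :
    projDesc ((proj k Q).obj (Opposite.op j)) l (Finsupp.single q (1 : k)) =
      (proj k Q).map q.op :=
  proj_hom_ext ((projDesc_apply _ _ _).trans (by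
    change Finsupp.single q (1 : k) =
      Finsupp.mapDomain (fun r => q ≫ r) (Finsupp.single (𝟙 l) (1 : k))
    rw [Finsupp.mapDomain_single, Category.comp_id]))

/-- The functional on `Ext¹(M, P(j))` given by a morphism from `P(j)` to `τ M`. -/
def tauElt {M : QuiverRep k Q} {j : Paths Q}
    (w : (proj k Q).obj (Opposite.op j) ⟶ (tau k Q).obj M) :
    Module.Dual k (Ext M ((proj k Q).obj (Opposite.op j)) 1) :=
  (w.app j).hom (Finsupp.single (𝟙 j) (1 : k))

theorem tauElt_projDesc_comp {M N : QuiverRep k Q} (θ : N ⟶ (tau k Q).obj M) (j : Paths Q)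
    (x : N.obj j) : tauElt (projDesc N j x ≫ θ) =
      (show Module.Dual k (Ext M ((proj k Q).obj (Opposite.op j)) 1) from (θ.app j).hom x) :=
  congrArg (θ.app j).hom (projDesc_apply N j x)

/-- A morphism P(l) ⟶ P(j) is a linear combination of paths, and for a single path the identity is
the definition of the action on τM. This is naturality of the Auslander-Reiten formula on the P(j).
-/
theorem tauElt_comp {M : QuiverRep k Q} {j l : Paths Q}
    (c : (proj k Q).obj (Opposite.op l) ⟶ (proj k Q).obj (Opposite.op j))
    (w : (proj k Q).obj (Opposite.op j) ⟶ (tau k Q).obj M)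
    (ξ : Ext M ((proj k Q).obj (Opposite.op l)) 1) :
    tauElt (c ≫ w) ξ = tauElt w (ξ.comp (Ext.mk₀ c) (add_zero 1)) := by
  have key : ∀ y : (j ⟶ l) →₀ k, tauElt (projDesc ((proj k Q).obj (Opposite.op j)) l y ≫ w) ξ =
      tauElt w (ξ.comp (Ext.mk₀ (projDesc ((proj k Q).obj (Opposite.op j)) l y))
        (add_zero 1)) := by
    intro y
    induction y using Finsupp.induction_linear with
    | zero =>
      have h0 : projDesc ((proj k Q).obj (Opposite.op j)) l (0 : (j ⟶ l) →₀ k) = 0 := by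
        have h := projDesc_smul ((proj k Q).obj (Opposite.op j)) l (0 : k) 0
        rwa [zero_smul, zero_smul] at h
      rw [h0, zero_comp, Ext.mk₀_zero, Ext.comp_zero, map_zero]
      rfl
    | add y z hy hz =>
      have h := projDesc_add ((proj k Q).obj (Opposite.op j)) l y z
      refine (congrArg (fun t => tauElt (t ≫ w) ξ) h).trans (Eq.trans ?_ (congrArg (fun t =>
        tauElt w (ξ.comp (Ext.mk₀ t) (add_zero 1))) h).symm)
      rw [Ext.mk₀_add, Ext.comp_add, map_add, ← hy, ← hz, Preadditive.add_comp]
      rfl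
    | single q a =>
      have h : projDesc ((proj k Q).obj (Opposite.op j)) l (Finsupp.single q a) =
          a • (proj k Q).map q.op :=
        (congrArg (projDesc ((proj k Q).obj (Opposite.op j)) l)
          (Finsupp.smul_single_one q a).symm).trans
            ((projDesc_smul _ l a _).trans (congrArg (a • ·) (projDesc_single q)))
      rw [h, Ext.mk₀_smul, Ext.comp_smul, map_smul, Linear.smul_comp]
      refine congrArg (fun t : k => a * t) ?_
      have h1 : tauElt ((proj k Q).map q.op ≫ w) = (show Module.Dual k _ from
          (w.app l).hom (Finsupp.single q (1 : k))) := by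
        rw [← projDesc_single]
        exact tauElt_projDesc_comp _ _ _
      refine (LinearMap.congr_fun h1 ξ).trans ?_
      have h2 := LinearMap.congr_fun (congrArg ModuleCat.Hom.hom (w.naturality q))
        (Finsupp.single (𝟙 j) (1 : k))
      have h3 : (((proj k Q).obj (Opposite.op j)).map q).hom (Finsupp.single (𝟙 j) (1 : k)) =
          Finsupp.single q (1 : k) := by
        change Finsupp.mapDomain (fun r => r ≫ q) (Finsupp.single (𝟙 j) (1 : k)) = _
        rw [Finsupp.mapDomain_single, Category.id_comp]
      have h4 := (congrArg (w.app l).hom h3).symm.trans h2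
      exact LinearMap.congr_fun h4 ξ
  have hc : c = projDesc ((proj k Q).obj (Opposite.op j)) l
      ((c.app l).hom (Finsupp.single (𝟙 l) (1 : k))) := proj_hom_ext (projDesc_apply _ _ _).symm
  rw [hc]
  exact key _

theorem tau_hom_ext {M N : QuiverRep k Q} {θ θ' : N ⟶ (tau k Q).obj M}
    (h : ∀ (j : Paths Q) (u : (proj k Q).obj (Opposite.op j) ⟶ N),
      tauElt (u ≫ θ) = tauElt (u ≫ θ')) : θ = θ' := by
  apply NatTrans.ext
  funext j
  apply ModuleCat.hom_ext
  apply LinearMap.ext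
  intro x
  exact (tauElt_projDesc_comp θ j x).symm.trans
    ((h j (projDesc N j x)).trans (tauElt_projDesc_comp θ' j x))

/-- A morphism `N ⟶ τ M` and a functional on `Ext¹(M, N)` correspond to each other under the
Auslander-Reiten formula. -/
def IsTauPair {M N : QuiverRep k Q} (θ : N ⟶ (tau k Q).obj M) (α : Module.Dual k (Ext M N 1)) :
    Prop :=
  ∀ (j : Paths Q) (u : (proj k Q).obj (Opposite.op j) ⟶ N)
    (ξ : Ext M ((proj k Q).obj (Opposite.op j)) 1),
      tauElt (u ≫ θ) ξ = α (ξ.comp (Ext.mk₀ u) (add_zero 1))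

theorem isTauPair_tauElt {M : QuiverRep k Q} {j : Paths Q}
    (w : (proj k Q).obj (Opposite.op j) ⟶ (tau k Q).obj M) : IsTauPair w (tauElt w) :=
  fun _ u ξ => tauElt_comp u w ξ

theorem IsTauPair.add {M N : QuiverRep k Q} {θ θ' : N ⟶ (tau k Q).obj M}
    {α α' : Module.Dual k (Ext M N 1)} (h : IsTauPair θ α) (h' : IsTauPair θ' α') :
    IsTauPair (θ + θ') (α + α') := fun j u ξ => by
  rw [LinearMap.add_apply, ← h, ← h', Preadditive.comp_add]
  rfl

theorem IsTauPair.smul {M N : QuiverRep k Q} {θ : N ⟶ (tau k Q).obj M}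
    {α : Module.Dual k (Ext M N 1)} (c : k) (h : IsTauPair θ α) :
    IsTauPair (c • θ) (c • α) := fun j u ξ => by
  rw [LinearMap.smul_apply, ← h, Linear.comp_smul]
  rfl

theorem IsTauPair.precomp {M N N' : QuiverRep k Q} {θ : N ⟶ (tau k Q).obj M}
    {α : Module.Dual k (Ext M N 1)} (h : IsTauPair θ α) (g : N' ⟶ N) :
    IsTauPair (g ≫ θ) (α ∘ₗ Ext.postcompOfLinear (Ext.mk₀ g) k M (add_zero 1)) := fun j u ξ => by
  rw [← Category.assoc, h, ← Ext.mk₀_comp_mk₀]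
  exact congrArg α (Ext.comp_assoc_of_third_deg_zero ξ (Ext.mk₀ u) (Ext.mk₀ g) (add_zero 1)).symm

theorem IsTauPair.unique_left {M N : QuiverRep k Q} {θ θ' : N ⟶ (tau k Q).obj M}
    {α : Module.Dual k (Ext M N 1)} (h : IsTauPair θ α) (h' : IsTauPair θ' α) : θ = θ' :=
  tau_hom_ext fun j u => LinearMap.ext fun ξ => (h j u ξ).trans (h' j u ξ).symm

/-- The morphism sends x in N_j to the functional ξ ↦ α(ξ · u), where u : P(j) ⟶ N is the morphism
attached to x. -/
theorem exists_isTauPair_left {M N : QuiverRep k Q} (α : Module.Dual k (Ext M N 1)) :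
    ∃ θ : N ⟶ (tau k Q).obj M, IsTauPair θ α := by
  let F : ∀ j : Paths Q, N.obj j →ₗ[k]
      Module.Dual k (Ext M ((proj k Q).obj (Opposite.op j)) 1) := fun j =>
    { toFun := fun x => α ∘ₗ Ext.postcompOfLinear (Ext.mk₀ (projDesc N j x)) k M (add_zero 1)
      map_add' := fun x y => LinearMap.ext fun ξ => by
        simp [projDesc_add, Ext.mk₀_add]
      map_smul' := fun c x => LinearMap.ext fun ξ => by
        simp [projDesc_smul, Ext.mk₀_smul] }
  have hF : ∀ (j : Paths Q) x ξ, F j x ξ =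
    α (ξ.comp (Ext.mk₀ (projDesc N j x)) (add_zero 1)) := fun _ _ _ => rfl
  let θ : N ⟶ (tau k Q).obj M :=
    { app := fun j => ModuleCat.ofHom (F j)
      naturality := fun j l p => by
        apply ModuleCat.hom_ext
        apply LinearMap.ext
        intro x
        apply LinearMap.ext
        intro ξ
        change F l ((N.map p).hom x) ξ = F j x (ξ.comp (Ext.mk₀ ((proj k Q).map p.op)) (add_zero 1))
        rw [hF, hF, Ext.comp_assoc_of_third_deg_zero, Ext.mk₀_comp_mk₀]
        congr 3
        refine proj_hom_ext ((projDesc_apply _ _ _).trans ?_)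
        change _ = Finsupp.linearCombination k (fun q : j ⟶ l => (N.map q).hom x)
          (Finsupp.mapDomain (fun r => p ≫ r) (Finsupp.single (𝟙 l) (1 : k)))
        rw [Finsupp.mapDomain_single, Category.comp_id, Finsupp.linearCombination_single, one_smul] }
  refine ⟨θ, fun j u ξ => ?_⟩
  have hu : u = projDesc N j ((u.app j).hom (Finsupp.single (𝟙 j) (1 : k))) :=
    proj_hom_ext (projDesc_apply _ _ _).symm
  conv_rhs => rw [hu]
  exact hF j _ ξ

/-- By right exactness of Ext¹(M, -), the classes pushed forward from the P(j) span Ext¹(M, N). -/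
theorem ext_linearMap_ext [Finite Q] {M N : QuiverRep k Q} (hN : IsFinDim N) {V : Type*}
    [AddCommGroup V] [Module k V] {A B : Ext M N 1 →ₗ[k] V}
    (h : ∀ (j : Paths Q) (u : (proj k Q).obj (Opposite.op j) ⟶ N)
      (ξ : Ext M ((proj k Q).obj (Opposite.op j)) 1), A (ξ.comp (Ext.mk₀ u) (add_zero 1)) =
        B (ξ.comp (Ext.mk₀ u) (add_zero 1))) : A = B := by
  obtain ⟨ι, _, j, p, hp⟩ := exists_proj_cover hN
  refine LinearMap.ext fun x => ?_
  obtain ⟨y, rfl⟩ := exists_ext_lift_of_epi M p x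
  have ht := IsBilimit.total (biproduct.isBilimit
    fun t => (proj k Q).obj (Opposite.op (j t)))
  have hy : y.comp (Ext.mk₀ p) (add_zero 1) = ∑ t, (y.comp (Ext.mk₀ (biproduct.π
      (fun t => (proj k Q).obj (Opposite.op (j t))) t)) (add_zero 1)).comp
        (Ext.mk₀ (biproduct.ι (fun t => (proj k Q).obj (Opposite.op (j t))) t ≫ p))
          (add_zero 1) := by
    conv_lhs => rw [← Category.id_comp p]
    have h1 : 𝟙 _ ≫ p = ∑ t, biproduct.π (fun t => (proj k Q).obj (Opposite.op (j t))) t ≫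
        biproduct.ι (fun t => (proj k Q).obj (Opposite.op (j t))) t ≫ p := by
      refine (congrArg (fun t => t ≫ p) ht).symm.trans ?_
      rw [Preadditive.sum_comp]
      exact Finset.sum_congr rfl fun _ _ => Category.assoc _ _ _
    rw [h1, Ext.mk₀_sum, Ext.comp_sum]
    refine Finset.sum_congr rfl fun t _ => ?_
    rw [Ext.comp_assoc_of_third_deg_zero, Ext.mk₀_comp_mk₀]
  rw [hy, map_sum, map_sum]
  exact Finset.sum_congr rfl fun t _ => h _ _ _

theorem IsTauPair.unique_right [Finite Q] {M N : QuiverRep k Q} (hN : IsFinDim N)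
    {θ : N ⟶ (tau k Q).obj M} {α α' : Module.Dual k (Ext M N 1)} (h : IsTauPair θ α)
    (h' : IsTauPair θ α') : α = α' :=
  ext_linearMap_ext hN fun j u ξ => (h j u ξ).symm.trans (h' j u ξ)

theorem tauElt_sum {M : QuiverRep k Q} {j : Paths Q} {ι : Type*} (s : Finset ι)
    (w : ι → ((proj k Q).obj (Opposite.op j) ⟶ (tau k Q).obj M)) :
    tauElt (∑ t ∈ s, w t) = ∑ t ∈ s, tauElt (w t) :=
  map_sum ({ toFun := tauElt, map_zero' := rfl, map_add' := fun _ _ => rfl } :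
    ((proj k Q).obj (Opposite.op j) ⟶ (tau k Q).obj M) →+ Module.Dual k _) _ _

variable [Finite Q] [∀ a b : Q, Finite (a ⟶ b)]

theorem exists_isTauPair_right (hQ : IsAcyclic Q) {M N : QuiverRep k Q} (hN : IsFinDim N)
    (θ : N ⟶ (tau k Q).obj M) : ∃ α : Module.Dual k (Ext M N 1), IsTauPair θ α := by
  obtain ⟨ι, _, j, p, hp⟩ := exists_proj_cover hN
  let V : ι → QuiverRep k Q := fun t => (proj k Q).obj (Opposite.op (j t))
  have hS := shortExact_kernel p
  have hK : IsFinDim (kernel p) :=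
    (isFinDim_biproduct _ fun t => isFinDim_proj hQ (j t)).of_mono (kernel.ι p)
  -- On a sum of P(j)'s the functional is forced: on each summand it is the `tauElt` of the
  -- restricted morphism.
  let α₀ : Module.Dual k (Ext M (⨁ V) 1) := ∑ t, tauElt (j := j t) (biproduct.ι V t ≫ p ≫ θ) ∘ₗ
    Ext.postcompOfLinear (Ext.mk₀ (biproduct.π V t)) k M (add_zero 1)
  have h₀ : ∀ (l : Paths Q) (h : (proj k Q).obj (Opposite.op l) ⟶ ⨁ V) ξ,
      α₀ (ξ.comp (Ext.mk₀ h) (add_zero 1)) = tauElt (h ≫ p ≫ θ) ξ := by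
    intro l h ξ
    have h1 : h ≫ p ≫ θ = ∑ t, (h ≫ biproduct.π V t) ≫ (biproduct.ι V t ≫ p ≫ θ) := by
      have ht : ∑ t, biproduct.π V t ≫ biproduct.ι V t = 𝟙 (⨁ V) :=
        IsBilimit.total (biproduct.isBilimit V)
      conv_lhs => rw [← Category.id_comp (p ≫ θ), ← ht]
      simp only [Preadditive.sum_comp, Preadditive.comp_sum, Category.assoc]
    rw [h1, tauElt_sum, LinearMap.sum_apply, LinearMap.sum_apply]
    refine Finset.sum_congr rfl fun t _ => ?_
    have h2 : (ξ.comp (Ext.mk₀ h) (add_zero 1)).comp (Ext.mk₀ (biproduct.π V t)) (add_zero 1) =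
        ξ.comp (Ext.mk₀ (h ≫ biproduct.π V t)) (add_zero 1) := by
      rw [Ext.comp_assoc_of_third_deg_zero, Ext.mk₀_comp_mk₀]
    refine Eq.trans ?_ (tauElt_comp (j := j t) (h ≫ biproduct.π V t)
      (biproduct.ι V t ≫ p ≫ θ) ξ).symm
    exact congrArg (tauElt (j := j t) (biproduct.ι V t ≫ p ≫ θ)) h2
  -- Ext¹(M, N) is the cokernel of Ext¹(M, ker p) ⟶ Ext¹(M, ⨁ V). The functional α₀ kills the image
  -- because composing the kernel inclusion with p gives zero.
  obtain ⟨α, hα⟩ := exists_linearMap_desc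
    (f := Ext.postcompOfLinear (Ext.mk₀ (kernel.ι p)) k M (add_zero 1))
    (g := Ext.postcompOfLinear (Ext.mk₀ p) k M (add_zero 1)) (exists_ext_lift_of_epi M p)
    (fun x => ⟨fun hx => Ext.covariant_sequence_exact₂ M hS x hx, by
      rintro ⟨y, rfl⟩
      refine (Ext.comp_assoc_of_third_deg_zero y (Ext.mk₀ (kernel.ι p)) (Ext.mk₀ p)
        (add_zero 1)).trans ?_
      rw [Ext.mk₀_comp_mk₀, kernel.condition, Ext.mk₀_zero, Ext.comp_zero]⟩) α₀
    (LinearMap.congr_fun (ext_linearMap_ext (A := α₀ ∘ₗ Ext.postcompOfLinear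
      (Ext.mk₀ (kernel.ι p)) k M (add_zero 1)) (B := 0) hK fun l u ξ => by
        refine (congrArg α₀ ((Ext.comp_assoc_of_third_deg_zero ξ (Ext.mk₀ u)
          (Ext.mk₀ (kernel.ι p)) (add_zero 1)).trans (by rw [Ext.mk₀_comp_mk₀]))).trans
          ((h₀ l _ ξ).trans ?_)
        rw [Category.assoc, kernel.condition_assoc, zero_comp, comp_zero]
        rfl))
  refine ⟨α, fun l u ξ => ?_⟩
  have hu := Projective.factorThru_comp u p
  rw [← hu, Category.assoc, ← h₀, ← hα, ← Ext.mk₀_comp_mk₀]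
  exact congrArg α (Ext.comp_assoc_of_third_deg_zero _ _ _ _)

end Tau

/-! ### Full faithfulness, Ext¹ and exactness for τ, and Schofield sequences -/

section TauFunctor

variable {k : Type u} [Field k] {Q : Type u} [Quiver.{u} Q]

instance : (tau k Q).Additive where
  map_add {M N φ ψ} := by
    apply NatTrans.ext
    funext j
    apply ModuleCat.hom_ext
    apply LinearMap.ext
    intro (x : Module.Dual k _)
    apply LinearMap.ext
    intro ξ
    change x ((Ext.mk₀ (φ + ψ)).comp ξ (zero_add 1)) =
      x ((Ext.mk₀ φ).comp ξ (zero_add 1)) + x ((Ext.mk₀ ψ).comp ξ (zero_add 1))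
    rw [Ext.mk₀_add, Ext.add_comp, map_add]

theorem tauElt_comp_map {M N : QuiverRep k Q} (φ : M ⟶ N) {j : Paths Q}
    (w : (proj k Q).obj (Opposite.op j) ⟶ (tau k Q).obj M)
    (ξ : Ext N ((proj k Q).obj (Opposite.op j)) 1) :
    tauElt (w ≫ (tau k Q).map φ) ξ = tauElt w ((Ext.mk₀ φ).comp ξ (zero_add 1)) := rfl

/-- The image of such a map is a subobject of a projective, hence projective, hence a direct summand
of M; so it is zero. -/
theorem hom_proj_eq_zero {M : QuiverRep k Q} (hM : Indecomposable M) (h : ¬ Projective M)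
    (j : Paths Q) : Subsingleton (M ⟶ (proj k Q).obj (Opposite.op j)) := by
  refine subsingleton_of_forall_eq 0 fun φ => ?_
  have : Projective (image φ) := projective_of_mono (image.ι φ)
  rcases isZero_or_isIso_of_retract hM (Projective.factorThru (𝟙 _) (Limits.factorThruImage φ))
    (Limits.factorThruImage φ) (Projective.factorThru_comp _ _) with h0 | hi
  · rw [← Limits.image.fac φ, h0.eq_of_src (image.ι φ) 0, comp_zero]
  · exact absurd (Projective.of_iso (asIso (Projective.factorThru (𝟙 _) (Limits.factorThruImage φ)))
      inferInstance) h

theorem hom_biproduct_proj_eq_zero {M : QuiverRep k Q}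
    (hM : ∀ j : Paths Q, Subsingleton (M ⟶ (proj k Q).obj (Opposite.op j))) {ι : Type u}
    [Finite ι] (j : ι → Paths Q) (φ : M ⟶ ⨁ fun t => (proj k Q).obj (Opposite.op (j t))) :
    φ = 0 :=
  biproduct.hom_ext _ _ fun t => (hM (j t)).elim _ _

variable [Finite Q] [∀ a b : Q, Finite (a ⟶ b)]

theorem IsFinDim.tau (hQ : IsAcyclic Q) {M : QuiverRep k Q} (hM : IsFinDim M) :
    IsFinDim ((tau k Q).obj M) := fun j => by
  have := finite_ext hQ hM (isFinDim_proj (k := k) hQ j)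
  change Module.Finite k (Module.Dual k (Ext M ((proj k Q).obj (Opposite.op (show Paths Q from j)))
    1))
  infer_instance

theorem subsingleton_hom_tau (hQ : IsAcyclic Q) {M N : QuiverRep k Q} (hN : IsFinDim N)
    (h : Subsingleton (Ext M N 1)) : Subsingleton (N ⟶ (tau k Q).obj M) := by
  refine ⟨fun θ θ' => ?_⟩
  obtain ⟨α, hα⟩ := exists_isTauPair_right hQ hN θ
  obtain ⟨α', hα'⟩ := exists_isTauPair_right hQ hN θ'
  obtain rfl : α = α' := LinearMap.ext fun x => by rw [h.elim x 0, map_zero, map_zero]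
  exact hα.unique_left hα'

/-- Take a projective presentation p of L. A morphism ker p ⟶ τN is a functional on Ext¹(N, ker p).
As Hom(N, L) = 0, this space embeds in Ext¹ from N to the projective, so the functional, and with it
the morphism, extends. -/
theorem subsingleton_ext_tau (hQ : IsAcyclic Q) {N L : QuiverRep k Q} (hL : IsFinDim L)
    (h : Subsingleton (N ⟶ L)) : Subsingleton (Ext L ((tau k Q).obj N) 1) := by
  obtain ⟨ι, _, j, p, hp⟩ := exists_proj_cover hL
  have hS := shortExact_kernel p
  have hK : IsFinDim (kernel p) :=
    (isFinDim_biproduct _ fun t => isFinDim_proj hQ (j t)).of_mono (kernel.ι p)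
  refine subsingleton_ext_of_extension hS fun θ => ?_
  obtain ⟨α, hα⟩ := exists_isTauPair_right hQ hK θ
  obtain ⟨r, hr⟩ := LinearMap.exists_leftInverse_of_injective
    (Ext.postcompOfLinear (Ext.mk₀ (kernel.ι p)) k N (add_zero 1)) (LinearMap.ker_eq_bot'.2
      fun x hx => by
        obtain ⟨y, rfl⟩ := Ext.covariant_sequence_exact₁ N hS x hx (zero_add 1)
        obtain ⟨y, rfl⟩ := (Ext.mk₀_bijective _ _).2 y
        rw [h.elim y 0, Ext.mk₀_zero, Ext.zero_comp])
  obtain ⟨ψ, hψ⟩ := exists_isTauPair_left (α ∘ₗ r)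
  refine ⟨ψ, (hψ.precomp (kernel.ι p)).unique_left (?_ : IsTauPair θ _)⟩
  rw [LinearMap.comp_assoc, hr]
  exact hα

/-- If τφ = 0, then φ induces zero on Ext¹ into each P(j), hence on Ext¹ into the kernel of a
presentation of N. It therefore kills the extension class, lifts to the projective, and vanishes. -/
theorem tau_map_injective {M N : QuiverRep k Q} (hQ : IsAcyclic Q) (hN : IsFinDim N)
    (hM : ∀ j : Paths Q, Subsingleton (M ⟶ (proj k Q).obj (Opposite.op j))) :
    Function.Injective ((tau k Q).map : (M ⟶ N) → _) := by
  refine (injective_iff_map_eq_zero (tau k Q).mapAddHom).2 fun φ hφ => ?_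
  obtain ⟨ι, _, j, p, hp⟩ := exists_proj_cover hN
  have hS := shortExact_kernel p
  have hK : IsFinDim (kernel p) :=
    (isFinDim_biproduct _ fun t => isFinDim_proj hQ (j t)).of_mono (kernel.ι p)
  have h₀ : ∀ (l : Paths Q) (ξ : Ext N ((proj k Q).obj (Opposite.op l)) 1),
      (Ext.mk₀ φ).comp ξ (zero_add 1) = 0 := by
    refine fun l ξ => (Module.forall_dual_apply_eq_zero_iff k _).1 fun x => ?_
    have h1 := congrArg (fun t => NatTrans.app t l) hφ
    exact LinearMap.congr_fun (LinearMap.congr_fun (congrArg ModuleCat.Hom.hom h1) x) ξ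
  have h₁ : Ext.precompOfLinear (Ext.mk₀ φ) k (kernel p) (zero_add 1) = 0 :=
    ext_linearMap_ext hK fun l u ξ => by
      refine (Ext.comp_assoc_of_third_deg_zero (Ext.mk₀ φ) ξ (Ext.mk₀ u) (zero_add 1)).symm.trans ?_
      rw [h₀, Ext.zero_comp]
      rfl
  obtain ⟨y, hy⟩ := Ext.covariant_sequence_exact₃ M hS (Ext.mk₀ φ) (zero_add 1)
    (LinearMap.congr_fun h₁ hS.extClass)
  obtain ⟨y, rfl⟩ := (Ext.mk₀_bijective _ _).2 y
  rw [hom_biproduct_proj_eq_zero hM j y, Ext.mk₀_zero, Ext.zero_comp] at hy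
  exact (Ext.mk₀_eq_zero_iff φ).1 hy.symm

/-- Through the formula, θ turns functionals on Ext¹(M, K) into functionals on Ext¹(N, K), where K =
ker p. Evaluating the latter at the extension class of p gives, by biduality, a class ξ in Ext¹(M,
K), and ξ is the pullback of the extension class along the desired φ : M ⟶ N. -/
theorem tau_map_surjective {M N : QuiverRep k Q} (hQ : IsAcyclic Q) (hMf : IsFinDim M)
    (hN : IsFinDim N) : Function.Surjective
      ((tau k Q).map : (M ⟶ N) → ((tau k Q).obj M ⟶ (tau k Q).obj N)) := by
  intro θ
  obtain ⟨ι, _, j, p, hp⟩ := exists_proj_cover hN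
  have hS := shortExact_kernel p
  have hP := isFinDim_biproduct (k := k) _ fun t => isFinDim_proj hQ (j t)
  have hK : IsFinDim (kernel p) := hP.of_mono (kernel.ι p)
  have := finite_ext hQ hMf hK
  choose T hT using fun α : Module.Dual k (Ext M (kernel p) 1) => exists_isTauPair_left α
  choose A hA using fun α => exists_isTauPair_right hQ hK (T α ≫ θ)
  -- Uniqueness in the correspondence makes the chosen T and A linear.
  have hTadd : ∀ α β, T (α + β) = T α + T β := fun α β =>
    (hT _).unique_left ((hT α).add (hT β))
  have hTsmul : ∀ (c : k) α, T (c • α) = c • T α := fun c α =>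
    (hT _).unique_left ((hT α).smul c)
  have hAadd : ∀ α β, A (α + β) = A α + A β := fun α β =>
    (hA _).unique_right hK (by
      rw [hTadd, Preadditive.add_comp]
      exact (hA α).add (hA β))
  have hAsmul : ∀ (c : k) α, A (c • α) = c • A α := fun c α =>
    (hA _).unique_right hK (by
      rw [hTsmul, Linear.smul_comp]
      exact (hA α).smul c)
  let E : Module.Dual k (Module.Dual k (Ext M (kernel p) 1)) :=
    { toFun := fun α => A α hS.extClass
      map_add' := fun α β => by rw [hAadd, LinearMap.add_apply]
      map_smul' := fun c α => by rw [hAsmul, LinearMap.smul_apply, RingHom.id_apply] }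
  obtain ⟨ξ, hξ⟩ := (Module.evalEquiv k (Ext M (kernel p) 1)).surjective E
  have hξ' : ∀ α, α ξ = A α hS.extClass := fun α => LinearMap.congr_fun hξ α
  -- The pushout of ξ to the projective vanishes because that of the extension class does.
  have hlift : ξ.comp (Ext.mk₀ (kernel.ι p)) (add_zero 1) = 0 := by
    refine (Module.forall_dual_apply_eq_zero_iff k _).1 fun β => ?_
    obtain ⟨ψ, hψ⟩ := exists_isTauPair_left β
    obtain ⟨B, hB⟩ := exists_isTauPair_right hQ hP (ψ ≫ θ)
    have h1 := (hT _).unique_left (hψ.precomp (kernel.ι p))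
    have h2 := hB.precomp (kernel.ι p)
    rw [← Category.assoc, ← h1] at h2
    refine (hξ' (β ∘ₗ Ext.postcompOfLinear (Ext.mk₀ (kernel.ι p)) k M (add_zero 1))).trans ?_
    rw [(hA _).unique_right hK h2]
    exact (congrArg B hS.extClass_comp).trans (map_zero B)
  obtain ⟨y, hy⟩ := Ext.covariant_sequence_exact₁ M hS ξ hlift (zero_add 1)
  obtain ⟨φ, rfl⟩ := (Ext.mk₀_bijective _ _).2 y
  refine ⟨φ, tau_hom_ext fun l w => LinearMap.ext fun ζ => ?_⟩
  -- Every class in Ext¹(N, P(l)) is a pushout of the extension class along some c : K ⟶ P(l), so τφ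
  -- and θ need only be compared there.
  obtain ⟨y, rfl⟩ := Ext.contravariant_sequence_exact₃ hS _ ζ (Ext.eq_zero_of_projective _)
    (add_zero 1)
  obtain ⟨c, rfl⟩ := (Ext.mk₀_bijective _ _).2 y
  have h1 := (hT _).unique_left ((isTauPair_tauElt w).precomp c)
  have h2 := (isTauPair_tauElt (w ≫ θ)).precomp c
  rw [← Category.assoc, ← h1] at h2
  have h3 := hξ' (tauElt w ∘ₗ Ext.postcompOfLinear (Ext.mk₀ c) k M (add_zero 1))
  rw [(hA _).unique_right hK h2] at h3
  refine (tauElt_comp_map φ w _).trans (Eq.trans (congrArg (tauElt w) ?_) h3)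
  rw [← hy]
  exact (Ext.comp_assoc_of_third_deg_zero _ _ _ _).symm

omit [Finite Q] [∀ a b : Q, Finite (a ⟶ b)] in
-- Dualise 0 ⟶ Ext¹(C, P) ⟶ Ext¹(B, P) ⟶ Ext¹(A, P) ⟶ 0: it is exact on the left since Hom(A, P) = 0
-- and on the right since Ext² = 0.
theorem shortExact_tau {A B C : QuiverRep k Q} {f : A ⟶ B} {g : B ⟶ C} (w : f ≫ g = 0)
    (hS : (ShortComplex.mk f g w).ShortExact)
    (hA : ∀ j : Paths Q, Subsingleton (A ⟶ (proj k Q).obj (Opposite.op j))) :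
    ∃ w, (ShortComplex.mk ((tau k Q).map f) ((tau k Q).map g) w).ShortExact := by
  have w' : (tau k Q).map f ≫ (tau k Q).map g = 0 := by
    rw [← Functor.map_comp, w, Functor.map_zero]
  refine ⟨w', (shortExact_iff_linAt _).2 fun j => ?_⟩
  have : Mono f := hS.mono_f
  let j' : Paths Q := j
  let P := (proj k Q).obj (Opposite.op j')
  let F := Ext.precompOfLinear (Ext.mk₀ f) k P (zero_add 1)
  let G := Ext.precompOfLinear (Ext.mk₀ g) k P (zero_add 1)
  have hF : Function.Surjective F := exists_ext_extension_of_mono P f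
  have hG : Function.Injective G := (injective_iff_map_eq_zero G).2 fun x hx => by
    obtain ⟨y, rfl⟩ := Ext.contravariant_sequence_exact₃ hS P x hx (add_zero 1)
    obtain ⟨y, rfl⟩ := (Ext.mk₀_bijective _ _).2 y
    rw [(hA j').elim y 0, Ext.mk₀_zero, Ext.comp_zero]
  have hGF : ∀ x, F (G x) = 0 := fun x => by
    change (Ext.mk₀ f).comp ((Ext.mk₀ g).comp x (zero_add 1)) (zero_add 1) = 0
    rw [Ext.mk₀_comp_mk₀_assoc, w, Ext.mk₀_zero, Ext.zero_comp]
  have hex : Function.Exact G F := fun x => ⟨fun hx => Ext.contravariant_sequence_exact₂ hS P x hx,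
    by rintro ⟨y, rfl⟩; exact hGF y⟩
  refine ⟨LinearMap.dualMap_injective_of_surjective hF, fun α => ⟨fun hα => ?_, ?_⟩,
    LinearMap.dualMap_surjective_of_injective hG⟩
  · obtain ⟨ψ, hψ⟩ := exists_linearMap_desc hF hex (α : Module.Dual k _)
      (LinearMap.congr_fun hα)
    exact ⟨ψ, LinearMap.ext hψ⟩
  · rintro ⟨β, rfl⟩
    exact LinearMap.congr_fun (congrArg (fun t => linAt t j) w') β

theorem IsSchofieldSequence.tau (hQ : IsAcyclic Q) {X Z Y : QuiverRep k Q} {m n : ℕ}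
    {f : (⨁ fun _ : Fin m => X) ⟶ Z} {g : Z ⟶ ⨁ fun _ : Fin n => Y}
    (h : IsSchofieldSequence m n X Z Y f g) (hX : ¬ Projective X) :
    IsSchofieldSequence m n ((tau k Q).obj X) ((tau k Q).obj Z) ((tau k Q).obj Y)
      (mapFrom (tau k Q) f) (mapTo (tau k Q) g) := by
  obtain ⟨w, hS⟩ := h.exact
  have hXP := hom_proj_eq_zero h.pair.exceptional_right.indecomposable hX
  refine h.map (QuiverRep.tau k Q)
    (fun M => ∀ j : Paths Q, Subsingleton (M ⟶ (proj k Q).obj (Opposite.op j))) hXP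
    (hom_proj_eq_zero h.exceptional.indecomposable fun hZ => hX ?_)
    (hom_proj_eq_zero h.pair.exceptional_left.indecomposable fun hY => h.not_subsingleton_ext
      (Ext.subsingleton_of_projective _ _ 0))
    (fun M hM => hM.tau hQ)
    (fun M N hM _ hMf hNf => ⟨tau_map_injective hQ hNf hM, tau_map_surjective hQ hMf hNf⟩)
    -- Ext¹(M, N) = 0 gives Hom(N, τM) = 0, which gives Ext¹(τM, τN) = 0.
    (fun M N hM hN hMN => subsingleton_ext_tau hQ (hM.tau hQ) (subsingleton_hom_tau hQ hN hMN))
    (shortExact_tau w hS fun j => ⟨fun φ ψ => biproduct.hom_ext' _ _ fun _ =>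
      (hXP j).elim _ _⟩)
  -- If Z were projective, then so would be its subobject X.
  obtain ⟨s, hs⟩ := h.exists_mono
  exact projective_of_mono s

end TauFunctor

/-! ### The Auslander-Reiten formula for `τ⁻¹` -/

section TauInv

variable {k : Type u} [Field k] {Q : Type u} [Quiver.{u} Q]

theorem injFun_comp_map {M : QuiverRep k Q} {j l : Paths Q} (q : l ⟶ j)
    (w : M ⟶ (inj k Q).obj (Opposite.op j)) (x : M.obj l) :
    injFun (w ≫ (inj k Q).map q.op) x = injFun w ((M.map q).hom x) := by
  refine Eq.trans ?_ (app_inj_apply w q x)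
  change (show Module.Dual k ((l ⟶ j) →₀ k) from (w.app l).hom x)
    (Finsupp.mapDomain (fun r => r ≫ q) (Finsupp.single (𝟙 l) 1)) = _
  rw [Finsupp.mapDomain_single, Category.id_comp]

theorem injLift_comp_map (M : QuiverRep k Q) {j l : Paths Q} (q : l ⟶ j)
    (m : Module.Dual k (M.obj j)) :
    injLift M j m ≫ (inj k Q).map q.op = injLift M l (m ∘ₗ (M.map q).hom) :=
  inj_hom_ext (LinearMap.ext fun x => (injFun_comp_map q _ x).trans (by
    rw [injFun_injLift, injFun_injLift]
    rfl))

theorem injLift_add (M : QuiverRep k Q) (j : Paths Q) (m m' : Module.Dual k (M.obj j)) :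
    injLift M j (m + m') = injLift M j m + injLift M j m' :=
  inj_hom_ext (by
    rw [injFun_injLift]
    exact (congrArg₂ (· + ·) (injFun_injLift M j m) (injFun_injLift M j m')).symm)

theorem injLift_smul (M : QuiverRep k Q) (j : Paths Q) (c : k) (m : Module.Dual k (M.obj j)) :
    injLift M j (c • m) = c • injLift M j m :=
  inj_hom_ext (by
    rw [injFun_injLift]
    exact (congrArg (c • ·) (injFun_injLift M j m)).symm)

theorem injLift_injFun {M : QuiverRep k Q} {j : Paths Q}
    (u : M ⟶ (inj k Q).obj (Opposite.op j)) : injLift M j (injFun u) = u :=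
  inj_hom_ext (injFun_injLift _ _ _)

/-- The functional on `Ext¹(I(j), N)` given by a morphism from `τ⁻¹ N` to `I(j)`. -/
def tauInvFun {N : QuiverRep k Q} {j : Paths Q}
    (w : (tauInv k Q).obj N ⟶ (inj k Q).obj (Opposite.op j)) :
    Module.Dual k (Ext ((inj k Q).obj (Opposite.op j)) N 1) :=
  injFun w

theorem tauInvFun_sum {N : QuiverRep k Q} {j : Paths Q} {ι : Type*} (s : Finset ι)
    (w : ι → ((tauInv k Q).obj N ⟶ (inj k Q).obj (Opposite.op j))) :
    tauInvFun (∑ t ∈ s, w t) = ∑ t ∈ s, tauInvFun (w t) :=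
  map_sum ({ toFun := tauInvFun, map_zero' := rfl, map_add' := fun _ _ => rfl } :
    ((tauInv k Q).obj N ⟶ (inj k Q).obj (Opposite.op j)) →+ Module.Dual k _) _ _

theorem tauInv_hom_ext {M N : QuiverRep k Q} {θ θ' : (tauInv k Q).obj N ⟶ M}
    (h : ∀ (j : Paths Q) (u : M ⟶ (inj k Q).obj (Opposite.op j)),
      tauInvFun (θ ≫ u) = tauInvFun (θ' ≫ u)) : θ = θ' := by
  apply NatTrans.ext
  funext j
  apply ModuleCat.hom_ext
  apply LinearMap.ext
  intro ξ
  refine sub_eq_zero.1 ((Module.forall_dual_apply_eq_zero_iff k _).1 fun m => ?_)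
  have h1 := LinearMap.congr_fun (h j (injLift M j m)) ξ
  have h2 : ∀ θ : (tauInv k Q).obj N ⟶ M, tauInvFun (θ ≫ injLift M j m) ξ =
      m ((θ.app j).hom ξ) := fun θ =>
    LinearMap.congr_fun (injFun_injLift M j m) ((θ.app j).hom ξ)
  rw [map_sub, sub_eq_zero]
  exact (h2 θ).symm.trans (h1.trans (h2 θ'))

/-- A morphism `τ⁻¹ N ⟶ M` and a functional on `Ext¹(M, N)` correspond to each other under the
Auslander-Reiten formula. -/
def IsTauInvPair {M N : QuiverRep k Q} (θ : (tauInv k Q).obj N ⟶ M)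
    (α : Module.Dual k (Ext M N 1)) : Prop :=
  ∀ (j : Paths Q) (u : M ⟶ (inj k Q).obj (Opposite.op j))
    (ξ : Ext ((inj k Q).obj (Opposite.op j)) N 1),
      tauInvFun (θ ≫ u) ξ = α ((Ext.mk₀ u).comp ξ (zero_add 1))

theorem IsTauInvPair.add {M N : QuiverRep k Q} {θ θ' : (tauInv k Q).obj N ⟶ M}
    {α α' : Module.Dual k (Ext M N 1)} (h : IsTauInvPair θ α) (h' : IsTauInvPair θ' α') :
    IsTauInvPair (θ + θ') (α + α') := fun j u ξ => by
  rw [LinearMap.add_apply, ← h, ← h', Preadditive.add_comp]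
  rfl

theorem IsTauInvPair.smul {M N : QuiverRep k Q} {θ : (tauInv k Q).obj N ⟶ M}
    {α : Module.Dual k (Ext M N 1)} (c : k) (h : IsTauInvPair θ α) :
    IsTauInvPair (c • θ) (c • α) := fun j u ξ => by
  rw [LinearMap.smul_apply, ← h, Linear.smul_comp]
  rfl

theorem IsTauInvPair.postcomp {M M' N : QuiverRep k Q} {θ : (tauInv k Q).obj N ⟶ M}
    {α : Module.Dual k (Ext M N 1)} (h : IsTauInvPair θ α) (g : M ⟶ M') :
    IsTauInvPair (θ ≫ g) (α ∘ₗ Ext.precompOfLinear (Ext.mk₀ g) k N (zero_add 1)) :=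
  fun j u ξ => by
    rw [Category.assoc, h, ← Ext.mk₀_comp_mk₀_assoc]
    rfl

theorem IsTauInvPair.unique_left {M N : QuiverRep k Q} {θ θ' : (tauInv k Q).obj N ⟶ M}
    {α : Module.Dual k (Ext M N 1)} (h : IsTauInvPair θ α) (h' : IsTauInvPair θ' α) : θ = θ' :=
  tauInv_hom_ext fun j u => LinearMap.ext fun ξ => (h j u ξ).trans (h' j u ξ).symm

/-- The formula prescribes the value of every functional m on θ ξ; a vector with these values exists
because the finite dimensional space M_j is reflexive. -/
theorem exists_isTauInvPair_left {M N : QuiverRep k Q} (hM : IsFinDim M)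
    (α : Module.Dual k (Ext M N 1)) : ∃ θ : (tauInv k Q).obj N ⟶ M, IsTauInvPair θ α := by
  have hfin : ∀ j : Paths Q, Module.Finite k (M.obj j) := hM
  let F : ∀ j : Paths Q, Ext ((inj k Q).obj (Opposite.op j)) N 1 →ₗ[k]
      Module.Dual k (Module.Dual k (M.obj j)) := fun j =>
    LinearMap.mk₂ k (fun ξ m => α ((Ext.mk₀ (injLift M j m)).comp ξ (zero_add 1)))
      (fun ξ ξ' m => by rw [Ext.comp_add, map_add])
      (fun c ξ m => by rw [Ext.comp_smul, map_smul])
      (fun ξ m m' => by rw [injLift_add, Ext.mk₀_add, Ext.add_comp, map_add])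
      (fun c ξ m => by rw [injLift_smul, Ext.mk₀_smul, Ext.smul_comp, map_smul])
  let G : ∀ j : Paths Q, Ext ((inj k Q).obj (Opposite.op j)) N 1 →ₗ[k] M.obj j := fun j =>
    (Module.evalEquiv k (M.obj j)).symm.toLinearMap ∘ₗ F j
  have hG : ∀ (j : Paths Q) ξ (m : Module.Dual k (M.obj j)), m (G j ξ) =
      α ((Ext.mk₀ (injLift M j m)).comp ξ (zero_add 1)) := fun j ξ m =>
    LinearMap.congr_fun ((Module.evalEquiv k (M.obj j)).apply_symm_apply (F j ξ)) m
  let θ : (tauInv k Q).obj N ⟶ M :=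
    { app := fun j => ModuleCat.ofHom (G j)
      naturality := fun j l p => by
        apply ModuleCat.hom_ext
        apply LinearMap.ext
        intro ξ
        refine sub_eq_zero.1 ((Module.forall_dual_apply_eq_zero_iff k _).1 fun m => ?_)
        rw [map_sub, sub_eq_zero]
        refine (hG l ((Ext.mk₀ ((inj k Q).map p.op)).comp ξ (zero_add 1)) m).trans
          (Eq.trans ?_ (hG j ξ (m ∘ₗ (M.map p).hom)).symm)
        refine congrArg α ((Ext.mk₀_comp_mk₀_assoc _ _ (show Ext _ N 1 from ξ)).trans ?_)
        rw [injLift_comp_map] }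
  refine ⟨θ, fun j u ξ => ?_⟩
  conv_rhs => rw [← injLift_injFun u]
  exact hG j ξ (injFun u)

theorem ext_linearMap_ext_left [Finite Q] {M N : QuiverRep k Q} (hM : IsFinDim M) {V : Type*}
    [AddCommGroup V] [Module k V] {A B : Ext M N 1 →ₗ[k] V}
    (h : ∀ (j : Paths Q) (u : M ⟶ (inj k Q).obj (Opposite.op j))
      (ξ : Ext ((inj k Q).obj (Opposite.op j)) N 1), A ((Ext.mk₀ u).comp ξ (zero_add 1)) =
        B ((Ext.mk₀ u).comp ξ (zero_add 1))) : A = B := by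
  obtain ⟨ι, _, j, s, hs⟩ := exists_inj_hull hM
  refine LinearMap.ext fun x => ?_
  obtain ⟨y, rfl⟩ := exists_ext_extension_of_mono N s x
  have ht := IsBilimit.total (biproduct.isBilimit
    fun t => (inj k Q).obj (Opposite.op (j t)))
  have hy : (Ext.mk₀ s).comp y (zero_add 1) = ∑ t, (Ext.mk₀ (s ≫ biproduct.π
      (fun t => (inj k Q).obj (Opposite.op (j t))) t)).comp ((Ext.mk₀ (biproduct.ι
        (fun t => (inj k Q).obj (Opposite.op (j t))) t)).comp y (zero_add 1)) (zero_add 1) := by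
    have h1 : s = ∑ t, (s ≫ biproduct.π (fun t => (inj k Q).obj (Opposite.op (j t))) t) ≫
        biproduct.ι (fun t => (inj k Q).obj (Opposite.op (j t))) t := by
      refine (Category.comp_id s).symm.trans ((congrArg (fun t => s ≫ t) ht).symm.trans ?_)
      rw [Preadditive.comp_sum]
      exact Finset.sum_congr rfl fun _ _ => (Category.assoc _ _ _).symm
    conv_lhs => rw [h1]
    rw [Ext.mk₀_sum, Ext.sum_comp]
    refine Finset.sum_congr rfl fun t _ => ?_
    rw [Ext.mk₀_comp_mk₀_assoc]
  rw [hy, map_sum, map_sum]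
  exact Finset.sum_congr rfl fun t _ => h _ _ _

theorem IsTauInvPair.unique_right [Finite Q] {M N : QuiverRep k Q} (hM : IsFinDim M)
    {θ : (tauInv k Q).obj N ⟶ M} {α α' : Module.Dual k (Ext M N 1)} (h : IsTauInvPair θ α)
    (h' : IsTauInvPair θ α') : α = α' :=
  ext_linearMap_ext_left hM fun j u ξ => (h j u ξ).symm.trans (h' j u ξ)

variable [Finite Q] [∀ a b : Q, Finite (a ⟶ b)]

theorem tauInvFun_comp (hQ : IsAcyclic Q) {N : QuiverRep k Q} {j l : Paths Q}
    (w : (tauInv k Q).obj N ⟶ (inj k Q).obj (Opposite.op j))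
    (c : (inj k Q).obj (Opposite.op j) ⟶ (inj k Q).obj (Opposite.op l))
    (ξ : Ext ((inj k Q).obj (Opposite.op l)) N 1) :
    tauInvFun (w ≫ c) ξ = tauInvFun w ((Ext.mk₀ c).comp ξ (zero_add 1)) := by
  have : Finite (l ⟶ j) := finite_path hQ l j
  let T : ((l ⟶ j) →₀ k) →ₗ[k]
      ((inj k Q).obj (Opposite.op j) ⟶ (inj k Q).obj (Opposite.op l)) :=
    { toFun := fun v => injLift _ l (Module.Dual.eval k ((l ⟶ j) →₀ k) v)
      map_add' := fun v v' => by
        rw [map_add]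
        exact injLift_add _ _ _ _
      map_smul' := fun a v => by
        rw [map_smul]
        exact injLift_smul _ _ _ _ }
  have hT : ∀ q : l ⟶ j, T (Finsupp.single q 1) = (inj k Q).map q.op := fun q =>
    inj_hom_ext ((injFun_injLift _ _ _).trans (LinearMap.ext fun x => by
      change (show Module.Dual k ((l ⟶ j) →₀ k) from x) (Finsupp.single q 1) =
        (show Module.Dual k ((l ⟶ j) →₀ k) from x)
          (Finsupp.mapDomain (fun r => r ≫ q) (Finsupp.single (𝟙 l) 1))
      rw [Finsupp.mapDomain_single, Category.id_comp]))
  have key : ∀ v, tauInvFun (w ≫ T v) ξ = tauInvFun w ((Ext.mk₀ (T v)).comp ξ (zero_add 1)) := by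
    intro v
    induction v using Finsupp.induction_linear with
    | zero =>
      rw [map_zero, comp_zero, Ext.mk₀_zero, Ext.zero_comp, map_zero]
      rfl
    | add v v' h h' =>
      rw [map_add, Preadditive.comp_add, Ext.mk₀_add, Ext.add_comp, map_add, ← h, ← h']
      rfl
    | single q a =>
      rw [← Finsupp.smul_single_one, map_smul, Linear.comp_smul, Ext.mk₀_smul, Ext.smul_comp,
        map_smul, hT]
      exact congrArg (fun t : k => a * t) (injFun_comp_map q w ξ)
  -- There are finitely many paths l ⟶ j, so the functional of c on the dual of their span is
  -- evaluation at a vector v; thus c is a linear combination of paths.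
  obtain ⟨v, hv⟩ := (Module.evalEquiv k ((l ⟶ j) →₀ k)).surjective (injFun c)
  have hc : T v = c := (congrArg (injLift _ l) hv).trans (injLift_injFun c)
  rw [← hc]
  exact key v

theorem isTauInvPair_tauInvFun (hQ : IsAcyclic Q) {N : QuiverRep k Q} {j : Paths Q}
    (w : (tauInv k Q).obj N ⟶ (inj k Q).obj (Opposite.op j)) : IsTauInvPair w (tauInvFun w) :=
  fun _ u ξ => tauInvFun_comp hQ w u ξ

theorem exists_isTauInvPair_right (hQ : IsAcyclic Q) {M N : QuiverRep k Q} (hM : IsFinDim M)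
    (θ : (tauInv k Q).obj N ⟶ M) : ∃ α : Module.Dual k (Ext M N 1), IsTauInvPair θ α := by
  obtain ⟨ι, _, j, s, hs⟩ := exists_inj_hull hM
  let V : ι → QuiverRep k Q := fun t => (inj k Q).obj (Opposite.op (j t))
  have hS := shortExact_cokernel s
  have hC : IsFinDim (cokernel s) :=
    (isFinDim_biproduct _ fun t => isFinDim_inj hQ (j t)).of_epi (cokernel.π s)
  let α₀ : Module.Dual k (Ext (⨁ V) N 1) := ∑ t, tauInvFun (j := j t) ((θ ≫ s) ≫ biproduct.π V t) ∘ₗ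
    Ext.precompOfLinear (Ext.mk₀ (biproduct.ι V t)) k N (zero_add 1)
  have h₀ : ∀ (l : Paths Q) (h : ⨁ V ⟶ (inj k Q).obj (Opposite.op l)) ξ,
      α₀ ((Ext.mk₀ h).comp ξ (zero_add 1)) = tauInvFun ((θ ≫ s) ≫ h) ξ := by
    intro l h ξ
    have h1 : (θ ≫ s) ≫ h = ∑ t, ((θ ≫ s) ≫ biproduct.π V t) ≫ (biproduct.ι V t ≫ h) := by
      have ht : ∑ t, biproduct.π V t ≫ biproduct.ι V t = 𝟙 (⨁ V) :=
        IsBilimit.total (biproduct.isBilimit V)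
      conv_lhs => rw [← Category.id_comp h, ← ht]
      simp only [Preadditive.sum_comp, Preadditive.comp_sum, Category.assoc]
    rw [h1, tauInvFun_sum, LinearMap.sum_apply, LinearMap.sum_apply]
    refine Finset.sum_congr rfl fun t _ => ?_
    refine Eq.trans ?_ (tauInvFun_comp hQ (j := j t) ((θ ≫ s) ≫ biproduct.π V t)
      (biproduct.ι V t ≫ h) ξ).symm
    exact congrArg (tauInvFun (j := j t) ((θ ≫ s) ≫ biproduct.π V t))
      (Ext.mk₀_comp_mk₀_assoc _ _ _)
  -- As Ext² = 0, Ext¹(M, N) is the cokernel of Ext¹(coker s, N) ⟶ Ext¹(⨁ V, N), and α₀ vanishes on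
  -- the image.
  obtain ⟨α, hα⟩ := exists_linearMap_desc
    (f := Ext.precompOfLinear (Ext.mk₀ (cokernel.π s)) k N (zero_add 1))
    (g := Ext.precompOfLinear (Ext.mk₀ s) k N (zero_add 1)) (exists_ext_extension_of_mono N s)
    (fun x => ⟨fun hx => Ext.contravariant_sequence_exact₂ hS N x hx, by
      rintro ⟨y, rfl⟩
      refine (Ext.mk₀_comp_mk₀_assoc s (cokernel.π s) y).trans ?_
      rw [cokernel.condition, Ext.mk₀_zero, Ext.zero_comp]⟩) α₀
    (LinearMap.congr_fun (ext_linearMap_ext_left (A := α₀ ∘ₗ Ext.precompOfLinear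
      (Ext.mk₀ (cokernel.π s)) k N (zero_add 1)) (B := 0) hC fun l u ξ => by
        refine (congrArg α₀ (Ext.mk₀_comp_mk₀_assoc (cokernel.π s) u ξ)).trans
          ((h₀ l _ ξ).trans ?_)
        rw [Category.assoc, cokernel.condition_assoc, zero_comp, comp_zero]
        rfl))
  refine ⟨α, fun l u ξ => ?_⟩
  have hu := Injective.comp_factorThru u s
  rw [← hu, ← Category.assoc, ← h₀, ← hα, ← Ext.mk₀_comp_mk₀_assoc]
  rfl

end TauInv

/-! ### Full faithfulness, Ext¹ and exactness for τ⁻¹, and Schofield sequences -/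

section TauInvFunctor

variable {k : Type u} [Field k] {Q : Type u} [Quiver.{u} Q]

instance : (tauInv k Q).Additive where
  map_add {M N φ ψ} := by
    apply NatTrans.ext
    funext j
    apply ModuleCat.hom_ext
    apply LinearMap.ext
    intro (ξ : Ext ((inj k Q).obj (Opposite.op j)) M 1)
    change ξ.comp (Ext.mk₀ (φ + ψ)) (add_zero 1) =
      ξ.comp (Ext.mk₀ φ) (add_zero 1) + ξ.comp (Ext.mk₀ ψ) (add_zero 1)
    rw [Ext.mk₀_add, Ext.comp_add]

theorem tauInvFun_map_comp {M N : QuiverRep k Q} (φ : M ⟶ N) {j : Paths Q}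
    (w : (tauInv k Q).obj N ⟶ (inj k Q).obj (Opposite.op j))
    (ξ : Ext ((inj k Q).obj (Opposite.op j)) M 1) :
    tauInvFun ((tauInv k Q).map φ ≫ w) ξ = tauInvFun w (ξ.comp (Ext.mk₀ φ) (add_zero 1)) := rfl

theorem hom_inj_eq_zero {M : QuiverRep k Q} (hM : Indecomposable M) (h : ¬ Injective M)
    (j : Paths Q) : Subsingleton ((inj k Q).obj (Opposite.op j) ⟶ M) := by
  refine subsingleton_of_forall_eq 0 fun φ => ?_
  have : Injective (Limits.image φ) := injective_of_epi (Limits.factorThruImage φ)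
  rcases isZero_or_isIso_of_retract hM (Limits.image.ι φ)
    (Injective.factorThru (𝟙 _) (Limits.image.ι φ)) (Injective.comp_factorThru _ _) with h0 | hi
  · rw [← Limits.image.fac φ, h0.eq_of_src (Limits.image.ι φ) 0, comp_zero]
  · exact absurd (Injective.of_iso (asIso (Limits.image.ι φ)) inferInstance) h

theorem hom_biproduct_inj_eq_zero {M : QuiverRep k Q}
    (hM : ∀ j : Paths Q, Subsingleton ((inj k Q).obj (Opposite.op j) ⟶ M)) {ι : Type u}
    [Finite ι] (j : ι → Paths Q) (φ : (⨁ fun t => (inj k Q).obj (Opposite.op (j t))) ⟶ M) :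
    φ = 0 :=
  biproduct.hom_ext' _ _ fun t => (hM (j t)).elim _ _

variable [Finite Q] [∀ a b : Q, Finite (a ⟶ b)]

theorem IsFinDim.tauInv (hQ : IsAcyclic Q) {M : QuiverRep k Q} (hM : IsFinDim M) :
    IsFinDim ((tauInv k Q).obj M) := fun j =>
  finite_ext hQ (isFinDim_inj (k := k) hQ j) hM

theorem subsingleton_hom_tauInv (hQ : IsAcyclic Q) {M N : QuiverRep k Q} (hM : IsFinDim M)
    (h : Subsingleton (Ext M N 1)) : Subsingleton ((tauInv k Q).obj N ⟶ M) := by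
  refine ⟨fun θ θ' => ?_⟩
  obtain ⟨α, hα⟩ := exists_isTauInvPair_right hQ hM θ
  obtain ⟨α', hα'⟩ := exists_isTauInvPair_right hQ hM θ'
  obtain rfl : α = α' := LinearMap.ext fun x => by rw [h.elim x 0, map_zero, map_zero]
  exact hα.unique_left hα'

/-- Embed L by s in a sum of I(j)'s. Since Hom(L, N) = 0, Ext¹(coker s, N) embeds in Ext¹ from that
sum to N, so the functional of a morphism τ⁻¹N ⟶ coker s extends, and the morphism lifts. -/
theorem subsingleton_ext_tauInv (hQ : IsAcyclic Q) {N L : QuiverRep k Q} (hL : IsFinDim L)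
    (h : Subsingleton (L ⟶ N)) : Subsingleton (Ext ((tauInv k Q).obj N) L 1) := by
  obtain ⟨ι, _, j, s, hs⟩ := exists_inj_hull hL
  have hS := shortExact_cokernel s
  have hI := isFinDim_biproduct (k := k) _ fun t => isFinDim_inj hQ (j t)
  have hC : IsFinDim (cokernel s) := hI.of_epi (cokernel.π s)
  refine subsingleton_ext_of_lift hS fun θ => ?_
  obtain ⟨α, hα⟩ := exists_isTauInvPair_right hQ hC θ
  obtain ⟨r, hr⟩ := LinearMap.exists_leftInverse_of_injective
    (Ext.precompOfLinear (Ext.mk₀ (cokernel.π s)) k N (zero_add 1)) (LinearMap.ker_eq_bot'.2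
      fun x hx => by
        obtain ⟨y, rfl⟩ := Ext.contravariant_sequence_exact₃ hS N x hx (add_zero 1)
        obtain ⟨y, rfl⟩ := (Ext.mk₀_bijective _ _).2 y
        rw [h.elim y 0, Ext.mk₀_zero, Ext.comp_zero])
  obtain ⟨ψ, hψ⟩ := exists_isTauInvPair_left hI (α ∘ₗ r)
  refine ⟨ψ, (hψ.postcomp (cokernel.π s)).unique_left (?_ : IsTauInvPair θ _)⟩
  rw [LinearMap.comp_assoc, hr]
  exact hα

theorem tauInv_map_injective {M N : QuiverRep k Q} (hQ : IsAcyclic Q) (hM : IsFinDim M)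
    (hN : ∀ j : Paths Q, Subsingleton ((inj k Q).obj (Opposite.op j) ⟶ N)) :
    Function.Injective ((tauInv k Q).map : (M ⟶ N) → _) := by
  refine (injective_iff_map_eq_zero (tauInv k Q).mapAddHom).2 fun φ hφ => ?_
  obtain ⟨ι, _, j, s, hs⟩ := exists_inj_hull hM
  have hS := shortExact_cokernel s
  have hC : IsFinDim (cokernel s) :=
    (isFinDim_biproduct _ fun t => isFinDim_inj hQ (j t)).of_epi (cokernel.π s)
  have h₀ : ∀ (l : Paths Q) (ξ : Ext ((inj k Q).obj (Opposite.op l)) M 1),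
      ξ.comp (Ext.mk₀ φ) (add_zero 1) = 0 := by
    intro l ξ
    have h1 := congrArg (fun t => NatTrans.app t l) hφ
    exact LinearMap.congr_fun (congrArg ModuleCat.Hom.hom h1) ξ
  have h₁ : Ext.postcompOfLinear (Ext.mk₀ φ) k (cokernel s) (add_zero 1) = 0 :=
    ext_linearMap_ext_left hC fun l u ξ => by
      refine (Ext.comp_assoc_of_third_deg_zero (Ext.mk₀ u) ξ (Ext.mk₀ φ) (zero_add 1)).trans ?_
      rw [h₀, Ext.comp_zero]
      rfl
  obtain ⟨y, hy⟩ := Ext.contravariant_sequence_exact₁ hS N (Ext.mk₀ φ) (add_zero 1)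
    (LinearMap.congr_fun h₁ hS.extClass)
  obtain ⟨y, rfl⟩ := (Ext.mk₀_bijective _ _).2 y
  rw [hom_biproduct_inj_eq_zero hN j y, Ext.mk₀_zero, Ext.comp_zero] at hy
  exact (Ext.mk₀_eq_zero_iff φ).1 hy.symm

/-- Dual to fullness of τ: with C = coker s for an embedding s of M in a sum of I(j)'s, θ and the
extension class in Ext¹(C, M) determine a class ξ in Ext¹(C, N), which is the pushout of the
extension class along the desired φ. -/
theorem tauInv_map_surjective {M N : QuiverRep k Q} (hQ : IsAcyclic Q) (hM : IsFinDim M)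
    (hNf : IsFinDim N) : Function.Surjective
      ((tauInv k Q).map : (M ⟶ N) → ((tauInv k Q).obj M ⟶ (tauInv k Q).obj N)) := by
  intro θ
  obtain ⟨ι, _, j, s, hs⟩ := exists_inj_hull hM
  have hS := shortExact_cokernel s
  have hI := isFinDim_biproduct (k := k) _ fun t => isFinDim_inj hQ (j t)
  have hC : IsFinDim (cokernel s) := hI.of_epi (cokernel.π s)
  have := finite_ext hQ hC hNf
  choose T hT using fun α : Module.Dual k (Ext (cokernel s) N 1) => exists_isTauInvPair_left hC α
  choose A hA using fun α => exists_isTauInvPair_right hQ hC (θ ≫ T α)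
  have hTadd : ∀ α β, T (α + β) = T α + T β := fun α β =>
    (hT _).unique_left ((hT α).add (hT β))
  have hTsmul : ∀ (c : k) α, T (c • α) = c • T α := fun c α =>
    (hT _).unique_left ((hT α).smul c)
  have hAadd : ∀ α β, A (α + β) = A α + A β := fun α β =>
    (hA _).unique_right hC (by
      rw [hTadd, Preadditive.comp_add]
      exact (hA α).add (hA β))
  have hAsmul : ∀ (c : k) α, A (c • α) = c • A α := fun c α =>
    (hA _).unique_right hC (by
      rw [hTsmul, Linear.comp_smul]
      exact (hA α).smul c)
  let E : Module.Dual k (Module.Dual k (Ext (cokernel s) N 1)) :=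
    { toFun := fun α => A α hS.extClass
      map_add' := fun α β => by rw [hAadd, LinearMap.add_apply]
      map_smul' := fun c α => by rw [hAsmul, LinearMap.smul_apply, RingHom.id_apply] }
  obtain ⟨ξ, hξ⟩ := (Module.evalEquiv k (Ext (cokernel s) N 1)).surjective E
  have hξ' : ∀ α, α ξ = A α hS.extClass := fun α => LinearMap.congr_fun hξ α
  have hlift : (Ext.mk₀ (cokernel.π s)).comp ξ (zero_add 1) = 0 := by
    refine (Module.forall_dual_apply_eq_zero_iff k _).1 fun β => ?_
    obtain ⟨ψ, hψ⟩ := exists_isTauInvPair_left hI β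
    obtain ⟨B, hB⟩ := exists_isTauInvPair_right hQ hI (θ ≫ ψ)
    have h1 := (hT _).unique_left (hψ.postcomp (cokernel.π s))
    have h2 := hB.postcomp (cokernel.π s)
    rw [Category.assoc, ← h1] at h2
    refine (hξ' (β ∘ₗ Ext.precompOfLinear (Ext.mk₀ (cokernel.π s)) k N (zero_add 1))).trans ?_
    rw [(hA _).unique_right hC h2]
    exact (congrArg B hS.comp_extClass).trans (map_zero B)
  obtain ⟨y, hy⟩ := Ext.contravariant_sequence_exact₃ hS N ξ hlift (add_zero 1)
  obtain ⟨φ, rfl⟩ := (Ext.mk₀_bijective _ _).2 y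
  refine ⟨φ, tauInv_hom_ext fun l w => LinearMap.ext fun ζ => ?_⟩
  obtain ⟨y, rfl⟩ := Ext.covariant_sequence_exact₁ _ hS ζ (Ext.eq_zero_of_injective _)
    (zero_add 1)
  obtain ⟨c, rfl⟩ := (Ext.mk₀_bijective _ _).2 y
  have h1 := (hT _).unique_left ((isTauInvPair_tauInvFun hQ w).postcomp c)
  have h2 := (isTauInvPair_tauInvFun hQ (θ ≫ w)).postcomp c
  rw [Category.assoc, ← h1] at h2
  have h3 := hξ' (tauInvFun w ∘ₗ Ext.precompOfLinear (Ext.mk₀ c) k N (zero_add 1))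
  rw [(hA _).unique_right hC h2] at h3
  refine (tauInvFun_map_comp φ w _).trans (Eq.trans (congrArg (tauInvFun w) ?_) h3)
  rw [← hy]
  exact Ext.comp_assoc_of_third_deg_zero _ _ _ _

omit [Finite Q] [∀ a b : Q, Finite (a ⟶ b)] in
-- Apply Ext¹(I(j), -): Hom(I(j), C) = 0 gives exactness on the left, Ext² = 0 on the right.
theorem shortExact_tauInv {A B C : QuiverRep k Q} {f : A ⟶ B} {g : B ⟶ C} (w : f ≫ g = 0)
    (hS : (ShortComplex.mk f g w).ShortExact)
    (hC : ∀ j : Paths Q, Subsingleton ((inj k Q).obj (Opposite.op j) ⟶ C)) :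
    ∃ w, (ShortComplex.mk ((tauInv k Q).map f) ((tauInv k Q).map g) w).ShortExact := by
  have w' : (tauInv k Q).map f ≫ (tauInv k Q).map g = 0 := by
    rw [← Functor.map_comp, w, Functor.map_zero]
  refine ⟨w', (shortExact_iff_linAt _).2 fun j => ?_⟩
  have : Epi g := hS.epi_g
  let j' : Paths Q := j
  let I := (inj k Q).obj (Opposite.op j')
  refine ⟨(injective_iff_map_eq_zero _).2 fun (x : Ext I A 1) hx => ?_,
    fun (x : Ext I B 1) => ⟨fun hx => Ext.covariant_sequence_exact₂ I hS x hx, ?_⟩,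
    exists_ext_lift_of_epi I g⟩
  · obtain ⟨y, rfl⟩ := Ext.covariant_sequence_exact₁ I hS x hx (zero_add 1)
    obtain ⟨y, rfl⟩ := (Ext.mk₀_bijective _ _).2 y
    rw [(hC j').elim y 0, Ext.mk₀_zero, Ext.zero_comp]
    rfl
  · rintro ⟨y, hy⟩
    exact (congrArg (linAt ((tauInv k Q).map g) j) hy).symm.trans
      (LinearMap.congr_fun (congrArg (fun t => linAt t j) w') y)

theorem IsSchofieldSequence.tauInv (hQ : IsAcyclic Q) {X Z Y : QuiverRep k Q} {m n : ℕ}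
    {f : (⨁ fun _ : Fin m => X) ⟶ Z} {g : Z ⟶ ⨁ fun _ : Fin n => Y}
    (h : IsSchofieldSequence m n X Z Y f g) (hY : ¬ Injective Y) :
    IsSchofieldSequence m n ((tauInv k Q).obj X) ((tauInv k Q).obj Z) ((tauInv k Q).obj Y)
      (mapFrom (tauInv k Q) f) (mapTo (tauInv k Q) g) := by
  obtain ⟨w, hS⟩ := h.exact
  have hYI := hom_inj_eq_zero h.pair.exceptional_left.indecomposable hY
  refine h.map (QuiverRep.tauInv k Q)
    (fun M => ∀ j : Paths Q, Subsingleton ((inj k Q).obj (Opposite.op j) ⟶ M))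
    (hom_inj_eq_zero h.pair.exceptional_right.indecomposable fun hX => h.not_subsingleton_ext
      (Ext.subsingleton_of_injective _ _ 0))
    (hom_inj_eq_zero h.exceptional.indecomposable fun hZ => hY ?_) hYI
    (fun M hM => hM.tauInv hQ)
    (fun M N _ hN hMf hNf => ⟨tauInv_map_injective hQ hMf hN, tauInv_map_surjective hQ hMf hNf⟩)
    -- Ext¹(M, N) = 0 gives Hom(τ⁻¹N, M) = 0, which gives Ext¹(τ⁻¹M, τ⁻¹N) = 0.
    (fun M N hM hN hMN => subsingleton_ext_tauInv hQ (hN.tauInv hQ)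
      (subsingleton_hom_tauInv hQ hM hMN))
    (shortExact_tauInv w hS fun j => ⟨fun φ ψ => biproduct.hom_ext _ _ fun _ =>
      (hYI j).elim _ _⟩)
  -- If Z were injective, then so would be its quotient Y.
  obtain ⟨s, hs⟩ := h.exists_epi
  exact injective_of_epi s

end TauInvFunctor

end QuiverRep

end

theorem mainTheorem10 {k : Type u} [Field k] {Q : Type u} [Quiver.{u} Q] [Finite Q]
    [∀ a b : Q, Finite (a ⟶ b)] (hQ : QuiverRep.IsAcyclic Q) {X Z Y : QuiverRep k Q} {m n : ℕ}
    (f : (⨁ fun _ : Fin m => X) ⟶ Z) (g : Z ⟶ ⨁ fun _ : Fin n => Y)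
    (h : QuiverRep.IsSchofieldSequence m n X Z Y f g) :
    (∀ (i : Q) (hi : QuiverRep.IsSink i), ¬ Nonempty (X ≅ QuiverRep.simpleRep k i) →
      QuiverRep.IsSchofieldSequence m n ((QuiverRep.reflectSink k hi).obj X)
        ((QuiverRep.reflectSink k hi).obj Z) ((QuiverRep.reflectSink k hi).obj Y)
        (QuiverRep.mapFrom (QuiverRep.reflectSink k hi) f)
        (QuiverRep.mapTo (QuiverRep.reflectSink k hi) g)) ∧
    (∀ (i : Q) (hi : QuiverRep.IsSource i), ¬ Nonempty (Y ≅ QuiverRep.simpleRep k i) →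
      QuiverRep.IsSchofieldSequence m n ((QuiverRep.reflectSource k hi).obj X)
        ((QuiverRep.reflectSource k hi).obj Z) ((QuiverRep.reflectSource k hi).obj Y)
        (QuiverRep.mapFrom (QuiverRep.reflectSource k hi) f)
        (QuiverRep.mapTo (QuiverRep.reflectSource k hi) g)) ∧
    (¬ Projective X →
      QuiverRep.IsSchofieldSequence m n ((QuiverRep.tau k Q).obj X) ((QuiverRep.tau k Q).obj Z)
        ((QuiverRep.tau k Q).obj Y) (QuiverRep.mapFrom (QuiverRep.tau k Q) f)
        (QuiverRep.mapTo (QuiverRep.tau k Q) g)) ∧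
    (¬ Injective Y →
      QuiverRep.IsSchofieldSequence m n ((QuiverRep.tauInv k Q).obj X)
        ((QuiverRep.tauInv k Q).obj Z) ((QuiverRep.tauInv k Q).obj Y)
        (QuiverRep.mapFrom (QuiverRep.tauInv k Q) f)
        (QuiverRep.mapTo (QuiverRep.tauInv k Q) g)) := by
  refine ⟨fun i hi hX => h.reflectSink hi hX, fun i hi hY => h.reflectSource hi hY,
    fun hX => h.tau hQ hX, fun hY => h.tauInv hQ hY⟩
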